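/- **Conventions.** A *ribbon* is a connected (possibly empty) skew shape $R=\lambda/\mu$ containing no $2\times 2$ block of cells. Let $m=|R|$ be its size, and let $[a,b]=\{j:\lambda_j>\mu_j\}$ be the set of indices of its nonempty rows (so $[a,b-1]=\emptyset$ if $R$ is empty). Label the cells of $R$ by $1,\dots,m$ sequentially, starting from the top-right cell; $\mathrm{Des}(R)$ is the set of $t\in[m-1]$ such that the cell labelled $t$ lies immediately above the cell labelled $t+1$, and $\mathrm{NDes}(R)=[m-1]\setminus\mathrm{Des}(R)$. For $J\subseteq\mathbb N$ put $d(J,R)=\{\sum_{j=1}^{i}(\lambda_j-\mu_j): i\in J\}$. For $\ell(\lambda)\le n$ the $n\times n$ (dual) Jacobi–Trudi matrix of $R$ is $\mathrm{JT}_R(\mathbf x)=\bigl(e_{\lambda_i-\mu_j-i+j}(\mathbf x)\bigr)_{i,j=1}^n$, where $e_d$ is the elementary symmetric function ($e_0=1$, and $e_d=0$ for $d<0$), and $*$ is the entrywise (Hadamard) product. $s_\nu$ is the Schur function, and $f^{\nu}(A)$ is the number of standard Young tableaux of shape $\nu$ with descent set $A$, where $i$ is a descent of a tableau if $i+1$ lies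 in a strictly lower row than $i$. Let $\mathrm{TL}_n(2)$ be the $\mathbb C$-algebra generated by $t_1,\dots,t_{n-1}$ with the relations $t_i^2=2t_i$, $t_it_jt_i=t_i$ if $|i-j|=1$, and $t_it_j=t_jt_i$ if $|i-j|\ge2$; it has as a basis the Kauffman diagrams (noncrossing perfect matchings of $n$ left and $n$ right points), multiplied by concatenation with every closed loop replaced by a factor $2$. Let $\theta:\mathbb C[\mathfrak S_n]\to \mathrm{TL}_n(2)$ be the algebra homomorphism with $\theta(\mathsf s_i)=t_i-1$, where $\mathsf s_i=(i,i+1)$ and permutations are composed from left to right. For a Kauffman diagram $\tau$ let $f_\tau(w)$ be the coefficient of $\tau$ in $\theta(w)$, and let $\mathrm{imm}_\tau(M)=\sum_{w\in\mathfrak S_n}f_\tau(w)\,M_{1,w(1)}\cdots M_{n,w(n)}$. For $I\subseteq[n-1]$ let $\tau(I)=\prod_{i\in I}t_i$ (product in increasing order), which is a Kauffman diagram. **Theorem.** Let $k\ge1$ and $I\subseteq[n-1]$. (1) Let $R^{(i)}=\lambda^{(i)}/\mu^{(i)}$, $1\le i\le k$, be ribbons with $\ell(\lambda^{(i)})\le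 n$, let $m_i$ be the size of $R^{(i)}$, and let $[a_i,b_i]=\{j:\lambda^{(i)}_j>\mu^{(i)}_j\}$. Then $$\mathrm{imm}_{\tau(I)}\bigl(\mathrm{JT}_{R^{(1)}}(\mathbf x^{(1)})*\cdots*\mathrm{JT}_{R^{(k)}}(\mathbf x^{(k)})\bigr)=\sum_{\nu_1\vdash m_1,\dots,\nu_k\vdash m_k}\Bigl(\sum_{\substack{I_i\subseteq[a_i,b_i-1]\\ I_1\cap\cdots\cap I_k=I}}\ \prod_{i=1}^k f^{\nu_i}\bigl(\mathrm{NDes}(R^{(i)})\cup d(I_i,R^{(i)})\bigr)\Bigr)\,s_{\nu_1}(\mathbf x^{(1)})\cdots s_{\nu_k}(\mathbf x^{(k)}).$$ (2) Let $R=\lambda/\mu$ be a ribbon of size $m$ with $\ell(\lambda)\le n$. Then $$\mathrm{imm}_{\tau(I)}\bigl(\mathrm{JT}_{R}(\mathbf x^{(1)})*\cdots*\mathrm{JT}_{R}(\mathbf x^{(k)})\bigr)=\sum_{\nu_1,\dots,\nu_k\vdash m}\Bigl(\sum_{\substack{A_1,\dots,A_k\subseteq[m-1]\\ A_1\cap\cdots\cap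 A_k=\mathrm{NDes}(R)\cup d(I,R)}} f^{\nu_1}(A_1)\cdots f^{\nu_k}(A_k)\Bigr)\,s_{\nu_1}(\mathbf x^{(1)})\cdots s_{\nu_k}(\mathbf x^{(k)}).$$ In both expansions the coefficients are manifestly nonnegative integers. -/

import Mathlib

namespace RibbonImmanant

/-! ### Kauffman diagrams

A Kauffman diagram has `n` points on the left (`Sum.inl i`) and `n` points on the right
(`Sum.inr i`), `0 ≤ i < n`, joined in pairs by `n` nonintersecting arcs drawn inside the convex
hull of the points. Index `i` here is index `i + 1` in one-based numbering, for points as well as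
for generators: `i : Fin (n - 1)` stands for the generator with one-based index `i + 1`. -/

/-- The position of a point on the boundary of the convex hull: up the left side, then down the
right side. -/
def boundaryPos (n : ℕ) : Fin n ⊕ Fin n → ℕ
  | .inl i => i
  | .inr i => 2 * n - 1 - i

/-- Kauffman diagrams: noncrossing perfect matchings of the `2n` points. Two arcs drawn in the convex
hull cross exactly when their end points alternate along the boundary. -/
@[ext]
structure KauffmanDiagram (n : ℕ) where
  partner : Fin n ⊕ Fin n → Fin n ⊕ Fin n
  partner_partner : ∀ p, partner (partner p) = p
  partner_ne : ∀ p, partner p ≠ p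
  noncrossing : ∀ p q, ¬ (boundaryPos n p < boundaryPos n q ∧
    boundaryPos n q < boundaryPos n (partner p) ∧
    boundaryPos n (partner p) < boundaryPos n (partner q))

/-- The lower of the two points that the `i`-th generator acts on. -/
def lo {n : ℕ} (i : Fin (n - 1)) : Fin n := ⟨i, by omega⟩
/-- The upper of the two points that the `i`-th generator acts on. -/
def hi {n : ℕ} (i : Fin (n - 1)) : Fin n := ⟨i + 1, by omega⟩

/-- Join `a` with `b`, and join the former partners of `a` and `b` with each other. -/
def rewire {P : Type*} [DecidableEq P] (a b : P) (m : P → P) (p : P) : P :=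
  if p = a then b else if p = b then a
  else if p = m a then m b else if p = m b then m a else m p

section rewire
variable {P : Type*} [DecidableEq P] {m : P → P}

theorem rewire_rewire (hm : ∀ p, m (m p) = p) (hf : ∀ p, m p ≠ p) (a b : P) (p : P) :
    rewire a b m (rewire a b m p) = p := by
  grind [rewire]

theorem rewire_ne (hm : ∀ p, m (m p) = p) (hf : ∀ p, m p ≠ p) (a b : P) (hab : a ≠ b) (p : P) :
    rewire a b m p ≠ p := by
  grind [rewire]

theorem rewire_idem (hm : ∀ p, m (m p) = p) (a b : P) (hab : a ≠ b) :
    rewire a b (rewire a b m) = rewire a b m := by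
  funext p; grind [rewire]

theorem rewire_braid (hm : ∀ p, m (m p) = p) (hf : ∀ p, m p ≠ p) (a b c : P) (hab : a ≠ b) (hbc : b ≠ c) (hac : a ≠ c) :
    rewire a b (rewire b c (rewire a b m)) = rewire a b m := by
  funext p; grind [rewire]

theorem rewire_comm (hm : ∀ p, m (m p) = p) (hf : ∀ p, m p ≠ p) (a b c d : P) (hab : a ≠ b) (hbc : b ≠ c) (hac : a ≠ c)
    (hbd : b ≠ d) (had : a ≠ d) (hcd : c ≠ d) :
    rewire a b (rewire c d m) = rewire c d (rewire a b m) := by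
  funext p; grind (splits := 25) [rewire]
end rewire

theorem boundaryPos_injective (n : ℕ) : Function.Injective (boundaryPos n) := by
  rintro (i | i) (j | j) h <;> simp only [boundaryPos] at h
  · exact congrArg _ (Fin.ext h)
  · omega
  · omega
  · exact congrArg _ (Fin.ext (by omega))

/-- The diagram of the identity: all arcs are horizontal. -/
def KauffmanDiagram.id (n : ℕ) : KauffmanDiagram n where
  partner := Sum.swap
  partner_partner := Sum.swap_swap
  partner_ne := by rintro (i | i) <;> simp
  noncrossing := by
    rintro (i | i) (j | j) <;> simp [boundaryPos] <;> omega

theorem rewire_noncrossing {P : Type*} [DecidableEq P] {m : P → P} (f : P → ℕ)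
   (hfi : Function.Injective f) (hm : ∀ p, m (m p) = p) (hf : ∀ p, m p ≠ p)
   (hnc : ∀ p q, ¬ (f p < f q ∧ f q < f (m p) ∧ f (m p) < f (m q)))
   (a b : P) (hab : f b = f a + 1) (p q : P) :
   ¬ (f p < f q ∧ f q < f (rewire a b m p) ∧ f (rewire a b m p) < f (rewire a b m q)) := by
  have hne : ∀ x y, x ≠ y → f x ≠ f y := fun x y h h' => h (hfi h')
  have hab' : a ≠ b := fun h => by subst h; omega
  -- the rewired chord `(m a, m b)` against an old chord `(x, m x)`
  have cross : ∀ x, x ≠ a → x ≠ b → m x ≠ a → m x ≠ b →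
      ¬ (f (m a) < f x ∧ f x < f (m b) ∧ f (m b) < f (m x)) ∧
      ¬ (f (m b) < f x ∧ f x < f (m a) ∧ f (m a) < f (m x)) ∧
      ¬ (f x < f (m a) ∧ f (m a) < f (m x) ∧ f (m x) < f (m b)) ∧
      ¬ (f x < f (m b) ∧ f (m b) < f (m x) ∧ f (m x) < f (m a)) := by
    intro x h1 h2 h3 h4
    have e1 := hne _ _ h1
    have e2 := hne _ _ h2
    have e3 := hne _ _ h3
    have e4 := hne _ _ h4
    have ha := hm a
    have hb := hm b
    have hx := hm x
    refine ⟨?_, ?_, ?_, ?_⟩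
    · have A1 := hnc (m a) x
      have A2 := hnc b x
      have A3 := hnc x (m b)
      rw [ha] at A1
      rw [hb] at A3
      clear hnc hne
      omega
    · have A1 := hnc (m b) x
      have A2 := hnc a x
      have A3 := hnc x (m a)
      rw [hb] at A1
      rw [ha] at A3
      clear hnc hne
      omega
    · have A1 := hnc x b
      have A2 := hnc a x
      have A3 := hnc x (m a)
      rw [ha] at A3
      clear hnc hne
      omega
    · have A1 := hnc x a
      have A2 := hnc b x
      have A3 := hnc x (m b)
      rw [hb] at A3
      clear hnc hne
      omega
  have ma : ∀ x, m x = a ↔ x = m a := fun x => ⟨fun h => by rw [← h, hm], fun h => by rw [h, hm]⟩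
  have mb : ∀ x, m x = b ↔ x = m b := fun x => ⟨fun h => by rw [← h, hm], fun h => by rw [h, hm]⟩
  simp only [ne_eq, ma, mb] at cross
  have cp := cross p
  have cq := cross q
  have n1 := hne p a
  have n2 := hne p b
  have n3 := hne q a
  have n4 := hne q b
  have n5 := hne (m p) a
  have n6 := hne (m p) b
  have n7 := hne (m q) a
  have n8 := hne (m q) b
  have hpq := hnc p q
  rw [ne_eq, ma] at n5 n7
  rw [ne_eq, mb] at n6 n8
  clear hnc hne cross ma mb hf hm hfi
  unfold rewire
  by_cases pa : p = a
  · subst pa; rw [if_pos rfl]; omega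
  by_cases pb : p = b
  · subst pb; rw [if_neg pa, if_pos rfl]; omega
  by_cases qa : q = a
  · subst qa; simp only [if_pos]; omega
  by_cases qb : q = b
  · subst qb; rw [if_neg qa, if_pos rfl]; omega
  rw [if_neg pa, if_neg pb, if_neg qa, if_neg qb]
  by_cases pma : p = m a
  · subst pma
    rw [if_pos rfl]
    split_ifs with h1 h2
    · subst h1; omega
    · subst h2; omega
    · have := cq qa qb h1 h2; omega
  by_cases pmb : p = m b
  · subst pmb
    rw [if_neg pma, if_pos rfl]
    split_ifs with h1 h2
    · subst h1; omega
    · subst h2; omega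
    · have := cq qa qb h1 h2; omega
  rw [if_neg pma, if_neg pmb]
  have := cp pa pb pma pmb
  split_ifs with h1 h2
  · subst h1; omega
  · subst h2; omega
  · exact hpq

/-! ### The symmetric group -/

/-- The simple transposition of `i` and `i + 1`. -/
def simpleRefl {n : ℕ} (i : Fin (n - 1)) : Equiv.Perm (Fin n) := Equiv.swap (lo i) (hi i)

theorem lo_ne_hi {n : ℕ} (i : Fin (n - 1)) : lo i ≠ hi i := by simp [lo, hi]

section presentation

/-! A map on the simple transpositions that respects the Coxeter relations extends to the
symmetric group (`exists_perm_hom`). -/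

variable {n : ℕ} {M : Type*} [Monoid M] {g : Fin (n - 1) → M}

theorem simpleRefl_lo (i : Fin (n - 1)) : simpleRefl i (lo i) = hi i := Equiv.swap_apply_left ..
theorem simpleRefl_hi (i : Fin (n - 1)) : simpleRefl i (hi i) = lo i := Equiv.swap_apply_right ..
theorem simpleRefl_of_ne (i : Fin (n - 1)) (x : Fin n) (h : x ≠ lo i) (h' : x ≠ hi i) :
    simpleRefl i x = x := Equiv.swap_apply_of_ne_of_ne h h'
theorem mul_simpleRefl_cancel (w : Equiv.Perm (Fin n)) (i : Fin (n - 1)) :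
    w * simpleRefl i * simpleRefl i = w := by
  rw [mul_assoc, simpleRefl, Equiv.swap_mul_self, mul_one]

/-- A weight that drops when a descent of a permutation is removed. -/
def permWeight (w : Equiv.Perm (Fin n)) : ℤ := ∑ j : Fin n, ((n : ℤ) - j) * (w j : ℤ)

theorem permWeight_lt {w : Equiv.Perm (Fin n)} {i : Fin (n - 1)} (h : w (hi i) < w (lo i)) :
    permWeight (w * simpleRefl i) < permWeight w := by
  have h1 : permWeight (w * simpleRefl i)
      = ∑ j : Fin n, ((n : ℤ) - (simpleRefl i j : Fin n)) * (w j : ℤ) := by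
    unfold permWeight
    rw [← Equiv.sum_comp (simpleRefl i)]
    refine Finset.sum_congr rfl fun j _ => ?_
    congr 3
    simp [simpleRefl]
  have h2 : permWeight (w * simpleRefl i) - permWeight w = (w (hi i) : ℤ) - w (lo i) := by
    rw [h1, permWeight, ← Finset.sum_sub_distrib, Fintype.sum_eq_add (lo i) (hi i) (lo_ne_hi i)]
    · rw [simpleRefl_lo, simpleRefl_hi]
      simp only [lo, hi]; push_cast; ring
    · rintro x ⟨hx, hx'⟩
      rw [simpleRefl_of_ne i x hx hx']; ring
  have : ((w (hi i) : Fin n) : ℤ) < (w (lo i) : Fin n) := by exact_mod_cast h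
  omega

theorem permWeight_nonneg (w : Equiv.Perm (Fin n)) : 0 ≤ permWeight w :=
  Finset.sum_nonneg fun j _ => mul_nonneg (by have := j.2; omega) (by positivity)

theorem exists_descent {w : Equiv.Perm (Fin n)} (h : w ≠ 1) : ∃ i : Fin (n - 1), w (hi i) < w (lo i) := by
  by_contra! hc
  apply h
  have hmono : StrictMono w := by
    cases n with
    | zero => exact Subsingleton.strictMono _
    | succ k =>
      rw [Fin.strictMono_iff_lt_succ]
      intro i
      refine lt_of_le_of_ne (hc ⟨i, by omega⟩) fun e => ?_
      have := w.injective e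
      simp [Fin.ext_iff] at this
  have := (hmono.range_inj (strictMono_id (α := Fin n))).1 (by rw [w.surjective.range_eq]; simp)
  ext x
  rw [this]; rfl

/-- Evaluation of reduced words. -/
inductive Reduced (g : Fin (n - 1) → M) : Equiv.Perm (Fin n) → M → Prop
  | one : Reduced g 1 1
  | step {w x i} : w (lo i) < w (hi i) → Reduced g w x → Reduced g (w * simpleRefl i) (x * g i)

theorem Reduced.cases_descent {w : Equiv.Perm (Fin n)} {x : M} (h : Reduced g w x) :
    (w = 1 ∧ x = 1) ∨ ∃ i y, w (hi i) < w (lo i) ∧ Reduced g (w * simpleRefl i) y ∧ x = y * g i := by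
  cases h with
  | one => exact .inl ⟨rfl, rfl⟩
  | @step w x i h1 h2 =>
    refine .inr ⟨i, x, ?_, ?_, rfl⟩
    · simpa [simpleRefl_lo, simpleRefl_hi] using h1
    · rwa [mul_simpleRefl_cancel]

theorem Reduced.of_descent {w : Equiv.Perm (Fin n)} {y : M} {i : Fin (n - 1)}
    (h : w (hi i) < w (lo i)) (hy : Reduced g (w * simpleRefl i) y) : Reduced g w (y * g i) := by
  rw [← mul_simpleRefl_cancel w i]
  exact .step (by simpa [simpleRefl_lo, simpleRefl_hi] using h) hy

theorem Reduced.exists (g : Fin (n - 1) → M) (w : Equiv.Perm (Fin n)) : ∃ x, Reduced g w x := by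
  induction hN : (permWeight w).toNat using Nat.strong_induction_on generalizing w with
  | _ N ih =>
    by_cases h : w = 1
    · exact ⟨1, h ▸ .one⟩
    obtain ⟨i, hi⟩ := exists_descent h
    have := permWeight_lt hi
    have := permWeight_nonneg w
    obtain ⟨y, hy⟩ := ih _ (by have := permWeight_nonneg (w * simpleRefl i); omega) (w * simpleRefl i) rfl
    exact ⟨_, .of_descent hi hy⟩

theorem simpleRefl_comm {i j : Fin (n - 1)} (h : (i : ℕ) + 2 ≤ j) :
    simpleRefl i * simpleRefl j = simpleRefl j * simpleRefl i := by
  refine (Equiv.Perm.disjoint_iff_disjoint_support.mpr ?_).commute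
  rw [simpleRefl, simpleRefl, Equiv.Perm.support_swap (lo_ne_hi i), Equiv.Perm.support_swap (lo_ne_hi j)]
  rw [Finset.disjoint_left]
  simp only [Finset.mem_insert, Finset.mem_singleton, lo, hi]
  rintro x (rfl | rfl) <;> simp [Fin.ext_iff] <;> omega

theorem simpleRefl_braid {i j : Fin (n - 1)} (h : (i : ℕ) + 1 = j) :
    simpleRefl i * simpleRefl j * simpleRefl i = simpleRefl j * simpleRefl i * simpleRefl j := by
  have e : lo j = hi i := by simp [lo, hi, h]
  have h1 := lo_ne_hi i
  have h2 := lo_ne_hi j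
  have h3 : lo i ≠ hi j := by simp only [lo, hi, ne_eq, Fin.mk.injEq]; omega
  rw [e] at h2
  unfold simpleRefl
  rw [e]
  ext x
  simp only [Equiv.Perm.mul_apply, Equiv.swap_apply_def]
  congr 1
  grind

theorem Reduced.unique (hcomm : ∀ i j : Fin (n - 1), (i : ℕ) + 2 ≤ j → g i * g j = g j * g i)
    (hbraid : ∀ i j : Fin (n - 1), (i : ℕ) + 1 = j → g i * g j * g i = g j * g i * g j)
    {w : Equiv.Perm (Fin n)} {x x' : M} (h : Reduced g w x) (h' : Reduced g w x') : x = x' := by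
  induction hN : (permWeight w).toNat using Nat.strong_induction_on generalizing w x x' with
  | _ N ih =>
  have IH : ∀ {v : Equiv.Perm (Fin n)} {z z' : M} {i : Fin (n - 1)}, w (hi i) < w (lo i) →
      v = w * simpleRefl i → Reduced g v z → Reduced g v z' → z = z' := by
    intro v z z' i hi hv hz hz'
    have h1 := permWeight_lt hi
    rw [← hv] at h1
    have := permWeight_nonneg v
    exact ih _ (by omega) hz hz' rfl
  have hone : ∀ i : Fin (n - 1), ¬ ((1 : Equiv.Perm (Fin n)) (hi i) < (1 : Equiv.Perm (Fin n)) (lo i)) := by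
    intro i; simp [lo, hi, Fin.lt_def]
  -- the diamond, for two different descents
  have diamond : ∀ {i j : Fin (n - 1)} {y y' : M}, (i : ℕ) < j → w (hi i) < w (lo i) →
      w (hi j) < w (lo j) → Reduced g (w * simpleRefl i) y → Reduced g (w * simpleRefl j) y' →
      y * g i = y' * g j := by
    intro i j y y' hij hdi hdj hy hy'
    by_cases hfar : (i : ℕ) + 2 ≤ j
    · obtain ⟨z, hz⟩ := Reduced.exists g (w * simpleRefl i * simpleRefl j)
      have ne1 : hi j ≠ lo i := by simp only [lo, hi, ne_eq, Fin.mk.injEq]; omega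
      have ne2 : hi j ≠ hi i := by simp only [lo, hi, ne_eq, Fin.mk.injEq]; omega
      have ne3 : lo j ≠ lo i := by simp only [lo, hi, ne_eq, Fin.mk.injEq]; omega
      have ne4 : lo j ≠ hi i := by simp only [lo, hi, ne_eq, Fin.mk.injEq]; omega
      have r1 : Reduced g (w * simpleRefl i) (z * g j) := .of_descent (by
        simp only [Equiv.Perm.mul_apply, simpleRefl_of_ne i _ ne1 ne2, simpleRefl_of_ne i _ ne3 ne4]
        exact hdj) hz
      have r2 : Reduced g (w * simpleRefl j) (z * g i) := .of_descent (by
        simp only [Equiv.Perm.mul_apply, simpleRefl_of_ne j _ ne3.symm ne1.symm,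
          simpleRefl_of_ne j _ ne4.symm ne2.symm]
        exact hdi) (by rwa [mul_assoc, ← simpleRefl_comm hfar, ← mul_assoc])
      rw [IH hdi rfl hy r1, IH hdj rfl hy' r2, mul_assoc, mul_assoc, hcomm i j hfar]
    · have hadj : (i : ℕ) + 1 = j := by omega
      have e : lo j = hi i := by simp [lo, hi, hadj]
      have ne1 : hi j ≠ lo i := by simp only [lo, hi, ne_eq, Fin.mk.injEq]; omega
      have ne2 : hi j ≠ hi i := by simp only [lo, hi, ne_eq, Fin.mk.injEq]; omega
      rw [e] at hdj
      obtain ⟨z, hz⟩ := Reduced.exists g (w * simpleRefl i * simpleRefl j * simpleRefl i)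
      have ej : simpleRefl j (hi i) = hi j := by rw [← e]; exact simpleRefl_lo j
      have ej' : simpleRefl j (hi j) = hi i := by rw [← e]; exact simpleRefl_hi j
      have ej'' : simpleRefl j (lo i) = lo i := simpleRefl_of_ne j _ (by rw [e]; exact lo_ne_hi i) ne1.symm
      have ei := simpleRefl_of_ne i _ ne1 ne2
      have r1 : Reduced g (w * simpleRefl i * simpleRefl j) (z * g i) := .of_descent (by
        simp only [Equiv.Perm.mul_apply, ej, ej'', simpleRefl_lo, ei]
        exact hdj) hz
      have r2 : Reduced g (w * simpleRefl i) (z * g i * g j) := .of_descent (by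
        simp only [Equiv.Perm.mul_apply, e, simpleRefl_hi, ei]
        exact hdj.trans hdi) r1
      have r3 : Reduced g (w * simpleRefl j * simpleRefl i) (z * g j) := .of_descent (by
        simp only [Equiv.Perm.mul_apply, e, simpleRefl_hi, ei, ej', ej'']
        exact hdi) (by
          rw [mul_assoc, mul_assoc, ← mul_assoc (simpleRefl j), ← simpleRefl_braid hadj]
          simpa only [mul_assoc] using hz)
      have r4 : Reduced g (w * simpleRefl j) (z * g j * g i) := .of_descent (by
        simp only [Equiv.Perm.mul_apply, ej, ej'']
        exact hdj.trans hdi) r3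
      have := hbraid i j hadj
      rw [IH hdi rfl hy r2, IH (i := j) (by rw [e]; exact hdj) rfl hy' r4]
      simp only [mul_assoc] at this ⊢
      rw [this]
  rcases h.cases_descent with ⟨rfl, rfl⟩ | ⟨i, y, hdi, hy, rfl⟩
  · rcases h'.cases_descent with ⟨-, rfl⟩ | ⟨j, y', hdj, -, -⟩
    · rfl
    · exact absurd hdj (hone j)
  · rcases h'.cases_descent with ⟨rfl, -⟩ | ⟨j, y', hdj, hy', rfl⟩
    · exact absurd hdi (hone i)
    · rcases lt_trichotomy (i : ℕ) j with hlt | heq | hgt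
      · exact diamond hlt hdi hdj hy hy'
      · obtain rfl := Fin.ext heq
        rw [IH hdi rfl hy hy']
      · exact (diamond hgt hdj hdi hy' hy).symm

theorem exists_perm_hom (hsq : ∀ i, g i * g i = 1)
    (hcomm : ∀ i j : Fin (n - 1), (i : ℕ) + 2 ≤ j → g i * g j = g j * g i)
    (hbraid : ∀ i j : Fin (n - 1), (i : ℕ) + 1 = j → g i * g j * g i = g j * g i * g j) :
    ∃ F : Equiv.Perm (Fin n) →* M, ∀ i, F (simpleRefl i) = g i := by
  choose F hF using Reduced.exists g
  have uniq : ∀ {w x}, Reduced g w x → F w = x := fun h => Reduced.unique hcomm hbraid (hF _) h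
  have hstep : ∀ w i, F (w * simpleRefl i) = F w * g i := by
    intro w i
    rcases lt_or_ge (w (lo i)) (w (hi i)) with h | h
    · exact uniq (.step h (hF w))
    · have h' := lt_of_le_of_ne h (fun e => lo_ne_hi i (w.injective e).symm)
      rw [uniq (.of_descent h' (hF (w * simpleRefl i))), mul_assoc, hsq, mul_one]
  have hone : F 1 = 1 := uniq .one
  have hmul : ∀ v x, Reduced g v x → ∀ w, F (w * v) = F w * F v := by
    intro v x hv
    induction hv with
    | one => intro w; rw [mul_one, hone, mul_one]
    | step _ _ ih => intro w; rw [← mul_assoc, hstep, hstep, ih, mul_assoc]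
  refine ⟨⟨⟨F, hone⟩, fun w v => hmul v _ (hF v) w⟩, fun i => ?_⟩
  have := hstep 1 i
  rwa [one_mul, hone, one_mul] at this

end presentation

/-! ### The Temperley--Lieb algebra -/

/-- The defining relations of the Temperley--Lieb algebra. -/
inductive TemperleyLiebRel (ξ : ℂ) (n : ℕ) :
    FreeAlgebra ℂ (Fin (n - 1)) → FreeAlgebra ℂ (Fin (n - 1)) → Prop
  | sq (i) : TemperleyLiebRel ξ n (FreeAlgebra.ι ℂ i * FreeAlgebra.ι ℂ i) (ξ • FreeAlgebra.ι ℂ i)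
  | braid (i j : Fin (n - 1)) : (i : ℕ) + 1 = j ∨ (j : ℕ) + 1 = i → TemperleyLiebRel ξ n
      (FreeAlgebra.ι ℂ i * FreeAlgebra.ι ℂ j * FreeAlgebra.ι ℂ i) (FreeAlgebra.ι ℂ i)
  | comm (i j : Fin (n - 1)) : (i : ℕ) + 2 ≤ j ∨ (j : ℕ) + 2 ≤ i → TemperleyLiebRel ξ n
      (FreeAlgebra.ι ℂ i * FreeAlgebra.ι ℂ j) (FreeAlgebra.ι ℂ j * FreeAlgebra.ι ℂ i)

/-- The Temperley--Lieb algebra: generators `t_1, …, t_{n-1}`, with the relations `t_i ^ 2 = ξ t_i`,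
`t_i t_j t_i = t_i` if `|i - j| = 1`, and `t_i t_j = t_j t_i` if `|i - j| ≥ 2`. -/
abbrev TemperleyLieb (ξ : ℂ) (n : ℕ) : Type := RingQuot (TemperleyLiebRel ξ n)

namespace TemperleyLieb
variable {ξ : ℂ} {n : ℕ}

/-- The generators `t_i`. -/
noncomputable def tGen (ξ : ℂ) {n : ℕ} (i : Fin (n - 1)) : TemperleyLieb ξ n :=
  RingQuot.mkAlgHom ℂ (TemperleyLiebRel ξ n) (FreeAlgebra.ι ℂ i)

theorem t_sq (i : Fin (n - 1)) : tGen ξ i * tGen ξ i = ξ • tGen ξ i := by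
  have := RingQuot.mkAlgHom_rel ℂ (TemperleyLiebRel.sq (ξ := ξ) i)
  rw [map_mul, map_smul] at this
  exact this

theorem t_braid {i j : Fin (n - 1)} (h : (i : ℕ) + 1 = j ∨ (j : ℕ) + 1 = i) :
    tGen ξ i * tGen ξ j * tGen ξ i = tGen ξ i := by
  have := RingQuot.mkAlgHom_rel ℂ (TemperleyLiebRel.braid (ξ := ξ) i j h)
  simp only [map_mul] at this
  exact this

theorem t_comm {i j : Fin (n - 1)} (h : (i : ℕ) + 2 ≤ j ∨ (j : ℕ) + 2 ≤ i) :
    tGen ξ i * tGen ξ j = tGen ξ j * tGen ξ i := by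
  have := RingQuot.mkAlgHom_rel ℂ (TemperleyLiebRel.comm (ξ := ξ) i j h)
  simp only [map_mul] at this
  exact this

end TemperleyLieb

open TemperleyLieb (tGen t_sq t_braid t_comm)

/-- The symmetric group with permutations composed from left to right. Mathlib composes
permutations from right to left, so this is the opposite group. -/
abbrev PermL (n : ℕ) : Type := (Equiv.Perm (Fin n))ᵐᵒᵖ

/-- The simple transposition `s_i`. -/
def sGen {n : ℕ} (i : Fin (n - 1)) : PermL n := MulOpposite.op (simpleRefl i)

theorem exists_theta (n : ℕ) : ∃ θ : MonoidAlgebra ℂ (PermL n) →ₐ[ℂ] TemperleyLieb 2 n,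
    ∀ i, θ (MonoidAlgebra.of ℂ _ (sGen i)) = tGen 2 i - 1 := by
  obtain ⟨F, hF⟩ := exists_perm_hom (n := n) (g := fun i => (tGen 2 i - 1 : TemperleyLieb 2 n))
    (fun i => by
      have := t_sq (ξ := 2) i
      simp only [sub_mul, mul_sub, this, one_mul, mul_one, two_smul]; abel)
    (fun i j h => by
      have := t_comm (ξ := 2) (i := i) (j := j) (.inl h)
      simp only [sub_mul, mul_sub, this, one_mul, mul_one]; abel)
    (fun i j h => by
      have h1 := t_braid (ξ := 2) (i := i) (j := j) (.inl h)
      have h2 := t_braid (ξ := 2) (i := j) (j := i) (.inr h)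
      have h3 := t_sq (ξ := 2) i
      have h4 := t_sq (ξ := 2) j
      simp only [sub_mul, mul_sub, h1, h2, h3, h4, one_mul, mul_one, two_smul]; abel)
  refine ⟨MonoidAlgebra.lift ℂ _ _ (F.comp (MulEquiv.inv' (Equiv.Perm (Fin n))).symm.toMonoidHom), fun i => ?_⟩
  simp [sGen, ← hF, simpleRefl]

/-- The algebra homomorphism `θ : ℂ[S_n] → TL_n(2)` determined by `θ(s_i) = t_i - 1`. -/
noncomputable def theta (n : ℕ) : MonoidAlgebra ℂ (PermL n) →ₐ[ℂ] TemperleyLieb 2 n :=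
  (exists_theta n).choose

theorem theta_s {n : ℕ} (i : Fin (n - 1)) :
    theta n (MonoidAlgebra.of ℂ _ (sGen i)) = tGen 2 i - 1 := (exists_theta n).choose_spec i

/-! ### The diagram basis -/

namespace KauffmanDiagram
variable {n : ℕ}

/-- Put the diagram of `t_i` to the left of `D` and remove a closed loop, if there is one. -/
def hook (i : Fin (n - 1)) (D : KauffmanDiagram n) : KauffmanDiagram n where
  partner := rewire (.inl (lo i)) (.inl (hi i)) D.partner
  partner_partner := rewire_rewire D.partner_partner D.partner_ne _ _
  partner_ne := rewire_ne D.partner_partner D.partner_ne _ _ (by simp [lo, hi])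
  noncrossing := rewire_noncrossing _ (boundaryPos_injective n) D.partner_partner D.partner_ne
    D.noncrossing _ _ rfl

/-- A closed loop arises exactly if `D` joins the left points `i` and `i + 1`; it counts `ξ`. -/
def loopFactor (ξ : ℂ) (i : Fin (n - 1)) (D : KauffmanDiagram n) : ℂ :=
  if D.partner (.inl (lo i)) = .inl (hi i) then ξ else 1

/-- Left multiplication by `t_i` on linear combinations of diagrams, by concatenation. -/
noncomputable def stack (ξ : ℂ) (i : Fin (n - 1)) : Module.End ℂ (KauffmanDiagram n →₀ ℂ) :=
  Finsupp.linearCombination ℂ fun D => Finsupp.single (hook i D) (loopFactor ξ i D)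

theorem stack_single (ξ : ℂ) (i : Fin (n - 1)) (D : KauffmanDiagram n) (c : ℂ) :
    stack ξ i (Finsupp.single D c) = Finsupp.single (hook i D) (c * loopFactor ξ i D) := by
  simp [stack]

theorem stack_sq (ξ : ℂ) (i : Fin (n - 1)) : stack ξ i * stack ξ i = ξ • stack (n := n) ξ i := by
  refine Finsupp.lhom_ext fun D c => ?_
  have h1 : hook i (hook i D) = hook i D :=
    KauffmanDiagram.ext (rewire_idem D.partner_partner _ _ (by simp [lo, hi]))
  have h2 : loopFactor ξ i (hook i D) = ξ := by simp [loopFactor, hook, rewire]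
  simp only [Module.End.mul_apply, LinearMap.smul_apply, stack_single, h1, h2, Finsupp.smul_single,
    smul_eq_mul]
  congr 1; ring

theorem stack_braid (ξ : ℂ) {i j : Fin (n - 1)} (h : (i : ℕ) + 1 = j ∨ (j : ℕ) + 1 = i) :
    stack ξ i * stack ξ j * stack ξ i = stack (n := n) ξ i := by
  refine Finsupp.lhom_ext fun D c => ?_
  have hab := lo_ne_hi i
  have hcd := lo_ne_hi j
  have hx : (lo j = hi i ∧ hi j ≠ lo i ∧ hi j ≠ hi i) ∨ (hi j = lo i ∧ lo j ≠ lo i ∧ lo j ≠ hi i) := by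
    simp only [lo, hi, ne_eq, Fin.mk.injEq]; omega
  have hm := D.partner_partner
  have hf := D.partner_ne
  have h1 : hook i (hook j (hook i D)) = hook i D := by
    apply KauffmanDiagram.ext
    funext p
    simp only [hook]
    grind (splits := 25) [rewire]
  have h2 : loopFactor ξ j (hook i D) = 1 := by
    simp only [loopFactor, hook]
    grind [rewire]
  have h3 : loopFactor ξ i (hook j (hook i D)) = 1 := by
    simp only [loopFactor, hook]
    grind (splits := 25) [rewire]
  simp only [Module.End.mul_apply, stack_single, h1, h2, h3, mul_one]

theorem stack_comm (ξ : ℂ) {i j : Fin (n - 1)} (h : (i : ℕ) + 2 ≤ j ∨ (j : ℕ) + 2 ≤ i) :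
    stack ξ i * stack ξ j = stack (n := n) ξ j * stack ξ i := by
  refine Finsupp.lhom_ext fun D c => ?_
  have hab := lo_ne_hi i
  have hcd := lo_ne_hi j
  have hx : lo i ≠ lo j ∧ lo i ≠ hi j ∧ hi i ≠ lo j ∧ hi i ≠ hi j := by
    simp only [lo, hi, ne_eq, Fin.mk.injEq]; omega
  have hm := D.partner_partner
  have hf := D.partner_ne
  have h1 : hook i (hook j D) = hook j (hook i D) :=
    KauffmanDiagram.ext (rewire_comm hm hf _ _ _ _ (by simpa using hab) (by simpa using hx.2.2.1)
      (by simpa using hx.1) (by simpa using hx.2.2.2) (by simpa using hx.2.1) (by simpa using hcd))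
  have h2 : loopFactor ξ j D * loopFactor ξ i (hook j D)
      = loopFactor ξ i D * loopFactor ξ j (hook i D) := by
    simp only [loopFactor, hook]
    grind (splits := 25) [rewire]
  simp only [Module.End.mul_apply, stack_single, h1, mul_assoc, h2]

end KauffmanDiagram

/-- The action of the Temperley--Lieb algebra on linear combinations of diagrams. -/
noncomputable def diagramAction (ξ : ℂ) (n : ℕ) :
    TemperleyLieb ξ n →ₐ[ℂ] Module.End ℂ (KauffmanDiagram n →₀ ℂ) :=
  RingQuot.liftAlgHom ℂ ⟨FreeAlgebra.lift ℂ (KauffmanDiagram.stack ξ), by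
    rintro x y (i | ⟨i, j, h⟩ | ⟨i, j, h⟩)
    · simpa using KauffmanDiagram.stack_sq ξ i
    · simpa using KauffmanDiagram.stack_braid ξ h
    · simpa using KauffmanDiagram.stack_comm ξ h⟩

theorem diagramAction_t (ξ : ℂ) {n : ℕ} (i : Fin (n - 1)) :
    diagramAction ξ n (tGen ξ i) = KauffmanDiagram.stack ξ i := by
  simp [diagramAction, tGen]

/-- The expansion of an element of the Temperley--Lieb algebra in the basis of Kauffman diagrams: its
product with the identity diagram. -/
noncomputable def diagramExpansion (ξ : ℂ) (n : ℕ) :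
    TemperleyLieb ξ n →ₗ[ℂ] (KauffmanDiagram n →₀ ℂ) :=
  (LinearMap.applyₗ (Finsupp.single (KauffmanDiagram.id n) 1)).comp (diagramAction ξ n).toLinearMap

/-- The diagram `τ(I)` of the product of the `t_i`, `i ∈ I`, in increasing order; see
`diagramExpansion_theta_beta`. -/
def tau {n : ℕ} (I : Finset (Fin (n - 1))) : KauffmanDiagram n :=
  (I.sort (· ≤ ·)).foldr KauffmanDiagram.hook (KauffmanDiagram.id n)

/-- `β(I)` is the product of the `1 + s_i`, `i ∈ I`, in increasing order. -/
noncomputable def beta {n : ℕ} (I : Finset (Fin (n - 1))) : MonoidAlgebra ℂ (PermL n) :=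
  ((I.sort (· ≤ ·)).map fun i => 1 + MonoidAlgebra.of ℂ _ (sGen i)).prod

theorem foldr_hook_partner {n : ℕ} (l : List (Fin (n - 1))) (x : Fin n)
    (h : ∀ i ∈ l, (x : ℕ) < i) :
    (l.foldr KauffmanDiagram.hook (KauffmanDiagram.id n)).partner (.inl x) = .inr x := by
  induction l with
  | nil => rfl
  | cons i l ih =>
    have hi' := h i (by simp)
    have ih := ih fun j hj => h j (by simp [hj])
    rw [List.foldr_cons]
    set D := l.foldr KauffmanDiagram.hook (KauffmanDiagram.id n)
    have hm := D.partner_partner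
    have e1 : x ≠ lo i := by simp only [lo, ne_eq, Fin.ext_iff]; omega
    have e2 : x ≠ hi i := by simp only [hi, ne_eq, Fin.ext_iff]; omega
    simp only [KauffmanDiagram.hook]
    grind [rewire]

/-- `τ(I) = θ(β(I))`. -/
theorem diagramExpansion_theta_beta {n : ℕ} (I : Finset (Fin (n - 1))) :
    diagramExpansion 2 n (theta n (beta I)) = Finsupp.single (tau I) 1 := by
  have h1 : theta n (beta I) = ((I.sort (· ≤ ·)).map fun i => tGen 2 i).prod := by
    rw [beta, map_list_prod, List.map_map]
    congr 2
    funext i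
    simp only [Function.comp, map_add, map_one, theta_s]; abel
  rw [h1, tau, diagramExpansion]
  have hs : (I.sort (· ≤ ·)).Pairwise (· < ·) := (I.sortedLT_sort).pairwise
  generalize I.sort (· ≤ ·) = l at hs
  change diagramAction 2 n _ _ = _
  induction l with
  | nil => simp
  | cons i l ih =>
    rw [List.pairwise_cons] at hs
    have hp := foldr_hook_partner l (lo i) (fun j hj => hs.1 j hj)
    rw [List.map_cons, List.prod_cons, map_mul, Module.End.mul_apply, ih hs.2, diagramAction_t,
      KauffmanDiagram.stack_single, List.foldr_cons]
    simp [KauffmanDiagram.loopFactor, hp]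

/-! ### Immanants -/

/-- The function `f_τ`: the coefficient of `τ` in `θ(w)`. -/
noncomputable def tlFunction {n : ℕ} (τ : KauffmanDiagram n) (w : Equiv.Perm (Fin n)) : ℂ :=
  diagramExpansion 2 n (theta n (MonoidAlgebra.of ℂ (PermL n) (MulOpposite.op w))) τ

/-- The `f`-immanant of a matrix. -/
noncomputable def immanant {n : ℕ} {A : Type*} [CommRing A] [Algebra ℂ A]
    (f : Equiv.Perm (Fin n) → ℂ) (M : Matrix (Fin n) (Fin n) A) : A :=
  ∑ w : Equiv.Perm (Fin n), f w • ∏ i, M i (w i)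

/-- The Temperley--Lieb immanant of a Kauffman diagram. -/
noncomputable def tlImmanant {n : ℕ} {A : Type*} [CommRing A] [Algebra ℂ A]
    (τ : KauffmanDiagram n) (M : Matrix (Fin n) (Fin n) A) : A :=
  immanant (tlFunction τ) M

/-- The entrywise product of a family of matrices. -/
def hadamardProd {k n : ℕ} {A : Type*} [CommRing A] (M : Fin k → Matrix (Fin n) (Fin n) A) :
    Matrix (Fin n) (Fin n) A :=
  Matrix.of fun p q => ∏ i, M i p q

/-! ### Skew shapes and ribbons

Rows and columns of Young diagrams are numbered from `0`. -/

/-- A skew shape `λ/μ`, where `λ = outer` and `μ = inner`. -/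
structure SkewShape where
  outer : YoungDiagram
  inner : YoungDiagram
  inner_le : inner ≤ outer

namespace SkewShape

/-- The cells of `λ/μ`. -/
def cells (R : SkewShape) : Finset (ℕ × ℕ) := R.outer.cells \ R.inner.cells

/-- The number of cells of `λ/μ`. -/
def size (R : SkewShape) : ℕ := R.cells.card

/-- The length `ℓ(λ)`. -/
def length (R : SkewShape) : ℕ := R.outer.colLen 0

/-- The number of cells in a row; the subtraction is not truncated, as `μ ⊆ λ`. -/
def rowSize (R : SkewShape) (j : ℕ) : ℕ := R.outer.rowLen j - R.inner.rowLen j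

/-- A ribbon is a connected skew shape without a `2 × 2` block. Cells that share a side are adjacent.
The empty shape is allowed. -/
def IsRibbon (R : SkewShape) : Prop :=
  ((SimpleGraph.hasse (ℕ × ℕ)).induce (R.cells : Set (ℕ × ℕ))).Preconnected ∧
  ¬ ∃ i j, (i, j) ∈ R.cells ∧ (i, j + 1) ∈ R.cells ∧ (i + 1, j) ∈ R.cells ∧
    (i + 1, j + 1) ∈ R.cells

/-- The label of a cell of a ribbon when its cells are numbered `1, 2, …` from the top-right cell:
the number of cells up to and including `c`, reading rows from top to bottom and each row from right
to left. -/
def label (R : SkewShape) (c : ℕ × ℕ) : ℕ :=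
  (R.cells.filter fun c' => c'.1 < c.1 ∨ (c'.1 = c.1 ∧ c.2 ≤ c'.2)).card

/-- `Des(R)`: those `a ∈ [m - 1]` for which the cell labelled `a` is immediately above the cell
labelled `a + 1`. -/
def des (R : SkewShape) : Finset ℕ :=
  (Finset.Icc 1 (R.size - 1)).filter fun a => ∃ c ∈ R.cells, (c.1 + 1, c.2) ∈ R.cells ∧
    R.label c = a ∧ R.label (c.1 + 1, c.2) = a + 1

/-- `NDes(R) = [m - 1] \ Des(R)`. -/
def ndes (R : SkewShape) : Finset ℕ := Finset.Icc 1 (R.size - 1) \ R.des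

/-- `d(J, R)`: the sums of the sizes of the first `i` rows, for `i ∈ J`. -/
def d (J : Finset ℕ) (R : SkewShape) : Finset ℕ :=
  J.image fun i => ∑ j ∈ Finset.range i, R.rowSize j

/-- The one-based indices of the nonempty rows. For a ribbon this is an interval `[a, b]`. -/
def rows (R : SkewShape) : Set ℕ := {j | 1 ≤ j ∧ R.inner.rowLen (j - 1) < R.outer.rowLen (j - 1)}

/-- The number `a` of the first nonempty row. -/
noncomputable def firstRow (R : SkewShape) : ℕ := sInf R.rows

/-- The number `b` of the last nonempty row. -/
noncomputable def lastRow (R : SkewShape) : ℕ := sSup R.rows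

/-- The set `[a, b - 1]`; it is empty if there is at most one nonempty row. -/
noncomputable def innerRows (R : SkewShape) : Finset ℕ := Finset.Ico R.firstRow R.lastRow

end SkewShape

/-- One-based indexing: the subset of `[n - 1]` that a set of indices in `Fin (n - 1)` stands for. -/
def oneBased {n : ℕ} (I : Finset (Fin (n - 1))) : Finset ℕ := I.image fun i : Fin (n - 1) => (i : ℕ) + 1

open scoped Classical in
/-- The tuples `(J_1, …, J_k)` with `J_i ⊆ S_i` for all `i` and `J_1 ∩ ⋯ ∩ J_k = T`. -/
noncomputable def tuplesWithInter {k : ℕ} (S : Fin k → Finset ℕ) (T : Finset ℕ) :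
    Finset (Fin k → Finset ℕ) :=
  (Fintype.piFinset fun i => (S i).powerset).filter fun J => ⋂ i, (J i : Set ℕ) = (T : Set ℕ)

/-! ### Partitions and tableaux -/

/-- The partitions of `m`. -/
abbrev PartitionOf (m : ℕ) : Type := {ν : YoungDiagram // ν.card = m}

theorem YoungDiagram_cells_subset (ν : YoungDiagram) :
    ν.cells ⊆ Finset.range ν.card ×ˢ Finset.range ν.card := by
  rintro ⟨i, j⟩ h
  have hc : (i, j) ∈ ν := h
  have h1 : ν.colLen j ≤ ν.card := by
    rw [YoungDiagram.colLen_eq_card]; exact Finset.card_le_card (Finset.filter_subset _ _)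
  have h2 : ν.rowLen i ≤ ν.card := by
    rw [YoungDiagram.rowLen_eq_card]; exact Finset.card_le_card (Finset.filter_subset _ _)
  rw [Finset.mem_product, Finset.mem_range, Finset.mem_range]
  exact ⟨(YoungDiagram.mem_iff_lt_colLen.1 hc).trans_le h1,
    (YoungDiagram.mem_iff_lt_rowLen.1 hc).trans_le h2⟩

instance (m : ℕ) : Finite (PartitionOf m) := by
  refine Finite.of_injective
    (β := (Finset.range m ×ˢ Finset.range m).powerset)
    (fun ν => ⟨ν.1.cells, by
      have := YoungDiagram_cells_subset ν.1
      rw [ν.2] at this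
      exact Finset.mem_powerset.2 this⟩) fun ν ν' h => ?_
  exact Subtype.ext (YoungDiagram.ext (congrArg Subtype.val h))

noncomputable instance (m : ℕ) : Fintype (PartitionOf m) := Fintype.ofFinite _

/-- A tableau is standard if each of `1, …, |ν|` appears exactly once. -/
def IsStandard {ν : YoungDiagram} (T : SemistandardYoungTableau ν) : Prop :=
  Set.BijOn (fun c : ℕ × ℕ => T c.1 c.2) ν.cells (Set.Icc 1 ν.card)

/-- The descent set of a standard tableau: those `a` for which `a + 1` is in a lower row than `a`. -/
def tableauDes {ν : YoungDiagram} (T : SemistandardYoungTableau ν) : Set ℕ :=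
  {a | ∃ c ∈ ν.cells, ∃ c' ∈ ν.cells, T c.1 c.2 = a ∧ T c'.1 c'.2 = a + 1 ∧ c.1 < c'.1}

/-- `f^ν(A)`: the number of standard Young tableaux of shape `ν` with descent set `A`. -/
noncomputable def sytCount (ν : YoungDiagram) (A : Finset ℕ) : ℕ :=
  Nat.card {T : SemistandardYoungTableau ν // IsStandard T ∧ tableauDes T = (A : Set ℕ)}

/-! ### Symmetric functions

Symmetric functions are formal power series in variables `x_0, x_1, …`, and multi-symmetric
functions are formal power series in variables `x^{(i)}_j`. -/

/-- The power series in `k` alphabets of variables. -/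
abbrev MultiSeries (k : ℕ) : Type := MvPowerSeries (Fin k × ℕ) ℂ

/-- The power series `f(x)`, written in the variables `x^{(i)}`. -/
noncomputable def inVars {k : ℕ} (i : Fin k) (f : MvPowerSeries ℕ ℂ) : MultiSeries k :=
  MvPowerSeries.rename (Function.Embedding.sectR i ℕ) f

open scoped Classical in
/-- The elementary symmetric function `e_d`: the sum of all squarefree monomials of degree `d`.
It is `0` if `d < 0`. -/
noncomputable def elemSymm (d : ℤ) : MvPowerSeries ℕ ℂ :=
  fun δ => if (δ.degree : ℤ) = d ∧ ∀ v, δ v ≤ 1 then 1 else 0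

/-- The Schur function `s_ν`, the generating function of the semistandard tableaux of shape `ν`: the
coefficient of `x^δ` is the number of tableaux in which each `v` appears `δ v` times. -/
noncomputable def schur (ν : YoungDiagram) : MvPowerSeries ℕ ℂ :=
  fun δ => (Nat.card {T : SemistandardYoungTableau ν //
    ∀ v, (ν.cells.filter fun c => T c.1 c.2 = v).card = δ v} : ℂ)

/-- The `n × n` (dual) Jacobi--Trudi matrix with entries `e_{λ_p - μ_q - p + q}`. -/
noncomputable def jacobiTrudi (n : ℕ) (R : SkewShape) :
    Matrix (Fin n) (Fin n) (MvPowerSeries ℕ ℂ) :=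
  Matrix.of fun p q => elemSymm
    ((R.outer.rowLen p : ℤ) - (R.inner.rowLen q : ℤ) - ((p : ℕ) : ℤ) + ((q : ℕ) : ℤ))

end RibbonImmanant

open RibbonImmanant

/-!
In the Jacobi--Trudi matrix of a ribbon all entries below the subdiagonal vanish, and this persists
under Hadamard products. For such a matrix only the permutations `w_S = ∏_{i ∈ S} s_i` (increasing
product), `S ⊆ [n - 1]`, contribute to an immanant. Since `β(J) = ∏_{i ∈ J} (1 + s_i)` is the sum of
the `w_S` with `S ⊆ J`, and `θ(β(J)) = τ(J)`, the coefficient of `τ(I)` in `θ(w_S)` is the Möbius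
function of the Boolean lattice. Hence `imm_{τ(I)}(M) = c(I)` as soon as
`∏_p M_{p, w_S(p)} = ∑_{J ⊇ S} c(J)` for all `S`.

For a ribbon `R` the product along `w_S` is a product of elementary symmetric functions, one for
each maximal run of rows joined by `S`. By the dual Pieri rule it is the sum of `s_ν` over the
standard tableaux whose descent set contains `NDes(R) ∪ d(S, R)`. Every subset of `[m - 1]`
containing `NDes(R)` is `NDes(R) ∪ d(J, R)` for a unique `J ⊆ [a, b - 1]`, so this is a sum over
`J ⊇ S`, and `c(J)` collects the tableaux with descent set exactly `NDes(R) ∪ d(J, R)`. In the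
product of `k` such sums the tuples `(I_1, …, I_k)` with `S ⊆ I_1 ∩ ⋯ ∩ I_k` are grouped by their
intersection. Part (2) follows since the bijection `J ↦ NDes(R) ∪ d(J, R)` respects intersections.
-/

namespace RibbonImmanant

/-! ### Hessenberg permutations -/

section Hessenberg
variable {n : ℕ}

/-- Upper Hessenberg permutations: those whose permutation matrix vanishes below the first
subdiagonal. -/
def IsHessenbergPerm (w : Equiv.Perm (Fin n)) : Prop := ∀ x : Fin n, (x : ℕ) ≤ (w x : ℕ) + 1

/-- Upper Hessenberg matrices: those which vanish below the first subdiagonal. -/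
def IsHessenberg {A : Type*} [Zero A] (M : Matrix (Fin n) (Fin n) A) : Prop :=
  ∀ p q : Fin n, (q : ℕ) + 1 < p → M p q = 0

/-- The product of the simple transpositions `s_i`, `i ∈ S`, in increasing order, composed from left
to right: one of the terms in the expansion of `β(J)` for `S ⊆ J`. -/
def ascendingPerm (S : Finset (Fin (n - 1))) : Equiv.Perm (Fin n) :=
  ((S.sort (· ≤ ·)).map sGen).prod.unop

theorem ascendingPerm_empty : ascendingPerm (∅ : Finset (Fin (n - 1))) = 1 := by
  simp [ascendingPerm]

theorem ascendingPerm_insert {S : Finset (Fin (n - 1))} {i : Fin (n - 1)} (hmin : ∀ j ∈ S, i < j) :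
    ascendingPerm (insert i S) = ascendingPerm S * simpleRefl i := by
  rw [ascendingPerm, Finset.sort_insert _ (fun j hj => (hmin j hj).le) fun h => (hmin i h).false]
  rfl

theorem ascendingPerm_apply_of_lt {S : Finset (Fin (n - 1))} {x : Fin n}
    (hx : ∀ i ∈ S, (x : ℕ) < i) : ascendingPerm S x = x := by
  induction S using Finset.induction_on_min with
  | empty => simp [ascendingPerm_empty]
  | insert i S hmin ih =>
    have hxi := hx i (Finset.mem_insert_self i S)
    rw [ascendingPerm_insert hmin, Equiv.Perm.mul_apply, simpleRefl_of_ne i x (Fin.ne_of_lt hxi)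
      (Fin.ne_of_lt (Nat.lt_succ_of_lt hxi)), ih fun j hj => hx j (Finset.mem_insert_of_mem hj)]

theorem isHessenbergPerm_ascendingPerm (S : Finset (Fin (n - 1))) :
    IsHessenbergPerm (ascendingPerm S) := by
  induction S using Finset.induction_on_min with
  | empty => simp [ascendingPerm_empty, IsHessenbergPerm]
  | insert i S hmin ih =>
    intro x
    rw [ascendingPerm_insert hmin, Equiv.Perm.mul_apply]
    rcases eq_or_ne x (lo i) with rfl | hlo
    · exact (Nat.le_succ _).trans (simpleRefl_lo i ▸ ih (hi i))
    rcases eq_or_ne x (hi i) with rfl | hhi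
    · rw [simpleRefl_hi, ascendingPerm_apply_of_lt hmin]
      rfl
    · rw [simpleRefl_of_ne i x hlo hhi]
      exact ih x

theorem ascendingPerm_apply_hi (S : Finset (Fin (n - 1))) (j : Fin (n - 1)) :
    ascendingPerm S (hi j) = lo j ↔ j ∈ S := by
  induction S using Finset.induction_on_min with
  | empty => simp [ascendingPerm_empty, (lo_ne_hi j).symm]
  | insert i S hmin ih =>
    rw [ascendingPerm_insert hmin, Equiv.Perm.mul_apply, Finset.mem_insert]
    rcases lt_trichotomy j i with hji | rfl | hij
    · have hjS : j ∉ insert i S := fun h => by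
        rcases Finset.mem_insert.1 h with rfl | h
        exacts [hji.false, (hji.trans (hmin j h)).false]
      refine iff_of_false (fun h => ?_) (by simpa using hjS)
      rcases eq_or_ne (hi j) (lo i) with hj | hj
      · have := isHessenbergPerm_ascendingPerm S (hi i)
        rw [hj, simpleRefl_lo] at h
        rw [h] at this
        simp only [lo, hi, Fin.ext_iff] at this hj
        omega
      · rw [simpleRefl_of_ne i _ hj (by simp only [hi, ne_eq, Fin.ext_iff]; omega), ih] at h
        exact hjS (Finset.mem_insert_of_mem h)
    · simp [simpleRefl_hi, ascendingPerm_apply_of_lt (x := lo j) hmin]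
    · rw [simpleRefl_of_ne i _ (by simp only [lo, hi, ne_eq, Fin.ext_iff]; omega)
        (by simp only [hi, ne_eq, Fin.ext_iff]; omega), ih]
      simp [hij.ne']

theorem ascendingPerm_injective : Function.Injective (ascendingPerm (n := n)) := fun S T h => by
  ext j
  rw [← ascendingPerm_apply_hi, ← ascendingPerm_apply_hi, h]

theorem perm_apply_lt {w : Equiv.Perm (Fin n)} {t : ℕ} (h : ∀ x : Fin n, t ≤ x → t ≤ (w x : ℕ))
    {x : Fin n} (hx : (x : ℕ) < t) : (w x : ℕ) < t := by
  by_contra! hwx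
  have := Equiv.Perm.perm_symm_on_of_perm_on_finite (p := fun x : Fin n => t ≤ x) h hwx
  rw [Equiv.symm_apply_apply] at this
  omega

theorem IsHessenbergPerm.le_apply {w : Equiv.Perm (Fin n)} (hw : IsHessenbergPerm w) {t : ℕ}
    (ht : ∀ j : Fin (n - 1), (j : ℕ) + 1 = t → w (hi j) ≠ lo j) (x : Fin n) (hx : t ≤ x) :
    t ≤ (w x : ℕ) := by
  by_contra! hwx
  have hxw := hw x
  have hx' : hi (n := n) ⟨w x, by omega⟩ = x := Fin.ext (by simp only [hi]; omega)
  exact ht ⟨w x, by omega⟩ (by simp only; omega) (by rw [hx']; rfl)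

theorem IsHessenbergPerm.ext {w w' : Equiv.Perm (Fin n)} (hw : IsHessenbergPerm w)
    (hw' : IsHessenbergPerm w') (h : ∀ j, w (hi j) = lo j ↔ w' (hi j) = lo j) : w = w' := by
  ext x : 1
  induction x using WellFoundedGT.induction with
  | ind x ih =>
    by_cases hx : ∃ j, hi j = x ∧ w (hi j) = lo j
    · obtain ⟨j, rfl, hj⟩ := hx
      rw [hj, (h j).1 hj]
    push Not at hx
    have hup := hw.le_apply (t := x) fun j e => hx j (Fin.ext e)
    have hup' := hw'.le_apply (t := x) fun j e e' => hx j (Fin.ext e) ((h j).2 e')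
    obtain ⟨y, hy⟩ := w'.surjective (w x)
    rcases lt_trichotomy y x with hlt | rfl | hgt
    · exact absurd (hup x le_rfl) (by rw [← hy]; exact (perm_apply_lt hup' hlt).not_ge)
    · exact hy.symm
    · exact absurd (w.injective ((ih y hgt).trans hy)) hgt.ne'

/-- `p` and `q` are the first and the last point moved by a maximal run of consecutive elements
of `S`. -/
theorem ascendingPerm_apply_run {S : Finset (Fin (n - 1))} {p q : Fin n} (hpq : p ≤ q)
    (hp : ∀ j ∈ S, hi j ≠ p) (hq : ∀ j ∈ S, lo j ≠ q)
    (h : ∀ j, p ≤ lo j → hi j ≤ q → j ∈ S) : ascendingPerm S p = q := by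
  have hS := isHessenbergPerm_ascendingPerm S
  have hge : p ≤ ascendingPerm S p := hS.le_apply (t := p)
    (fun j e e' => hp j ((ascendingPerm_apply_hi S j).1 e') (Fin.ext e)) p le_rfl
  have hle : ascendingPerm S p ≤ q := Nat.lt_succ_iff.1 <| perm_apply_lt
    (hS.le_apply (t := (q : ℕ) + 1) fun j e e' =>
      hq j ((ascendingPerm_apply_hi S j).1 e') (Fin.ext (Nat.succ_injective e)))
    (Nat.lt_succ_of_le hpq)
  by_contra hne
  obtain ⟨j, hj⟩ : ∃ j : Fin (n - 1), lo j = ascendingPerm S p :=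
    ⟨⟨ascendingPerm S p, by have := hle.lt_of_ne hne; omega⟩, rfl⟩
  have hjS : j ∈ S := h j (hj ▸ hge)
    (by have := hle.lt_of_ne hne; simp only [← hj, Fin.lt_def, Fin.le_def, lo, hi] at *; omega)
  have := (ascendingPerm S).injective (((ascendingPerm_apply_hi S j).2 hjS).trans hj)
  exact hp j hjS this

theorem immanant_hessenberg {A : Type*} [CommRing A] [Algebra ℂ A] (f : Equiv.Perm (Fin n) → ℂ)
    {M : Matrix (Fin n) (Fin n) A} (hM : IsHessenberg M) :
    immanant f M =
      ∑ S : Finset (Fin (n - 1)), f (ascendingPerm S) • ∏ i, M i (ascendingPerm S i) := by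
  classical
  rw [immanant, ← Finset.sum_image (g := ascendingPerm) (f := fun w => f w • ∏ i, M i (w i))
    ascendingPerm_injective.injOn]
  refine (Finset.sum_subset (Finset.subset_univ _) fun w _ hw => ?_).symm
  obtain ⟨x, hx⟩ : ∃ x : Fin n, (w x : ℕ) + 1 < x := by
    by_contra! hHess
    refine hw (Finset.mem_image.2
      ⟨Finset.univ.filter fun j => w (hi j) = lo j, Finset.mem_univ _, ?_⟩)
    exact (isHessenbergPerm_ascendingPerm _).ext hHess fun j => by simp [ascendingPerm_apply_hi]
  rw [Finset.prod_eq_zero (Finset.mem_univ x) (hM x (w x) hx), smul_zero]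

/-! ### The immanants of the diagrams `τ(I)` -/

theorem tau_insert {S : Finset (Fin (n - 1))} {i : Fin (n - 1)} (hmin : ∀ j ∈ S, i < j) :
    tau (insert i S) = (tau S).hook i := by
  rw [tau, Finset.sort_insert _ (fun j hj => (hmin j hj).le) fun h => (hmin i h).false]
  rfl

theorem tau_partner_of_lt {S : Finset (Fin (n - 1))} {x : Fin n} (hx : ∀ i ∈ S, (x : ℕ) < i) :
    (tau S).partner (.inl x) = .inr x :=
  foldr_hook_partner _ x fun i hi => hx i ((Finset.mem_sort _).1 hi)

theorem tau_partner_hi_le_lo (S : Finset (Fin (n - 1))) (j : Fin (n - 1)) :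
    Sum.elim id id ((tau S).partner (.inl (hi j))) ≤ lo j ↔ j ∈ S := by
  induction S using Finset.induction_on_min with
  | empty => simp [tau_partner_of_lt, lo, hi]
  | insert i S hmin ih =>
    have hlo := tau_partner_of_lt (x := lo i) hmin
    rw [Finset.mem_insert]
    rcases lt_trichotomy j i with hji | rfl | hij
    · have hjS : j ∉ S := fun h => (hji.trans (hmin j h)).false
      refine iff_of_false (fun h => ?_) (by simp [hji.ne, hjS])
      rcases (Nat.succ_le_of_lt hji).eq_or_lt with hj | hj
      · have hji' : hi j = lo i := Fin.ext hj
        rw [hji', tau_insert hmin] at h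
        simp only [KauffmanDiagram.hook, rewire, if_true, Sum.elim_inl, id, Fin.le_def, lo, hi] at h
        omega
      · rw [tau_partner_of_lt] at h
        · simp [Fin.le_def, lo, hi] at h
        · simpa using ⟨hj, fun k hk => hj.trans (hmin k hk)⟩
    · simp [tau_insert hmin, KauffmanDiagram.hook, rewire, (lo_ne_hi j).symm]
    · have h1 : hi j ≠ lo i := by simp only [lo, hi, ne_eq, Fin.ext_iff]; omega
      have h2 : hi j ≠ hi i := by simp only [hi, ne_eq, Fin.ext_iff]; omega
      have hle : lo i ≤ lo j := hij.le
      have hle' : hi i ≤ lo j := hij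
      rw [← ih]
      simp only [tau_insert hmin, KauffmanDiagram.hook, rewire, hlo, Sum.inl.injEq, h1, h2,
        hij.ne', reduceCtorEq, if_false, false_or]
      split_ifs with h3
      · rw [h3, (tau S).partner_partner]
        simp [hle, hle']
      · rfl

theorem tau_injective : Function.Injective (tau (n := n)) := fun S T h => by
  ext j
  rw [← tau_partner_hi_le_lo, ← tau_partner_hi_le_lo, h]

theorem beta_eq_sum_ascendingPerm (J : Finset (Fin (n - 1))) :
    beta J = ∑ S ∈ J.powerset, MonoidAlgebra.of ℂ _ (MulOpposite.op (ascendingPerm S)) := by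
  induction J using Finset.induction_on_min with
  | empty => simp [beta, ascendingPerm_empty, MonoidAlgebra.one_def]
  | insert i J hmin ih =>
    have hiJ : i ∉ J := fun h => (hmin i h).false
    have hbeta : beta (insert i J) = (1 + MonoidAlgebra.of ℂ _ (sGen i)) * beta J := by
      rw [beta, Finset.sort_insert _ (fun j hj => (hmin j hj).le) hiJ]
      rfl
    rw [hbeta, ih, Finset.sum_powerset_insert hiJ, add_mul, one_mul, Finset.mul_sum]
    congr 1
    refine Finset.sum_congr rfl fun S hS => ?_
    rw [ascendingPerm_insert fun j hj => hmin j (Finset.mem_powerset.1 hS hj), ← map_mul]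
    rfl

theorem sum_tlFunction_tau_ascendingPerm (I J : Finset (Fin (n - 1))) :
    ∑ S ∈ J.powerset, tlFunction (tau I) (ascendingPerm S) = if J = I then 1 else 0 := by
  classical
  calc ∑ S ∈ J.powerset, tlFunction (tau I) (ascendingPerm S)
      = diagramExpansion 2 n (theta n (beta J)) (tau I) := by
        simp only [beta_eq_sum_ascendingPerm, map_sum, Finsupp.finsetSum_apply, tlFunction]
    _ = if J = I then 1 else 0 := by
        rw [diagramExpansion_theta_beta, Finsupp.single_apply]
        simp only [tau_injective.eq_iff]

/-- Möbius inversion: `f_{τ(I)}` inverts the summation over supersets. -/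
theorem tlImmanant_hessenberg {A : Type*} [CommRing A] [Algebra ℂ A]
    {M : Matrix (Fin n) (Fin n) A} (hM : IsHessenberg M) {c : Finset (Fin (n - 1)) → A}
    (hc : ∀ S, ∏ i, M i (ascendingPerm S i) = ∑ J with S ⊆ J, c J) (I : Finset (Fin (n - 1))) :
    tlImmanant (tau I) M = c I := by
  calc tlImmanant (tau I) M
      = ∑ S, ∑ J with S ⊆ J, tlFunction (tau I) (ascendingPerm S) • c J := by
        simp only [tlImmanant, immanant_hessenberg _ hM, hc, Finset.smul_sum]
    _ = ∑ J, (∑ S ∈ J.powerset, tlFunction (tau I) (ascendingPerm S)) • c J := by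
        simp only [Finset.sum_smul]
        exact Finset.sum_comm' fun S J => by simp
    _ = c I := by simp [sum_tlFunction_tau_ascendingPerm]

end Hessenberg

/-! ### Young diagrams and strips -/

section Diagrams
variable {μ ν : YoungDiagram}

theorem youngDiagram_ext_rowLen (h : ∀ i, μ.rowLen i = ν.rowLen i) : μ = ν := by
  ext ⟨i, j⟩
  rw [YoungDiagram.mem_cells, YoungDiagram.mem_cells, YoungDiagram.mem_iff_lt_rowLen,
    YoungDiagram.mem_iff_lt_rowLen, h]

theorem youngDiagram_le_of_rowLen_le (h : ∀ i, μ.rowLen i ≤ ν.rowLen i) : μ ≤ ν := by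
  rintro ⟨i, j⟩ hc
  rw [YoungDiagram.mem_iff_lt_rowLen] at hc ⊢
  exact hc.trans_le (h i)

theorem rowLen_mono (h : μ ≤ ν) (i : ℕ) : μ.rowLen i ≤ ν.rowLen i :=
  le_of_forall_lt fun _ hj => YoungDiagram.mem_iff_lt_rowLen.1
    (h (YoungDiagram.mem_iff_lt_rowLen.2 hj))

theorem youngDiagram_card_le (h : μ ≤ ν) : μ.card ≤ ν.card :=
  Finset.card_le_card (YoungDiagram.cells_subset_iff.2 h)

theorem youngDiagram_card_eq_sum {L : ℕ} (hL : ∀ i, L ≤ i → μ.rowLen i = 0) :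
    μ.card = ∑ i ∈ Finset.range L, μ.rowLen i := by
  rw [YoungDiagram.card, Finset.card_eq_sum_card_fiberwise (f := Prod.fst) (t := Finset.range L)]
  · exact Finset.sum_congr rfl fun i _ => μ.rowLen_eq_card.symm
  · rintro ⟨i, j⟩ h
    rw [SetLike.mem_coe, YoungDiagram.mem_cells, YoungDiagram.mem_iff_lt_rowLen] at h
    by_contra hi
    exact absurd (hL i (by simpa using hi)) (by omega)

theorem card_sub_card_eq_sum (h : μ ≤ ν) {L : ℕ} (hL : ∀ i, L ≤ i → ν.rowLen i = 0) :
    ν.card - μ.card = ∑ i ∈ Finset.range L, (ν.rowLen i - μ.rowLen i) := by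
  have hrow : ∀ i, μ.rowLen i ≤ ν.rowLen i := fun i => rowLen_mono h i
  rw [youngDiagram_card_eq_sum hL, youngDiagram_card_eq_sum fun i hi =>
    Nat.le_zero.1 (hL i hi ▸ hrow i), Finset.sum_tsub_distrib _ fun i _ => hrow i]

theorem rowLen_eq_zero_of_card_le {i : ℕ} (h : μ.card ≤ i) : μ.rowLen i = 0 := by
  by_contra hne
  have hmem : (i, 0) ∈ μ := YoungDiagram.mem_iff_lt_rowLen.2 (Nat.pos_of_ne_zero hne)
  have := YoungDiagram_cells_subset μ hmem
  simp only [Finset.mem_product, Finset.mem_range] at this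
  omega

/-- The Young diagram whose row lengths are the first `L` values of an antitone sequence. -/
def diagramOfRows (f : ℕ → ℕ) (L : ℕ) (hf : Antitone f) : YoungDiagram where
  cells := (Finset.range L ×ˢ Finset.range (f 0)).filter fun c => c.2 < f c.1
  isLowerSet := by
    rintro ⟨i, j⟩ ⟨i', j'⟩ ⟨hi, hj⟩ h
    simp only [Finset.coe_filter, Finset.mem_product, Finset.mem_range, Set.mem_ofPred_eq] at *
    have := hf hi
    omega

theorem rowLen_diagramOfRows {f : ℕ → ℕ} {L : ℕ} (hf : Antitone f) (hL : ∀ i, L ≤ i → f i = 0)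
    (i : ℕ) : (diagramOfRows f L hf).rowLen i = f i := by
  refine eq_of_forall_lt_iff fun j => ?_
  rw [← YoungDiagram.mem_iff_lt_rowLen, ← YoungDiagram.mem_cells]
  simp only [diagramOfRows, Finset.mem_filter, Finset.mem_product, Finset.mem_range]
  have := hf (Nat.zero_le i)
  have := hL i
  omega

theorem finite_setOf_card_le (m : ℕ) : {ν : YoungDiagram | ν.card ≤ m}.Finite :=
  (Set.finite_range fun ν : Σ k : Fin (m + 1), PartitionOf k => ν.2.1).subset
    fun ν hν => ⟨⟨⟨ν.card, Nat.lt_succ_of_le hν⟩, ν, rfl⟩, rfl⟩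

/-- `ν/μ` is a vertical strip. -/
def IsVerticalStrip (μ ν : YoungDiagram) : Prop :=
  ∀ i, μ.rowLen i ≤ ν.rowLen i ∧ ν.rowLen i ≤ μ.rowLen i + 1

/-- `ν/μ` is a horizontal strip. -/
def IsHorizontalStrip (μ ν : YoungDiagram) : Prop :=
  ∀ i, μ.rowLen i ≤ ν.rowLen i ∧ ν.rowLen (i + 1) ≤ μ.rowLen i

theorem IsVerticalStrip.le (h : IsVerticalStrip μ ν) : μ ≤ ν :=
  youngDiagram_le_of_rowLen_le fun i => (h i).1

theorem IsHorizontalStrip.le (h : IsHorizontalStrip μ ν) : μ ≤ ν :=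
  youngDiagram_le_of_rowLen_le fun i => (h i).1

/-- The diagrams obtained by adding a vertical strip of size `d` to `μ`. -/
noncomputable def addVerticalStrips (μ : YoungDiagram) (d : ℕ) : Finset YoungDiagram :=
  Set.Finite.toFinset (s := {ν | IsVerticalStrip μ ν ∧ ν.card = μ.card + d})
    ((finite_setOf_card_le (μ.card + d)).subset fun _ h => h.2.le)

/-- The diagrams obtained by removing a vertical strip of size `d` from `ν`. -/
noncomputable def removeVerticalStrips (ν : YoungDiagram) (d : ℕ) : Finset YoungDiagram :=
  Set.Finite.toFinset (s := {μ | IsVerticalStrip μ ν ∧ ν.card = μ.card + d})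
    ((finite_setOf_card_le ν.card).subset fun _ h => youngDiagram_card_le h.1.le)

/-- The diagrams obtained by removing a horizontal strip from `ν`. -/
noncomputable def removeHorizontalStrips (ν : YoungDiagram) : Finset YoungDiagram :=
  Set.Finite.toFinset (s := {μ | IsHorizontalStrip μ ν})
    ((finite_setOf_card_le ν.card).subset fun _ h => youngDiagram_card_le (IsHorizontalStrip.le h))

theorem mem_addVerticalStrips {d : ℕ} :
    ν ∈ addVerticalStrips μ d ↔ IsVerticalStrip μ ν ∧ ν.card = μ.card + d := by
  simp [addVerticalStrips]

theorem mem_removeVerticalStrips {d : ℕ} :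
    μ ∈ removeVerticalStrips ν d ↔ IsVerticalStrip μ ν ∧ ν.card = μ.card + d := by
  simp [removeVerticalStrips]

theorem mem_removeHorizontalStrips : μ ∈ removeHorizontalStrips ν ↔ IsHorizontalStrip μ ν := by
  simp [removeHorizontalStrips]

end Diagrams

/-! ### The local rule for vertical and horizontal strips -/

section LocalRule

theorem finite_setOf_rowLen_mem {S : ℕ → Finset ℕ} {L : ℕ} (hL : ∀ i, L ≤ i → S i = {0}) :
    {ν : YoungDiagram | ∀ i, ν.rowLen i ∈ S i}.Finite := by
  refine (finite_setOf_card_le (∑ i ∈ Finset.range L, (S i).sup id)).subset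
    fun ν (hν : ∀ i, ν.rowLen i ∈ S i) => ?_
  rw [Set.mem_ofPred_eq, youngDiagram_card_eq_sum fun i hi => by simpa [hL i hi] using hν i]
  exact Finset.sum_le_sum fun i _ => Finset.le_sup (f := id) (hν i)

theorem sum_prod_rowLen {A : Type*} [CommSemiring A] {U : Finset YoungDiagram}
    {S : ℕ → Finset ℕ} {L : ℕ} (hU : ∀ ν, ν ∈ U ↔ ∀ i, ν.rowLen i ∈ S i)
    (hS : ∀ i, ∀ x ∈ S (i + 1), ∀ y ∈ S i, x ≤ y) (hL : ∀ i, L ≤ i → S i = {0}) (w : ℕ → ℕ → A) :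
    ∑ ν ∈ U, ∏ i ∈ Finset.range L, w i (ν.rowLen i) = ∏ i ∈ Finset.range L, ∑ x ∈ S i, w i x := by
  simp only [Finset.prod_range]
  rw [Finset.prod_univ_sum]
  refine Finset.sum_bij (fun ν _ i => ν.rowLen i) (fun ν hν => ?_) (fun ν hν ν' hν' h => ?_)
    (fun f hf => ?_) fun ν _ => rfl
  · exact Fintype.mem_piFinset.2 fun i => (hU ν).1 hν i
  · refine youngDiagram_ext_rowLen fun i => ?_
    rcases lt_or_ge i L with hi | hi
    · exact congrFun h ⟨i, hi⟩
    · have h1 := (hU ν).1 hν i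
      have h2 := (hU ν').1 hν' i
      rw [hL i hi, Finset.mem_singleton] at h1 h2
      rw [h1, h2]
  · set g : ℕ → ℕ := fun i => if h : i < L then f ⟨i, h⟩ else 0 with hg
    have hgS : ∀ i, g i ∈ S i := fun i => by
      rcases lt_or_ge i L with hi | hi
      · simpa [hg, hi] using Fintype.mem_piFinset.1 hf ⟨i, hi⟩
      · simp [hg, hi.not_gt, hL i hi]
    have hanti : Antitone g := antitone_nat_of_succ_le fun i => hS i _ (hgS _) _ (hgS _)
    have hrow := rowLen_diagramOfRows (L := L) hanti fun i hi => by simp [hg, hi.not_gt]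
    refine ⟨_, (hU _).2 fun i => by rw [hrow]; exact hgS i, ?_⟩
    ext i
    rw [hrow]
    simp [hg]

open Polynomial

theorem sum_Icc_upper_row {a p r : ℕ} (hap : a ≤ p) :
    ∑ x ∈ Finset.Icc (max a r) (min (a + 1) p), (X : ℕ[X]) ^ (x - a) =
      (if r ≤ a then 1 else 0) + if a < p ∧ r ≤ a + 1 then X else 0 := by
  have hIcc : Finset.Icc (max a r) (min (a + 1) p) =
      ({a, a + 1} : Finset ℕ).filter fun x => r ≤ x ∧ x ≤ p := by
    ext x
    simp only [Finset.mem_Icc, Finset.mem_filter, Finset.mem_insert, Finset.mem_singleton]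
    omega
  rw [hIcc, Finset.sum_filter, Finset.sum_pair (Nat.succ_ne_self a).symm]
  simp [hap, and_comm]

theorem sum_Icc_lower_row {a b r : ℕ} (hbr : b ≤ r) :
    ∑ x ∈ Finset.Icc (max b (r - 1)) (min a r), (X : ℕ[X]) ^ (r - x) =
      (if r ≤ a then 1 else 0) + if b < r ∧ r ≤ a + 1 then X else 0 := by
  rcases hbr.eq_or_lt with rfl | hbr
  · rcases le_or_gt b a with hba | hba
    · simp [hba]
    · simp [hba.not_ge]
  · have hIcc : Finset.Icc (max b (r - 1)) (min a r) =
        ({r, r - 1} : Finset ℕ).filter fun x => x ≤ a := by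
      ext x
      simp only [Finset.mem_Icc, Finset.mem_filter, Finset.mem_insert, Finset.mem_singleton]
      omega
    rw [hIcc, Finset.sum_filter, Finset.sum_pair (by omega)]
    simp [hbr, Nat.sub_sub_self (Nat.one_le_of_lt hbr)]

theorem upper_row_eq_lower_row {a b p r : ℕ} (hap : a ≤ p) (hbr : b ≤ r) (hba : b ≤ a)
    (hrp : r ≤ p) :
    (if a = p then 1 + X else 1) *
        ∑ x ∈ Finset.Icc (max a r) (min (a + 1) p), (X : ℕ[X]) ^ (x - a) =
      (if b = r then 1 + X else 1) *
        ∑ x ∈ Finset.Icc (max b (r - 1)) (min a r), (X : ℕ[X]) ^ (r - x) := by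
  rw [sum_Icc_upper_row hap, sum_Icc_lower_row hbr]
  split_ifs <;> first | omega | ring

theorem prod_upper_row_eq_prod_lower_row {m s : ℕ → ℕ} (hm : Antitone m) (hs : Antitone s)
    (h0 : m 0 < s 0) {L : ℕ} (hL : m L ≤ s L) :
    ∏ i ∈ Finset.range L, ∑ x ∈ Finset.Icc (max (m i) (s (i + 1))) (min (m i + 1) (s i)),
        (X : ℕ[X]) ^ (x - m i) =
      (if m L = s L then 1 + X else 1) * ∏ i ∈ Finset.range L,
        ∑ x ∈ Finset.Icc (max (m (i + 1)) (s (i + 1) - 1)) (min (m i) (s (i + 1))),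
          (X : ℕ[X]) ^ (s (i + 1) - x) := by
  induction L with
  | zero => simp [h0.ne]
  | succ L ih =>
    rw [Finset.prod_range_succ, Finset.prod_range_succ]
    rcases le_or_gt (m L) (s L) with hmL | hmL
    · rw [ih hmL, mul_right_comm, upper_row_eq_lower_row hmL hL (hm L.le_succ) (hs L.le_succ)]
      ring
    · obtain ⟨K, rfl⟩ : ∃ K, L = K + 1 := Nat.exists_eq_succ_of_ne_zero (by rintro rfl; omega)
      have hupper : ¬ max (m (K + 1)) (s (K + 1 + 1)) ≤ min (m (K + 1) + 1) (s (K + 1)) := by omega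
      have hlower : ¬ max (m (K + 1)) (s (K + 1) - 1) ≤ min (m K) (s (K + 1)) := by omega
      simp [Finset.prod_range_succ _ K, Finset.Icc_eq_empty hupper, Finset.Icc_eq_empty hlower]

/-- The row lengths of `ρ` moved down by one row, below a first row which is so long that it imposes
no condition on vertical strips over `μ`. -/
def shiftedRowLen (μ ρ : YoungDiagram) : ℕ → ℕ
  | 0 => max (μ.rowLen 0 + 1) (ρ.rowLen 0)
  | i + 1 => ρ.rowLen i

theorem shiftedRowLen_antitone (μ ρ : YoungDiagram) : Antitone (shiftedRowLen μ ρ) :=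
  antitone_nat_of_succ_le fun i => by
    cases i with
    | zero => exact le_max_right _ _
    | succ i => exact ρ.rowLen_anti i (i + 1) i.le_succ

theorem shiftedRowLen_eq_zero {μ ρ : YoungDiagram} {i : ℕ} (hi : ρ.card < i) :
    shiftedRowLen μ ρ i = 0 := by
  obtain ⟨j, rfl⟩ := Nat.exists_eq_succ_of_ne_zero (Nat.ne_zero_of_lt hi)
  exact rowLen_eq_zero_of_card_le (Nat.le_of_lt_succ hi)

variable {μ ρ ν κ : YoungDiagram}

theorem isVerticalStrip_and_isHorizontalStrip_iff_upper :
    IsVerticalStrip μ ν ∧ IsHorizontalStrip ρ ν ↔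
      ∀ i, ν.rowLen i ∈ Finset.Icc (max (μ.rowLen i) (shiftedRowLen μ ρ (i + 1)))
        (min (μ.rowLen i + 1) (shiftedRowLen μ ρ i)) := by
  simp only [IsVerticalStrip, IsHorizontalStrip, Finset.mem_Icc, shiftedRowLen, max_le_iff,
    le_min_iff]
  refine ⟨fun ⟨hV, hH⟩ i => ⟨⟨(hV i).1, (hH i).1⟩, (hV i).2, ?_⟩, fun h =>
    ⟨fun i => ⟨(h i).1.1, (h i).2.1⟩, fun i => ⟨(h i).1.2, (h (i + 1)).2.2⟩⟩⟩
  cases i with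
  | zero => exact (hV 0).2.trans (le_max_left _ _)
  | succ i => exact (hH i).2

theorem isHorizontalStrip_and_isVerticalStrip_iff_lower :
    IsHorizontalStrip κ μ ∧ IsVerticalStrip κ ρ ↔
      ∀ i, κ.rowLen i ∈ Finset.Icc (max (μ.rowLen (i + 1)) (shiftedRowLen μ ρ (i + 1) - 1))
        (min (μ.rowLen i) (shiftedRowLen μ ρ (i + 1))) := by
  simp only [IsVerticalStrip, IsHorizontalStrip, ← forall_and, Finset.mem_Icc, shiftedRowLen]
  exact forall_congr' fun i => by omega

theorem upper_row_eq_singleton {i : ℕ} (hi : max μ.card ρ.card < i) :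
    Finset.Icc (max (μ.rowLen i) (shiftedRowLen μ ρ (i + 1)))
      (min (μ.rowLen i + 1) (shiftedRowLen μ ρ i)) = {0} := by
  rw [rowLen_eq_zero_of_card_le (by omega), shiftedRowLen_eq_zero (by omega),
    shiftedRowLen_eq_zero (by omega)]
  rfl

theorem lower_row_eq_singleton {i : ℕ} (hi : max μ.card ρ.card < i) :
    Finset.Icc (max (μ.rowLen (i + 1)) (shiftedRowLen μ ρ (i + 1) - 1))
      (min (μ.rowLen i) (shiftedRowLen μ ρ (i + 1))) = {0} := by
  rw [rowLen_eq_zero_of_card_le (by omega), rowLen_eq_zero_of_card_le (by omega),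
    shiftedRowLen_eq_zero (by omega)]
  rfl

theorem finite_setOf_upper (μ ρ : YoungDiagram) :
    {ν | IsVerticalStrip μ ν ∧ IsHorizontalStrip ρ ν}.Finite := by
  simp only [isVerticalStrip_and_isHorizontalStrip_iff_upper]
  exact finite_setOf_rowLen_mem fun i (hi : max μ.card ρ.card + 1 ≤ i) => upper_row_eq_singleton hi

theorem sum_upper_eq_prod {U : Finset YoungDiagram}
    (hU : ∀ ν, ν ∈ U ↔ IsVerticalStrip μ ν ∧ IsHorizontalStrip ρ ν) {L : ℕ}
    (hL : max μ.card ρ.card < L) :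
    ∑ ν ∈ U, (X : ℕ[X]) ^ (ν.card - μ.card) = ∏ i ∈ Finset.range L,
      ∑ x ∈ Finset.Icc (max (μ.rowLen i) (shiftedRowLen μ ρ (i + 1)))
        (min (μ.rowLen i + 1) (shiftedRowLen μ ρ i)), X ^ (x - μ.rowLen i) := by
  have hU' := fun ν => (hU ν).trans isVerticalStrip_and_isHorizontalStrip_iff_upper
  rw [← sum_prod_rowLen hU' (fun i x hx y hy => ?_)
    fun i hi => upper_row_eq_singleton (hL.trans_le hi)]
  · refine Finset.sum_congr rfl fun ν hν => ?_
    rw [Finset.prod_pow_eq_pow_sum, card_sub_card_eq_sum ((hU ν).1 hν).1.le fun i hi => ?_]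
    simpa [upper_row_eq_singleton (hL.trans_le hi)] using (hU' ν).1 hν i
  · simp only [Finset.mem_Icc] at hx hy
    omega

theorem sum_lower_eq_prod {D : Finset YoungDiagram}
    (hD : ∀ κ, κ ∈ D ↔ IsHorizontalStrip κ μ ∧ IsVerticalStrip κ ρ) {L : ℕ}
    (hL : max μ.card ρ.card < L) :
    ∑ κ ∈ D, (X : ℕ[X]) ^ (ρ.card - κ.card) = ∏ i ∈ Finset.range L,
      ∑ x ∈ Finset.Icc (max (μ.rowLen (i + 1)) (shiftedRowLen μ ρ (i + 1) - 1))
        (min (μ.rowLen i) (shiftedRowLen μ ρ (i + 1))),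
        X ^ (shiftedRowLen μ ρ (i + 1) - x) := by
  have hD' := fun κ => (hD κ).trans isHorizontalStrip_and_isVerticalStrip_iff_lower
  rw [← sum_prod_rowLen hD' (fun i x hx y hy => ?_)
    fun i hi => lower_row_eq_singleton (hL.trans_le hi)]
  · refine Finset.sum_congr rfl fun κ hκ => ?_
    rw [Finset.prod_pow_eq_pow_sum, card_sub_card_eq_sum (L := L) ((hD κ).1 hκ).2.le fun i hi =>
      rowLen_eq_zero_of_card_le (by omega)]
    rfl
  · simp only [Finset.mem_Icc] at hx hy
    omega

theorem sum_upper_eq_sum_lower {U D : Finset YoungDiagram}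
    (hU : ∀ ν, ν ∈ U ↔ IsVerticalStrip μ ν ∧ IsHorizontalStrip ρ ν)
    (hD : ∀ κ, κ ∈ D ↔ IsHorizontalStrip κ μ ∧ IsVerticalStrip κ ρ) :
    ∑ ν ∈ U, (X : ℕ[X]) ^ (ν.card - μ.card) = (1 + X) * ∑ κ ∈ D, X ^ (ρ.card - κ.card) := by
  have hL := Nat.lt_succ_self (max μ.card ρ.card)
  have hμ : μ.rowLen (max μ.card ρ.card + 1) = 0 := rowLen_eq_zero_of_card_le (by omega)
  have hρ : shiftedRowLen μ ρ (max μ.card ρ.card + 1) = 0 := shiftedRowLen_eq_zero (by omega)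
  rw [sum_upper_eq_prod hU hL, sum_lower_eq_prod hD hL, prod_upper_row_eq_prod_lower_row
    (fun i j => μ.rowLen_anti i j) (shiftedRowLen_antitone μ ρ)
    (lt_max_of_lt_left (Nat.lt_succ_self _)) (by rw [hμ, hρ]), hμ, hρ, if_pos rfl]

open scoped Classical in
/-- The commutation rule behind the Pieri formula: adding a vertical strip and then removing a
horizontal strip, or conversely. -/
theorem card_addVerticalStrips_filter (μ ρ : YoungDiagram) (d : ℕ) :
    (Finset.card {ν ∈ addVerticalStrips μ (d + 1) | IsHorizontalStrip ρ ν}) =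
      Finset.card {κ ∈ removeHorizontalStrips μ | ρ ∈ addVerticalStrips κ (d + 1)} +
        Finset.card {κ ∈ removeHorizontalStrips μ | ρ ∈ addVerticalStrips κ d} := by
  set U := (finite_setOf_upper μ ρ).toFinset with hUdef
  set D := (removeHorizontalStrips μ).filter (IsVerticalStrip · ρ) with hDdef
  have hU : ∀ ν, ν ∈ U ↔ IsVerticalStrip μ ν ∧ IsHorizontalStrip ρ ν := by simp [hUdef]
  have hD : ∀ κ, κ ∈ D ↔ IsHorizontalStrip κ μ ∧ IsVerticalStrip κ ρ := by
    simp [hDdef, mem_removeHorizontalStrips]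
  have hcoeff := congrArg (Polynomial.coeff · (d + 1)) (sum_upper_eq_sum_lower hU hD)
  simp only [add_mul, one_mul, coeff_add, coeff_X_mul, finsetSum_coeff, coeff_X_pow,
    ← Finset.card_filter] at hcoeff
  have hupper : {ν ∈ addVerticalStrips μ (d + 1) | IsHorizontalStrip ρ ν} =
      U.filter fun ν => d + 1 = ν.card - μ.card := by
    ext ν
    simp only [Finset.mem_filter, mem_addVerticalStrips, hU]
    refine ⟨fun h => ⟨⟨h.1.1, h.2⟩, by omega⟩, fun h => ⟨⟨h.1.1, by omega⟩, h.1.2⟩⟩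
  have hlower : ∀ e, {κ ∈ removeHorizontalStrips μ | ρ ∈ addVerticalStrips κ e} =
      D.filter fun κ => e = ρ.card - κ.card := fun e => by
    ext κ
    simp only [Finset.mem_filter, mem_removeHorizontalStrips, mem_addVerticalStrips, hD]
    constructor
    · exact fun h => ⟨⟨h.1, h.2.1⟩, by omega⟩
    · intro h
      have := youngDiagram_card_le h.1.2.le
      exact ⟨h.1.1, h.1.2, by omega⟩
  rw [hupper, hlower, hlower, hcoeff]

end LocalRule

/-! ### Restriction of tableaux -/

section Tableaux
variable {ν κ : YoungDiagram} {t : ℕ}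

theorem tableau_mono (T : SemistandardYoungTableau ν) {i i' j j' : ℕ} (hi : i ≤ i') (hj : j ≤ j')
    (h : (i', j') ∈ ν) : T i j ≤ T i' j' :=
  (T.row_weak_of_le hj (ν.up_left_mem hi le_rfl h)).trans (T.col_weak hi h)

theorem sigma_tableau_ext {x y : Σ κ, SemistandardYoungTableau κ} (h : x.1 = y.1)
    (h' : ∀ c ∈ x.1, x.2 c.1 c.2 = y.2 c.1 c.2) : x = y := by
  obtain ⟨κ, T⟩ := x
  obtain ⟨κ, T'⟩ := y
  obtain rfl : _ = κ := h
  refine congrArg (Sigma.mk _) (SemistandardYoungTableau.ext fun i j => ?_)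
  by_cases hc : (i, j) ∈ κ
  · exact h' _ hc
  · rw [T.zeros hc, T'.zeros hc]

/-- The diagram of the cells of a tableau whose entries are smaller than `t`. -/
def belowDiagram (T : SemistandardYoungTableau ν) (t : ℕ) : YoungDiagram where
  cells := ν.cells.filter fun c => T c.1 c.2 < t
  isLowerSet := by
    rintro ⟨i, j⟩ ⟨i', j'⟩ ⟨hi, hj⟩ h
    simp only [Finset.coe_filter, YoungDiagram.mem_cells, Set.mem_ofPred_eq] at *
    exact ⟨ν.up_left_mem hi hj h.1, (tableau_mono T hi hj h.1).trans_lt h.2⟩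

theorem mem_belowDiagram {T : SemistandardYoungTableau ν} {c : ℕ × ℕ} :
    c ∈ belowDiagram T t ↔ c ∈ ν ∧ T c.1 c.2 < t := by
  rw [← YoungDiagram.mem_cells]
  simp [belowDiagram]

theorem belowDiagram_le (T : SemistandardYoungTableau ν) (t : ℕ) : belowDiagram T t ≤ ν :=
  fun _ hc => (mem_belowDiagram.1 hc).1

/-- The restriction of a tableau to its entries smaller than `t`. -/
def restrictBelow (T : SemistandardYoungTableau ν) (t : ℕ) :
    SemistandardYoungTableau (belowDiagram T t) where
  entry i j := if (i, j) ∈ belowDiagram T t then T i j else 0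
  row_weak' {i j₁ j₂} hj h := by
    rw [if_pos h, if_pos ((belowDiagram T t).up_left_mem le_rfl hj.le h)]
    exact T.row_weak hj (mem_belowDiagram.1 h).1
  col_strict' {i₁ i₂ j} hi h := by
    rw [if_pos h, if_pos ((belowDiagram T t).up_left_mem hi.le le_rfl h)]
    exact T.col_strict hi (mem_belowDiagram.1 h).1
  zeros' h := if_neg h

theorem restrictBelow_apply {T : SemistandardYoungTableau ν} {c : ℕ × ℕ}
    (hc : c ∈ belowDiagram T t) : restrictBelow T t c.1 c.2 = T c.1 c.2 :=
  if_pos hc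

/-- Writing `g i` into the cells of `ν/κ` in row `i` extends every tableau of shape `κ` with entries
smaller than `t` to a tableau of shape `ν`, and the new entries are at least `t`. -/
structure IsRowFilling (κ ν : YoungDiagram) (t : ℕ) (g : ℕ → ℕ) : Prop where
  le : κ ≤ ν
  le_fill : ∀ {i j}, (i, j) ∈ ν → (i, j) ∉ κ → t ≤ g i
  fill_lt : ∀ {i₁ i₂ j}, i₁ < i₂ → (i₁, j) ∉ κ → (i₂, j) ∈ ν → g i₁ < g i₂

/-- The extension of a tableau of shape `κ` by a row filling of `ν/κ`. -/
def extendTableau (T : SemistandardYoungTableau κ) {g : ℕ → ℕ} (hg : IsRowFilling κ ν t g)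
    (hT : ∀ c ∈ κ, T c.1 c.2 < t) : SemistandardYoungTableau ν where
  entry i j := if (i, j) ∈ κ then T i j else if (i, j) ∈ ν then g i else 0
  row_weak' {i j₁ j₂} hj h := by
    have h₁ := ν.up_left_mem le_rfl hj.le h
    by_cases h₂ : (i, j₂) ∈ κ
    · rw [if_pos h₂, if_pos (κ.up_left_mem le_rfl hj.le h₂)]
      exact T.row_weak hj h₂
    · rw [if_neg h₂, if_pos h, if_pos h₁]
      split_ifs with h₃
      exacts [(hT _ h₃).le.trans (hg.le_fill h h₂), le_rfl]
  col_strict' {i₁ i₂ j} hi h := by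
    have h₁ := ν.up_left_mem hi.le le_rfl h
    by_cases h₂ : (i₂, j) ∈ κ
    · rw [if_pos h₂, if_pos (κ.up_left_mem hi.le le_rfl h₂)]
      exact T.col_strict hi h₂
    · rw [if_neg h₂, if_pos h, if_pos h₁]
      split_ifs with h₃
      exacts [(hT _ h₃).trans_le (hg.le_fill h h₂), hg.fill_lt hi h₃ h]
  zeros' {i j} h := by rw [if_neg fun h' => h (hg.le h'), if_neg h]

section Extend
variable {T : SemistandardYoungTableau κ} {g : ℕ → ℕ} (hg : IsRowFilling κ ν t g)
  (hT : ∀ c ∈ κ, T c.1 c.2 < t) {c : ℕ × ℕ}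

theorem extendTableau_of_mem (hc : c ∈ κ) : extendTableau T hg hT c.1 c.2 = T c.1 c.2 :=
  if_pos hc

theorem extendTableau_of_notMem (hν : c ∈ ν) (hκ : c ∉ κ) :
    extendTableau T hg hT c.1 c.2 = g c.1 :=
  (if_neg hκ).trans (if_pos hν)

theorem belowDiagram_extendTableau : belowDiagram (extendTableau T hg hT) t = κ := by
  ext c
  rw [YoungDiagram.mem_cells, YoungDiagram.mem_cells, mem_belowDiagram]
  by_cases hc : c ∈ κ
  · rw [extendTableau_of_mem hg hT hc]
    exact iff_of_true ⟨hg.le hc, hT c hc⟩ hc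
  · refine iff_of_false (fun h => ?_) hc
    rw [extendTableau_of_notMem hg hT h.1 hc] at h
    exact h.2.not_ge (hg.le_fill h.1 hc)

theorem restrictBelow_extendTableau :
    (⟨_, restrictBelow (extendTableau T hg hT) t⟩ : Σ κ, SemistandardYoungTableau κ) = ⟨κ, T⟩ :=
  sigma_tableau_ext (belowDiagram_extendTableau hg hT) fun c hc => by
    rw [restrictBelow_apply hc]
    exact extendTableau_of_mem hg hT (belowDiagram_extendTableau hg hT ▸ hc)

end Extend

theorem finite_tableaux_of_bounded (ν : YoungDiagram) (B : ℕ) :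
    Finite {T : SemistandardYoungTableau ν // ∀ c ∈ ν, T c.1 c.2 < B} := by
  refine Finite.of_injective (β := ν.cells → Fin B)
    (fun T c => ⟨T.1 c.1.1 c.1.2, T.2 c.1 c.2⟩) fun T T' h => ?_
  refine Subtype.ext (SemistandardYoungTableau.ext fun i j => ?_)
  by_cases hc : (i, j) ∈ ν
  · simpa using congrFun h ⟨(i, j), hc⟩
  · rw [T.1.zeros hc, T'.1.zeros hc]

theorem tableau_eq_of_restrictBelow_eq {T T' : SemistandardYoungTableau ν}
    (h : (⟨_, restrictBelow T t⟩ : Σ κ, SemistandardYoungTableau κ) = ⟨_, restrictBelow T' t⟩)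
    (h' : ∀ c ∈ ν, t ≤ T c.1 c.2 → t ≤ T' c.1 c.2 → T c.1 c.2 = T' c.1 c.2) : T = T' := by
  have hbelow : belowDiagram T t = belowDiagram T' t := congrArg Sigma.fst h
  have hentry (c : ℕ × ℕ) : restrictBelow T t c.1 c.2 = restrictBelow T' t c.1 c.2 :=
    congrArg (fun x : Σ κ, SemistandardYoungTableau κ => x.2 c.1 c.2) h
  have hsigma : (⟨ν, T⟩ : Σ κ, SemistandardYoungTableau κ) = ⟨ν, T'⟩ := by
    refine sigma_tableau_ext rfl fun c hc => ?_
    by_cases hlt : T c.1 c.2 < t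
    · have hm := mem_belowDiagram.2 ⟨hc, hlt⟩
      rw [← restrictBelow_apply hm, hentry, restrictBelow_apply (hbelow ▸ hm)]
    · refine h' c hc (not_lt.1 hlt) (not_lt.1 fun hlt' => hlt ?_)
      exact (mem_belowDiagram.1 (hbelow ▸ mem_belowDiagram.2 ⟨hc, hlt'⟩)).2
  exact eq_of_heq (Sigma.mk.inj hsigma).2

theorem sigma_subtype_tableau_injective (Q : ∀ κ, SemistandardYoungTableau κ → Prop)
    (F : Finset YoungDiagram) : Function.Injective fun x : Σ κ : F, {T // Q κ T} =>
      (⟨x.1.1, x.2.1⟩ : Σ κ, SemistandardYoungTableau κ) := by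
  rintro ⟨⟨κ, _⟩, ⟨T, _⟩⟩ ⟨⟨κ', _⟩, ⟨T', _⟩⟩ h
  obtain ⟨rfl, hT⟩ := Sigma.mk.inj h
  obtain rfl := eq_of_heq hT
  rfl

theorem card_tableaux_eq_sum_card_restrictBelow {P : SemistandardYoungTableau ν → Prop}
    {Q : ∀ κ, SemistandardYoungTableau κ → Prop} {F : Finset YoungDiagram}
    {fill : YoungDiagram → ℕ → ℕ}
    (hP : ∀ T, P T ↔ belowDiagram T t ∈ F ∧ Q _ (restrictBelow T t) ∧
      ∀ c ∈ ν, t ≤ T c.1 c.2 → T c.1 c.2 = fill (belowDiagram T t) c.1)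
    (hfill : ∀ κ ∈ F, IsRowFilling κ ν t (fill κ))
    (hQ : ∀ κ ∈ F, ∀ T, Q κ T → ∀ c ∈ κ, T c.1 c.2 < t) :
    Nat.card {T // P T} = ∑ κ ∈ F, Nat.card {T // Q κ T} := by
  let restrict (T : {T // P T}) : Σ κ : F, {T // Q κ T} :=
    ⟨⟨belowDiagram T.1 t, ((hP _).1 T.2).1⟩, ⟨restrictBelow T.1 t, ((hP _).1 T.2).2.1⟩⟩
  have hbij : Function.Bijective restrict := by
    refine ⟨fun ⟨T, hT⟩ ⟨T', hT'⟩ h => Subtype.ext ?_, fun ⟨⟨κ, hκ⟩, ⟨T, hT⟩⟩ => ?_⟩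
    · have hbelow : belowDiagram T t = belowDiagram T' t := congrArg (fun x => x.1.1) h
      refine tableau_eq_of_restrictBelow_eq
        (congrArg (fun x => (⟨x.1.1, x.2.1⟩ : Σ κ, SemistandardYoungTableau κ)) h)
        fun c hc hge hge' => ?_
      rw [((hP T).1 hT).2.2 c hc hge, ((hP T').1 hT').2.2 c hc hge', hbelow]
    · have hlt := hQ κ hκ T hT
      set E := extendTableau T (hfill κ hκ) hlt
      have hE : (⟨_, restrictBelow E t⟩ : Σ κ, SemistandardYoungTableau κ) = ⟨κ, T⟩ :=
        restrictBelow_extendTableau _ _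
      have hbelow : belowDiagram E t = κ := belowDiagram_extendTableau _ _
      refine ⟨⟨E, (hP E).2 ⟨hbelow ▸ hκ, ?_, fun c hc hge => ?_⟩⟩,
        sigma_subtype_tableau_injective Q F hE⟩
      · exact (congrArg (fun x => Q x.1 x.2) hE).mpr hT
      · rw [hbelow]
        refine extendTableau_of_notMem _ _ hc fun hcκ => ?_
        rw [extendTableau_of_mem _ hlt hcκ] at hge
        exact hge.not_gt (hlt c hcκ)
  have hfin (κ : F) : Finite {T // Q κ T} := by
    have := finite_tableaux_of_bounded κ t
    exact Finite.of_injective (β := {T : SemistandardYoungTableau κ // ∀ c ∈ κ.1, T c.1 c.2 < t})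
      (fun T => ⟨T.1, hQ κ κ.2 T.1 T.2⟩) fun T T' h => Subtype.ext (congrArg (·.1) h)
  rw [Nat.card_congr (Equiv.ofBijective restrict hbij), Nat.card_sigma]
  exact Finset.sum_coe_sort F fun κ => Nat.card {T // Q κ T}

end Tableaux

/-! ### The Pieri rule -/

section Content
variable {ν κ : YoungDiagram} {t N : ℕ} {δ : ℕ →₀ ℕ}

theorem isHorizontalStrip_belowDiagram {T : SemistandardYoungTableau ν}
    (hT : ∀ c ∈ ν, T c.1 c.2 ≤ t) : IsHorizontalStrip (belowDiagram T t) ν := by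
  refine fun i => ⟨rowLen_mono (belowDiagram_le T t) i, le_of_forall_lt fun j hj => ?_⟩
  rw [← YoungDiagram.mem_iff_lt_rowLen] at hj ⊢
  exact mem_belowDiagram.2 ⟨ν.up_left_mem i.le_succ le_rfl hj,
    (T.col_strict i.lt_succ_self hj).trans_le (hT _ hj)⟩

theorem IsHorizontalStrip.isRowFilling (h : IsHorizontalStrip κ ν) (t : ℕ) :
    IsRowFilling κ ν t fun _ => t where
  le := h.le
  le_fill _ _ := le_rfl
  fill_lt {i₁ i₂ j} hi h₁ h₂ := by
    rw [YoungDiagram.mem_iff_lt_rowLen] at h₁ h₂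
    exact absurd (h₂.trans_le ((ν.rowLen_anti _ _ hi).trans (h i₁).2)) h₁

/-- Each `v` appears `δ v` times in the tableau `T`. -/
def HasContent (T : SemistandardYoungTableau ν) (δ : ℕ →₀ ℕ) : Prop :=
  ∀ v, (ν.cells.filter fun c => T c.1 c.2 = v).card = δ v

theorem HasContent.ne_zero {T : SemistandardYoungTableau ν} (hT : HasContent T δ) {c : ℕ × ℕ}
    (hc : c ∈ ν) : δ (T c.1 c.2) ≠ 0 := by
  rw [← hT, Finset.card_ne_zero]
  exact ⟨c, Finset.mem_filter.2 ⟨hc, rfl⟩⟩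

theorem HasContent.le {T : SemistandardYoungTableau ν} (hT : HasContent T δ)
    (hδ : ∀ v, N < v → δ v = 0) {c : ℕ × ℕ} (hc : c ∈ ν) : T c.1 c.2 ≤ N :=
  not_lt.1 fun h => hT.ne_zero hc (hδ _ h)

theorem card_filter_restrictBelow (T : SemistandardYoungTableau ν) {v : ℕ} (hv : v < t) :
    ((belowDiagram T t).cells.filter fun c => restrictBelow T t c.1 c.2 = v).card =
      (ν.cells.filter fun c => T c.1 c.2 = v).card := by
  congr 1
  ext c
  simp only [Finset.mem_filter, YoungDiagram.mem_cells]
  constructor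
  · rintro ⟨hc, rfl⟩
    rw [restrictBelow_apply hc]
    exact ⟨(mem_belowDiagram.1 hc).1, rfl⟩
  · rintro ⟨hc, rfl⟩
    have hm := mem_belowDiagram.2 ⟨hc, hv⟩
    exact ⟨hm, restrictBelow_apply hm⟩

theorem card_filter_restrictBelow_of_le (T : SemistandardYoungTableau ν) {v : ℕ} (hv : t ≤ v) :
    ((belowDiagram T t).cells.filter fun c => restrictBelow T t c.1 c.2 = v).card = 0 := by
  refine Finset.card_eq_zero.2 (Finset.filter_eq_empty_iff.2 fun c hc => ?_)
  rw [restrictBelow_apply hc]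
  exact ((mem_belowDiagram.1 hc).2.trans_le hv).ne

theorem card_filter_eq_of_le {T : SemistandardYoungTableau ν} (hT : ∀ c ∈ ν, T c.1 c.2 ≤ t) :
    (ν.cells.filter fun c => T c.1 c.2 = t).card = ν.card - (belowDiagram T t).card := by
  rw [YoungDiagram.card, YoungDiagram.card, ← Finset.card_sdiff_of_subset
    (YoungDiagram.cells_subset_iff.2 (belowDiagram_le T t))]
  congr 1
  ext c
  simp only [Finset.mem_filter, Finset.mem_sdiff, YoungDiagram.mem_cells, mem_belowDiagram]
  refine and_congr_right fun hc => ?_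
  have := hT c hc
  simp only [hc, true_and, not_lt]
  omega

theorem hasContent_iff_restrictBelow (hδ : ∀ v, N < v → δ v = 0)
    (T : SemistandardYoungTableau ν) :
    HasContent T δ ↔ δ N = ν.card - (belowDiagram T N).card ∧
      HasContent (restrictBelow T N) (δ.erase N) ∧ ∀ c ∈ ν, N ≤ T c.1 c.2 → T c.1 c.2 = N := by
  constructor
  · refine fun hT => ⟨?_, fun v => ?_, fun c hc => (hT.le hδ hc).antisymm⟩
    · rw [← hT N, card_filter_eq_of_le fun c => hT.le hδ]
    · rcases lt_or_ge v N with hv | hv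
      · rw [card_filter_restrictBelow T hv, hT, Finsupp.erase_ne hv.ne]
      · rw [card_filter_restrictBelow_of_le T hv]
        rcases hv.eq_or_lt with rfl | hv
        exacts [Finsupp.erase_same.symm, ((Finsupp.erase_ne hv.ne').trans (hδ v hv)).symm]
  · rintro ⟨hN, hcont, htop⟩ v
    have hle : ∀ c ∈ ν, T c.1 c.2 ≤ N := fun c hc =>
      (le_total (T c.1 c.2) N).elim id fun h => (htop c hc h).le
    rcases lt_trichotomy v N with hv | rfl | hv
    · rw [← card_filter_restrictBelow T hv, hcont, Finsupp.erase_ne hv.ne]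
    · rw [card_filter_eq_of_le hle, hN]
    · rw [hδ v hv]
      exact Finset.card_eq_zero.2 (Finset.filter_eq_empty_iff.2 fun c hc =>
        ((hle c hc).trans_lt hv).ne)

theorem card_hasContent (ν : YoungDiagram) (hδ : ∀ v, N < v → δ v = 0) :
    Nat.card {T : SemistandardYoungTableau ν // HasContent T δ} =
      ∑ κ ∈ removeHorizontalStrips ν with δ N = ν.card - κ.card,
        Nat.card {T : SemistandardYoungTableau κ // HasContent T (δ.erase N)} := by
  refine card_tableaux_eq_sum_card_restrictBelow (t := N) (fill := fun _ _ => N) (fun T => ?_)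
    (fun κ hκ => ?_) fun κ _ T hT c hc => ?_
  · rw [hasContent_iff_restrictBelow hδ, Finset.mem_filter, mem_removeHorizontalStrips]
    refine ⟨fun ⟨hN, hcont, htop⟩ => ⟨⟨isHorizontalStrip_belowDiagram fun c hc => ?_, hN⟩, hcont,
      htop⟩, fun ⟨⟨_, hN⟩, hcont, htop⟩ => ⟨hN, hcont, htop⟩⟩
    exact (le_total (T c.1 c.2) N).elim id fun h => (htop c hc h).le
  · exact (mem_removeHorizontalStrips.1 (Finset.mem_filter.1 hκ).1).isRowFilling N
  · by_contra hlt
    refine hT.ne_zero hc ?_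
    rcases (not_lt.1 hlt).eq_or_lt with h | h
    · rw [← h, Finsupp.erase_same]
    · rw [Finsupp.erase_ne h.ne', hδ _ h]

end Content

section Truncation
open MvPowerSeries

variable {f g : MvPowerSeries ℕ ℂ} {δ : ℕ →₀ ℕ} {N : ℕ}

/-- The endomorphism of the algebra of formal power series that sets the variables `x_v` with
`N ≤ v` to zero; it lets identities of symmetric functions be proved one variable at a time. -/
noncomputable def truncVars (N : ℕ) : MvPowerSeries ℕ ℂ →ₐ[ℂ] MvPowerSeries ℕ ℂ :=
  (rename Fin.valEmbedding).comp (killCompl (Fin.valEmbedding (n := N)))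

theorem coeff_truncVars (f : MvPowerSeries ℕ ℂ) (hδ : ∀ v, N ≤ v → δ v = 0) :
    coeff δ (truncVars N f) = coeff δ f := by
  have hsupp : (δ.support : Set ℕ) ⊆ Set.range (Fin.valEmbedding (n := N)) := fun v hv =>
    ⟨⟨v, not_le.1 fun h => Finsupp.mem_support_iff.1 hv (hδ v h)⟩, rfl⟩
  rw [← Finsupp.embDomain_comapDomain hsupp, truncVars, AlgHom.comp_apply, coeff_embDomain_rename,
    coeff_killCompl]

theorem coeff_truncVars_eq_zero (f : MvPowerSeries ℕ ℂ) {v : ℕ} (hv : N ≤ v) (hδ : δ v ≠ 0) :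
    coeff δ (truncVars N f) = 0 := by
  rw [truncVars, AlgHom.comp_apply]
  refine coeff_rename_eq_zero (f := Fin.valEmbedding) _ ?_
  rintro ⟨x, rfl⟩
  refine hδ (Finsupp.mapDomain_of_notMem_range _ _ ?_)
  rintro ⟨i, rfl⟩
  exact i.is_lt.not_ge hv

theorem ext_truncVars (h : ∀ N, truncVars N f = truncVars N g) : f = g := by
  ext δ
  have hδ : ∀ v, δ.support.sup id + 1 ≤ v → δ v = 0 := fun v hv =>
    Finsupp.notMem_support_iff.1 fun hc => (Finset.le_sup (f := id) hc).not_gt hv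
  rw [← coeff_truncVars f hδ, h, coeff_truncVars g hδ]

theorem truncVars_zero_apply (f : MvPowerSeries ℕ ℂ) : truncVars 0 f = C (constantCoeff f) := by
  ext δ
  by_cases hδ : δ = 0
  · subst hδ
    rw [coeff_truncVars f fun _ _ => rfl, coeff_zero_C, coeff_zero_eq_constantCoeff_apply]
  · obtain ⟨v, hv⟩ := Finsupp.ne_iff.1 hδ
    rw [coeff_truncVars_eq_zero f v.zero_le hv, coeff_C, if_neg hδ]

open scoped Classical in
theorem coeff_X_pow_mul_truncVars (f : MvPowerSeries ℕ ℂ) (a : ℕ) (hδ : ∀ v, N < v → δ v = 0) :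
    coeff δ (X N ^ a * truncVars N f) = if δ N = a then coeff (δ.erase N) f else 0 := by
  rw [X_pow_eq, coeff_monomial_mul, one_mul]
  simp only [Finsupp.single_le_iff]
  have happly (v : ℕ) (hv : v ≠ N) : (δ - Finsupp.single N a) v = δ v := by
    rw [Finsupp.tsub_apply, Finsupp.single_eq_of_ne hv, Nat.sub_zero]
  have happlyN : (δ - Finsupp.single N a) N = δ N - a := by
    rw [Finsupp.tsub_apply, Finsupp.single_eq_same]
  rcases lt_trichotomy (δ N) a with h | h | h
  · rw [if_neg h.not_ge, if_neg h.ne]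
  · have hsub : δ - Finsupp.single N a = δ.erase N := by
      ext v
      by_cases hv : v = N
      · rw [hv, happlyN, h, Nat.sub_self, Finsupp.erase_same]
      · rw [happly v hv, Finsupp.erase_ne hv]
    rw [if_pos h.ge, if_pos h, hsub, coeff_truncVars f fun v hv => ?_]
    rcases hv.eq_or_lt with rfl | hv
    exacts [Finsupp.erase_same, (Finsupp.erase_ne hv.ne').trans (hδ v hv)]
  · rw [if_pos h.le, if_neg h.ne', coeff_truncVars_eq_zero f le_rfl]
    rw [happlyN]
    omega

theorem coeff_X_pow_mul_truncVars_eq_zero (f : MvPowerSeries ℕ ℂ) (a : ℕ) {v : ℕ} (hv : N < v)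
    (hδ : δ v ≠ 0) : coeff δ (X N ^ a * truncVars N f) = 0 := by
  classical
  rw [X_pow_eq, coeff_monomial_mul, one_mul, coeff_truncVars_eq_zero f hv.le, ite_self]
  rwa [Finsupp.tsub_apply, Finsupp.single_eq_of_ne hv.ne', Nat.sub_zero]

end Truncation

section Pieri
open MvPowerSeries

variable {δ : ℕ →₀ ℕ}

open scoped Classical in
theorem coeff_elemSymm (d : ℕ) (δ : ℕ →₀ ℕ) :
    coeff δ (elemSymm d) = if δ.degree = d ∧ ∀ v, δ v ≤ 1 then 1 else 0 :=
  if_congr (and_congr_left' Nat.cast_inj) rfl rfl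

theorem elemSymm_zero : elemSymm 0 = 1 := by
  classical
  ext δ
  rw [← Nat.cast_zero, coeff_elemSymm, coeff_one]
  refine if_congr ⟨fun h => (Finsupp.degree_eq_zero_iff δ).1 h.1, ?_⟩ rfl rfl
  rintro rfl
  exact ⟨map_zero _, fun _ => Nat.zero_le 1⟩

theorem constantCoeff_elemSymm_succ (d : ℕ) : constantCoeff (elemSymm (d + 1 : ℕ)) = 0 := by
  classical
  rw [← coeff_zero_eq_constantCoeff_apply, coeff_elemSymm, if_neg]
  rintro ⟨h, -⟩
  simp at h

theorem forall_le_one_iff_erase (N : ℕ) :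
    (∀ v, δ v ≤ 1) ↔ (∀ v, δ.erase N v ≤ 1) ∧ δ N ≤ 1 := by
  constructor
  · refine fun h => ⟨fun v => ?_, h N⟩
    by_cases hv : v = N
    · rw [hv, Finsupp.erase_same]
      exact zero_le_one
    · rw [Finsupp.erase_ne hv]
      exact h v
  · rintro ⟨h, hN⟩ v
    by_cases hv : v = N
    · rwa [hv]
    · rw [← Finsupp.erase_ne (f := δ) hv]
      exact h v

theorem degree_eq_degree_erase_add (δ : ℕ →₀ ℕ) (N : ℕ) :
    δ.degree = (δ.erase N).degree + δ N := by
  conv_lhs => rw [← Finsupp.erase_add_single N δ]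
  rw [map_add, Finsupp.degree_single]

theorem truncVars_succ_elemSymm (N d : ℕ) : truncVars (N + 1) (elemSymm (d + 1 : ℕ)) =
    truncVars N (elemSymm (d + 1 : ℕ)) + X N * truncVars N (elemSymm d) := by
  classical
  ext δ
  rw [← one_mul (truncVars N (elemSymm (d + 1 : ℕ))), ← pow_zero (X N : MvPowerSeries ℕ ℂ),
    ← pow_one (X N), ← pow_mul, mul_zero, map_add]
  by_cases h : ∀ v, N < v → δ v = 0
  · rw [coeff_truncVars _ h, coeff_X_pow_mul_truncVars _ _ h, coeff_X_pow_mul_truncVars _ _ h,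
      coeff_elemSymm, coeff_elemSymm, coeff_elemSymm, forall_le_one_iff_erase N,
      degree_eq_degree_erase_add δ N]
    generalize (∀ v, δ.erase N v ≤ 1) = p
    rcases δ N with _ | _ | k
    · simp
    · simp
    · have : ¬ k + 1 + 1 ≤ 1 := by omega
      simp [this]
  · push Not at h
    obtain ⟨v, hv, hδ⟩ := h
    rw [coeff_truncVars_eq_zero _ hv hδ, coeff_X_pow_mul_truncVars_eq_zero _ _ hv hδ,
      coeff_X_pow_mul_truncVars_eq_zero _ _ hv hδ, add_zero]

theorem coeff_schur (ν : YoungDiagram) (δ : ℕ →₀ ℕ) :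
    coeff δ (schur ν) = Nat.card {T : SemistandardYoungTableau ν // HasContent T δ} := rfl

theorem constantCoeff_schur {ν : YoungDiagram} (h : ν.card ≠ 0) :
    constantCoeff (schur ν) = 0 := by
  rw [← coeff_zero_eq_constantCoeff_apply, coeff_schur]
  obtain ⟨c, hc⟩ := Finset.card_ne_zero.1 h
  have : IsEmpty {T : SemistandardYoungTableau ν // HasContent T 0} :=
    ⟨fun T => T.2.ne_zero hc rfl⟩
  rw [Nat.card_of_isEmpty, Nat.cast_zero]

theorem truncVars_succ_schur (N : ℕ) (ν : YoungDiagram) :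
    truncVars (N + 1) (schur ν) = ∑ κ ∈ removeHorizontalStrips ν,
      X N ^ (ν.card - κ.card) * truncVars N (schur κ) := by
  classical
  ext δ
  rw [map_sum]
  by_cases h : ∀ v, N < v → δ v = 0
  · rw [coeff_truncVars _ h, coeff_schur, card_hasContent ν h, Finset.sum_filter, Nat.cast_sum]
    refine Finset.sum_congr rfl fun κ _ => ?_
    rw [coeff_X_pow_mul_truncVars _ _ h, coeff_schur, Nat.cast_ite, Nat.cast_zero]
  · push Not at h
    obtain ⟨v, hv, hδ⟩ := h
    rw [coeff_truncVars_eq_zero _ hv hδ]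
    exact (Finset.sum_eq_zero fun κ _ => coeff_X_pow_mul_truncVars_eq_zero _ _ hv hδ).symm

theorem addVerticalStrips_zero (μ : YoungDiagram) : addVerticalStrips μ 0 = {μ} := by
  ext ν
  rw [mem_addVerticalStrips, Finset.mem_singleton, add_zero]
  constructor
  · rintro ⟨hν, hcard⟩
    have hcells := Finset.eq_of_subset_of_card_le (YoungDiagram.cells_subset_iff.2 hν.le) hcard.le
    exact YoungDiagram.ext hcells.symm
  · rintro rfl
    exact ⟨fun i => ⟨le_rfl, Nat.le_succ _⟩, rfl⟩

theorem sum_sum_eq_sum_card_smul {α β A : Type*} [DecidableEq β] [AddCommMonoid A] {s : Finset α}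
    {t : α → Finset β} {U : Finset β} (h : ∀ a ∈ s, t a ⊆ U) (G : β → A) :
    ∑ a ∈ s, ∑ b ∈ t a, G b = ∑ b ∈ U, (s.filter fun a => b ∈ t a).card • G b := by
  rw [Finset.sum_comm' (t' := U) (s' := fun b => s.filter fun a => b ∈ t a) fun a b => ?_]
  · exact Finset.sum_congr rfl fun b _ => Finset.sum_const _
  · rw [Finset.mem_filter]
    exact ⟨fun ⟨ha, hb⟩ => ⟨⟨ha, hb⟩, h a ha hb⟩, fun ⟨⟨ha, hb⟩, _⟩ => ⟨ha, hb⟩⟩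

theorem sum_addVerticalStrips_removeHorizontalStrips {A : Type*} [AddCommMonoid A]
    (μ : YoungDiagram) (d : ℕ) (G : YoungDiagram → A) :
    ∑ ν ∈ addVerticalStrips μ (d + 1), ∑ ρ ∈ removeHorizontalStrips ν, G ρ =
      ∑ κ ∈ removeHorizontalStrips μ,
        (∑ ρ ∈ addVerticalStrips κ (d + 1), G ρ + ∑ ρ ∈ addVerticalStrips κ d, G ρ) := by
  classical
  set U := (finite_setOf_card_le (μ.card + (d + 1))).toFinset
  have hU {ρ : YoungDiagram} : ρ.card ≤ μ.card + (d + 1) → ρ ∈ U := fun h => by simpa [U] using h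
  rw [Finset.sum_add_distrib,
    sum_sum_eq_sum_card_smul (U := U) fun ν hν ρ hρ => hU ?_,
    sum_sum_eq_sum_card_smul (U := U) fun κ hκ ρ hρ => hU ?_,
    sum_sum_eq_sum_card_smul (U := U) fun κ hκ ρ hρ => hU ?_, ← Finset.sum_add_distrib]
  · refine Finset.sum_congr rfl fun ρ _ => ?_
    simp only [mem_removeHorizontalStrips]
    rw [← add_smul, ← card_addVerticalStrips_filter]
  · have := youngDiagram_card_le (mem_removeHorizontalStrips.1 hκ).le
    have := (mem_addVerticalStrips.1 hρ).2
    omega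
  · have := youngDiagram_card_le (mem_removeHorizontalStrips.1 hκ).le
    have := (mem_addVerticalStrips.1 hρ).2
    omega
  · rw [← (mem_addVerticalStrips.1 hν).2]
    exact youngDiagram_card_le (mem_removeHorizontalStrips.1 hρ).le

theorem truncVars_succ_elemSymm_mul_schur (N d : ℕ) (μ : YoungDiagram) :
    truncVars (N + 1) (elemSymm (d + 1 : ℕ)) * truncVars (N + 1) (schur μ) =
      ∑ κ ∈ removeHorizontalStrips μ,
        (X N ^ (μ.card - κ.card) * (truncVars N (elemSymm (d + 1 : ℕ)) * truncVars N (schur κ)) +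
          X N ^ (μ.card - κ.card + 1) * (truncVars N (elemSymm d) * truncVars N (schur κ))) := by
  rw [truncVars_succ_elemSymm, truncVars_succ_schur, Finset.mul_sum]
  exact Finset.sum_congr rfl fun κ _ => by ring

theorem elemSymm_zero_mul_schur (μ : YoungDiagram) :
    elemSymm (0 : ℕ) * schur μ = ∑ ν ∈ addVerticalStrips μ 0, schur ν := by
  rw [Nat.cast_zero, elemSymm_zero, one_mul, addVerticalStrips_zero, Finset.sum_singleton]

theorem truncVars_elemSymm_mul_schur (N d : ℕ) (μ : YoungDiagram) :
    truncVars N (elemSymm d) * truncVars N (schur μ) =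
      ∑ ν ∈ addVerticalStrips μ d, truncVars N (schur ν) := by
  obtain - | d := d
  · rw [← map_mul, elemSymm_zero_mul_schur, map_sum]
  induction N generalizing μ d with
  | zero =>
    simp only [truncVars_zero_apply]
    rw [constantCoeff_elemSymm_succ, map_zero, zero_mul]
    refine (Finset.sum_eq_zero fun ν hν => ?_).symm
    have := (mem_addVerticalStrips.1 hν).2
    rw [constantCoeff_schur (by omega), map_zero]
  | succ N ih =>
    have ih' (κ : YoungDiagram) : truncVars N (elemSymm d) * truncVars N (schur κ) =
        ∑ ν ∈ addVerticalStrips κ d, truncVars N (schur ν) := by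
      obtain - | d := d
      · rw [← map_mul, elemSymm_zero_mul_schur, map_sum]
      · exact ih κ d
    let G (ρ : YoungDiagram) : MvPowerSeries ℕ ℂ :=
      X N ^ (μ.card + (d + 1) - ρ.card) * truncVars N (schur ρ)
    calc truncVars (N + 1) (elemSymm (d + 1 : ℕ)) * truncVars (N + 1) (schur μ)
        = ∑ κ ∈ removeHorizontalStrips μ,
            (∑ ρ ∈ addVerticalStrips κ (d + 1), G ρ + ∑ ρ ∈ addVerticalStrips κ d, G ρ) := by
          rw [truncVars_succ_elemSymm_mul_schur]
          refine Finset.sum_congr rfl fun κ hκ => ?_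
          have hκμ := youngDiagram_card_le (mem_removeHorizontalStrips.1 hκ).le
          rw [ih, ih', Finset.mul_sum, Finset.mul_sum]
          congr 1 <;> refine Finset.sum_congr rfl fun ρ hρ => ?_
          · have hρκ := (mem_addVerticalStrips.1 hρ).2
            rw [show μ.card - κ.card = μ.card + (d + 1) - ρ.card by omega]
          · have hρκ := (mem_addVerticalStrips.1 hρ).2
            rw [show μ.card - κ.card + 1 = μ.card + (d + 1) - ρ.card by omega]
      _ = ∑ ν ∈ addVerticalStrips μ (d + 1), ∑ ρ ∈ removeHorizontalStrips ν, G ρ :=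
          (sum_addVerticalStrips_removeHorizontalStrips μ d G).symm
      _ = ∑ ν ∈ addVerticalStrips μ (d + 1), truncVars (N + 1) (schur ν) := by
          refine Finset.sum_congr rfl fun ν hν => ?_
          rw [truncVars_succ_schur, (mem_addVerticalStrips.1 hν).2]

theorem elemSymm_mul_schur (d : ℕ) (μ : YoungDiagram) :
    elemSymm d * schur μ = ∑ ν ∈ addVerticalStrips μ d, schur ν :=
  ext_truncVars fun N => by rw [map_mul, truncVars_elemSymm_mul_schur, map_sum]

end Pieri

/-! ### Standard tableaux with prescribed descents -/

section Standard
variable {μ ν : YoungDiagram} {m r : ℕ} {B : Set ℕ} {T : SemistandardYoungTableau ν}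

theorem isStandard_of_injOn (h : ∀ c ∈ ν, 1 ≤ T c.1 c.2 ∧ T c.1 c.2 ≤ ν.card)
    (hinj : Set.InjOn (fun c : ℕ × ℕ => T c.1 c.2) ν.cells) : IsStandard T := by
  refine ⟨fun c hc => h c hc, hinj, ?_⟩
  rw [← Finset.coe_Icc]
  exact Finset.surjOn_of_injOn_of_card_le _ (fun c hc => by simpa using h c hc) hinj
    (by rw [Nat.card_Icc]; rfl)

theorem IsStandard.card_filter (hT : IsStandard T) {a b : ℕ} (hb : b ≤ ν.card) :
    (ν.cells.filter fun c => a < T c.1 c.2 ∧ T c.1 c.2 ≤ b).card = b - a := by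
  rw [← Nat.card_Ioc]
  refine Finset.card_bij (fun c _ => T c.1 c.2) (fun c hc => ?_) (fun c hc c' hc' => ?_)
    fun x hx => ?_
  · exact Finset.mem_Ioc.2 (Finset.mem_filter.1 hc).2
  · exact hT.injOn (Finset.mem_filter.1 hc).1 (Finset.mem_filter.1 hc').1
  · rw [Finset.mem_Ioc] at hx
    obtain ⟨c, hc, rfl⟩ := hT.surjOn (show x ∈ Set.Icc 1 ν.card from ⟨by omega, hx.2.trans hb⟩)
    exact ⟨c, Finset.mem_filter.2 ⟨hc, hx⟩, rfl⟩

theorem IsStandard.card_belowDiagram (hT : IsStandard T) (hm : m ≤ ν.card) :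
    (belowDiagram T (m + 1)).card = m := by
  refine Eq.trans ?_ (hT.card_filter (a := 0) hm)
  refine congrArg Finset.card (Finset.filter_congr fun c hc => ?_)
  have : 1 ≤ T c.1 c.2 := (hT.mapsTo hc).1
  omega

theorem IsStandard.restrictBelow (hT : IsStandard T) (hm : m ≤ ν.card) :
    IsStandard (restrictBelow T (m + 1)) := by
  refine isStandard_of_injOn (fun c hc => ?_) fun c hc c' hc' h => ?_
  · rw [restrictBelow_apply hc, hT.card_belowDiagram hm]
    have hc := mem_belowDiagram.1 hc
    exact ⟨(hT.mapsTo hc.1).1, Nat.le_of_lt_succ hc.2⟩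
  · dsimp only at h
    rw [restrictBelow_apply hc, restrictBelow_apply hc'] at h
    exact hT.injOn (mem_belowDiagram.1 hc).1 (mem_belowDiagram.1 hc').1 h

theorem mem_tableauDes_restrictBelow {a t : ℕ} (ha : a + 1 < t) :
    a ∈ tableauDes (restrictBelow T t) ↔ a ∈ tableauDes T := by
  constructor
  · rintro ⟨c, hc, c', hc', h, h', hlt⟩
    rw [restrictBelow_apply hc] at h
    rw [restrictBelow_apply hc'] at h'
    exact ⟨c, belowDiagram_le T t hc, c', belowDiagram_le T t hc', h, h', hlt⟩
  · rintro ⟨c, hc, c', hc', h, h', hlt⟩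
    have hc : c ∈ belowDiagram T t := mem_belowDiagram.2 ⟨hc, by omega⟩
    have hc' : c' ∈ belowDiagram T t := mem_belowDiagram.2 ⟨hc', by omega⟩
    rw [← restrictBelow_apply hc] at h
    rw [← restrictBelow_apply hc'] at h'
    exact ⟨c, hc, c', hc', h, h', hlt⟩

section StripRank

/-- The number of cells of `ν/μ` in the rows up to `i`. -/
def stripRank (μ ν : YoungDiagram) (i : ℕ) : ℕ :=
  ((ν.cells \ μ.cells).filter fun c => c.1 ≤ i).card

theorem stripRank_mono (μ ν : YoungDiagram) : Monotone (stripRank μ ν) := fun _ _ h =>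
  Finset.card_le_card (Finset.monotone_filter_right _ fun _ _ hc => hc.trans h)

theorem stripRank_lt {i : ℕ} {c : ℕ × ℕ} (h : i < c.1) (hν : c ∈ ν) (hμ : c ∉ μ) :
    stripRank μ ν i < stripRank μ ν c.1 :=
  Finset.card_lt_card <| Finset.ssubset_iff_subset_ne.2
    ⟨Finset.monotone_filter_right _ fun _ _ hc => hc.trans h.le,
      fun he => by simpa [hν, hμ, h.not_ge] using Finset.ext_iff.1 he c⟩

theorem stripRank_pos {c : ℕ × ℕ} (hν : c ∈ ν) (hμ : c ∉ μ) : 0 < stripRank μ ν c.1 :=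
  Finset.card_pos.2 ⟨c, by simp [hν, hμ]⟩

theorem stripRank_le (h : μ ≤ ν) (i : ℕ) : stripRank μ ν i ≤ ν.card - μ.card :=
  (Finset.card_filter_le _ _).trans_eq
    (Finset.card_sdiff_of_subset (YoungDiagram.cells_subset_iff.2 h))

theorem IsVerticalStrip.eq_of_row_eq (h : IsVerticalStrip μ ν) {c c' : ℕ × ℕ} (hν : c ∈ ν)
    (hμ : c ∉ μ) (hν' : c' ∈ ν) (hμ' : c' ∉ μ) (hrow : c.1 = c'.1) : c = c' := by
  obtain ⟨i, j⟩ := c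
  obtain ⟨i', j'⟩ := c'
  obtain rfl : i = i' := hrow
  rw [YoungDiagram.mem_iff_lt_rowLen] at *
  have := h i
  exact Prod.ext rfl (by dsimp only; omega)

theorem IsVerticalStrip.stripRank_injOn (h : IsVerticalStrip μ ν) :
    Set.InjOn (fun c : ℕ × ℕ => stripRank μ ν c.1) {c | c ∈ ν ∧ c ∉ μ} :=
  fun c hc c' hc' heq => h.eq_of_row_eq hc.1 hc.2 hc'.1 hc'.2 <| by
    rcases lt_trichotomy c.1 c'.1 with hlt | hrow | hlt
    · exact absurd heq (stripRank_lt hlt hc'.1 hc'.2).ne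
    · exact hrow
    · exact absurd heq (stripRank_lt hlt hc.1 hc.2).ne'

theorem isRowFilling_stripRank (h : μ ≤ ν) (m : ℕ) :
    IsRowFilling μ ν (m + 1) fun i => m + stripRank μ ν i where
  le := h
  le_fill hν hμ := Nat.add_le_add_left (stripRank_pos hν hμ) m
  fill_lt {_ i₂ j} hi hμ hν :=
    Nat.add_lt_add_left (stripRank_lt (c := (i₂, j)) hi hν
      fun hμ' => hμ (μ.up_left_mem hi.le le_rfl hμ')) m

end StripRank

section Descents

theorem IsStandard.row_lt_of_descents (hT : IsStandard T)
    (hdes : ∀ a, m < a → a < ν.card → a ∈ tableauDes T) {c c' : ℕ × ℕ} (hc : c ∈ ν) (hc' : c' ∈ ν)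
    (hm : m < T c.1 c.2) (hlt : T c.1 c.2 < T c'.1 c'.2) : c.1 < c'.1 := by
  obtain ⟨k, hk⟩ := Nat.exists_eq_add_of_lt hlt
  induction k generalizing c' with
  | zero =>
    have hle : T c'.1 c'.2 ≤ ν.card := (hT.mapsTo hc').2
    obtain ⟨x, hx, x', hx', h, h', hrow⟩ := hdes (T c.1 c.2) hm (by omega)
    rwa [← hT.injOn hx hc h, ← hT.injOn hx' hc' (h'.trans hk.symm)]
  | succ k ih =>
    have hle : T c'.1 c'.2 ≤ ν.card := (hT.mapsTo hc').2
    obtain ⟨x, hx, x', hx', h, h', hrow⟩ := hdes (T c.1 c.2 + k + 1) (by omega) (by omega)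
    rw [← hT.injOn hx' hc' (h'.trans hk.symm)]
    exact (ih hx (by omega) h).trans hrow

theorem IsStandard.row_le_iff_of_descents (hT : IsStandard T)
    (hdes : ∀ a, m < a → a < ν.card → a ∈ tableauDes T) {c c' : ℕ × ℕ} (hc : c ∈ ν) (hc' : c' ∈ ν)
    (hm : m < T c.1 c.2) (hm' : m < T c'.1 c'.2) : c.1 ≤ c'.1 ↔ T c.1 c.2 ≤ T c'.1 c'.2 := by
  refine ⟨fun h => not_lt.1 fun hlt => ?_, fun h => ?_⟩
  · exact (hT.row_lt_of_descents hdes hc' hc hm' hlt).not_ge h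
  · rcases h.eq_or_lt with h | h
    · exact (congrArg Prod.fst (hT.injOn hc hc' h)).le
    · exact (hT.row_lt_of_descents hdes hc hc' hm h).le

theorem IsStandard.isVerticalStrip_belowDiagram (hT : IsStandard T)
    (hdes : ∀ a, m < a → a < ν.card → a ∈ tableauDes T) :
    IsVerticalStrip (belowDiagram T (m + 1)) ν := by
  set κ := belowDiagram T (m + 1) with hκ
  refine fun i => ⟨rowLen_mono (belowDiagram_le T _) i, not_lt.1 fun hlt => ?_⟩
  have hc : (i, κ.rowLen i) ∈ ν := YoungDiagram.mem_iff_lt_rowLen.2 (by omega)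
  have hc' : (i, κ.rowLen i + 1) ∈ ν := YoungDiagram.mem_iff_lt_rowLen.2 hlt
  have hm : m < T i (κ.rowLen i) := by
    have : (i, κ.rowLen i) ∉ κ := by simp [YoungDiagram.mem_iff_lt_rowLen]
    rw [hκ, mem_belowDiagram, not_and, not_lt] at this
    exact this hc
  have hm' := hm.trans_le (T.row_weak (Nat.lt_succ_self _) hc')
  have heq := ((hT.row_le_iff_of_descents hdes hc hc' hm hm').1 le_rfl).antisymm
    ((hT.row_le_iff_of_descents hdes hc' hc hm' hm).1 le_rfl)
  simpa using hT.injOn hc hc' heq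

theorem IsStandard.eq_add_stripRank_of_descents (hT : IsStandard T)
    (hdes : ∀ a, m < a → a < ν.card → a ∈ tableauDes T) {c : ℕ × ℕ} (hc : c ∈ ν)
    (hm : m < T c.1 c.2) : T c.1 c.2 = m + stripRank (belowDiagram T (m + 1)) ν c.1 := by
  have hle : T c.1 c.2 ≤ ν.card := (hT.mapsTo hc).2
  have hrank : stripRank (belowDiagram T (m + 1)) ν c.1 = T c.1 c.2 - m := by
    rw [← hT.card_filter hle, stripRank]
    congr 1
    ext x
    simp only [Finset.mem_filter, Finset.mem_sdiff, YoungDiagram.mem_cells, mem_belowDiagram,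
      not_and, not_lt, and_assoc]
    refine and_congr_right fun hx => ⟨fun ⟨h, hrow⟩ => ?_, fun ⟨h, hle⟩ => ?_⟩
    · exact ⟨h hx, (hT.row_le_iff_of_descents hdes hx hc (h hx) hm).1 hrow⟩
    · exact ⟨fun _ => h, (hT.row_le_iff_of_descents hdes hx hc h hm).2 hle⟩
  omega

theorem isStandard_of_restrictBelow (hcard : (belowDiagram T (m + 1)).card = m)
    (hstrip : IsVerticalStrip (belowDiagram T (m + 1)) ν)
    (hT : IsStandard (restrictBelow T (m + 1)))
    (htop : ∀ c ∈ ν, m + 1 ≤ T c.1 c.2 →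
      T c.1 c.2 = m + stripRank (belowDiagram T (m + 1)) ν c.1) : IsStandard T := by
  have hnot {c : ℕ × ℕ} (h : m + 1 ≤ T c.1 c.2) : c ∉ belowDiagram T (m + 1) :=
    fun hc => h.not_gt (mem_belowDiagram.1 hc).2
  refine isStandard_of_injOn (fun c hc => ?_) fun c hc c' hc' heq => ?_
  · rcases lt_or_ge (T c.1 c.2) (m + 1) with h | h
    · have hmem := mem_belowDiagram.2 ⟨hc, h⟩
      have hbounds := hT.mapsTo hmem
      have hle := youngDiagram_card_le hstrip.le
      rw [restrictBelow_apply hmem] at hbounds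
      exact ⟨hbounds.1, hbounds.2.trans hle⟩
    · have hle := stripRank_le hstrip.le c.1
      have hle' := youngDiagram_card_le hstrip.le
      have := htop c hc h
      omega
  · dsimp only at heq
    rcases lt_or_ge (T c.1 c.2) (m + 1) with h | h
    · have hmem := mem_belowDiagram.2 ⟨hc, h⟩
      have hmem' := mem_belowDiagram.2 ⟨hc', heq ▸ h⟩
      refine hT.injOn hmem hmem' ?_
      rw [restrictBelow_apply hmem, restrictBelow_apply hmem', heq]
    · have h' := heq ▸ h
      refine hstrip.stripRank_injOn ⟨hc, hnot h⟩ ⟨hc', hnot h'⟩ (Nat.add_left_cancel (n := m) ?_)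
      dsimp only
      rw [← htop c hc h, ← htop c' hc' h', heq]

theorem IsStandard.mem_tableauDes_of_stripRank (hT : IsStandard T)
    (htop : ∀ c ∈ ν, m + 1 ≤ T c.1 c.2 → T c.1 c.2 = m + stripRank μ ν c.1) {a : ℕ} (hm : m < a)
    (ha : a < ν.card) : a ∈ tableauDes T := by
  obtain ⟨c, hc, h⟩ := hT.surjOn (show a ∈ Set.Icc 1 ν.card from ⟨by omega, ha.le⟩)
  obtain ⟨c', hc', h'⟩ := hT.surjOn (show a + 1 ∈ Set.Icc 1 ν.card from ⟨by omega, ha⟩)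
  dsimp only at h h'
  refine ⟨c, hc, c', hc', h, h', not_le.1 fun hle => ?_⟩
  have := stripRank_mono μ ν hle
  have := htop c hc (by omega)
  have := htop c' hc' (by omega)
  omega

/-- `T` is a standard tableau whose descent set contains all the elements of `B` smaller than its
size. -/
def IsStandardWithDescents (B : Set ℕ) (T : SemistandardYoungTableau ν) : Prop :=
  IsStandard T ∧ ∀ a ∈ B, a < ν.card → a ∈ tableauDes T

theorem isStandardWithDescents_iff_restrictBelow (hν : ν.card = m + r) (hm : m ∉ B)
    (hB : ∀ x, m < x → x < m + r → x ∈ B) (T : SemistandardYoungTableau ν) :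
    IsStandardWithDescents B T ↔ belowDiagram T (m + 1) ∈ removeVerticalStrips ν r ∧
      IsStandardWithDescents B (restrictBelow T (m + 1)) ∧
      ∀ c ∈ ν, m + 1 ≤ T c.1 c.2 → T c.1 c.2 = m + stripRank (belowDiagram T (m + 1)) ν c.1 := by
  rw [mem_removeVerticalStrips]
  constructor
  · rintro ⟨hT, hdes⟩
    have hcard := hT.card_belowDiagram (show m ≤ ν.card by omega)
    have hdes' (a : ℕ) (hlt : m < a) (ha : a < ν.card) : a ∈ tableauDes T :=
      hdes a (hB a hlt (hν ▸ ha)) ha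
    exact ⟨⟨hT.isVerticalStrip_belowDiagram hdes', by omega⟩, ⟨hT.restrictBelow (by omega),
      fun a ha hlt => (mem_tableauDes_restrictBelow (by omega)).2 (hdes a ha (by omega))⟩,
      fun c hc => hT.eq_add_stripRank_of_descents hdes' hc⟩
  · rintro ⟨⟨hstrip, hcard⟩, ⟨hrestrict, hdes⟩, htop⟩
    have hT := isStandard_of_restrictBelow (by omega) hstrip hrestrict htop
    refine ⟨hT, fun a ha hlt => ?_⟩
    rcases lt_trichotomy a m with h | rfl | h
    · exact (mem_tableauDes_restrictBelow (by omega)).1 (hdes a ha (by omega))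
    · exact absurd ha hm
    · exact hT.mem_tableauDes_of_stripRank htop h hlt

theorem card_isStandardWithDescents (hν : ν.card = m + r) (hm : m ∉ B)
    (hB : ∀ x, m < x → x < m + r → x ∈ B) :
    Nat.card {T : SemistandardYoungTableau ν // IsStandardWithDescents B T} =
      ∑ κ ∈ removeVerticalStrips ν r,
        Nat.card {T : SemistandardYoungTableau κ // IsStandardWithDescents B T} := by
  refine card_tableaux_eq_sum_card_restrictBelow
    (isStandardWithDescents_iff_restrictBelow hν hm hB)
    (fun κ hκ => isRowFilling_stripRank (mem_removeVerticalStrips.1 hκ).1.le m)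
    fun κ hκ T hT c hc => Nat.lt_succ_of_le ((hT.1.mapsTo hc).2.trans_eq ?_)
  have := (mem_removeVerticalStrips.1 hκ).2
  omega

end Descents

section DescentSeries

/-- The generating function, in terms of Schur functions, of the standard tableaux of size `m` whose
descent set contains the elements of `B` smaller than `m`. -/
noncomputable def descentSeries (B : Set ℕ) (m : ℕ) : MvPowerSeries ℕ ℂ :=
  ∑ ν : PartitionOf m,
    Nat.card {T : SemistandardYoungTableau ν.1 // IsStandardWithDescents B T} • schur ν.1

theorem sum_removeVerticalStrips_comm {A : Type*} [AddCommMonoid A] (m r : ℕ)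
    (G : YoungDiagram → YoungDiagram → A) :
    ∑ ν : PartitionOf (m + r), ∑ μ ∈ removeVerticalStrips ν.1 r, G μ ν.1 =
      ∑ μ : PartitionOf m, ∑ ν ∈ addVerticalStrips μ.1 r, G μ.1 ν := by
  rw [Finset.sum_sigma', Finset.sum_sigma']
  refine Finset.sum_bij'
    (fun x hx => ⟨⟨x.2, ?_⟩, x.1.1⟩) (fun x hx => ⟨⟨x.2, ?_⟩, x.1.1⟩) ?_ ?_ ?_ ?_ ?_
  · have := (mem_removeVerticalStrips.1 (Finset.mem_sigma.1 hx).2).2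
    have := x.1.2
    omega
  · rw [(mem_addVerticalStrips.1 (Finset.mem_sigma.1 hx).2).2, x.1.2]
  all_goals simp +contextual [mem_removeVerticalStrips, mem_addVerticalStrips]

theorem descentSeries_add (hm : m ∉ B) (hB : ∀ x, m < x → x < m + r → x ∈ B) :
    descentSeries B (m + r) = elemSymm r * descentSeries B m := by
  simp only [descentSeries, Finset.mul_sum, mul_smul_comm, elemSymm_mul_schur, Finset.smul_sum]
  rw [← sum_removeVerticalStrips_comm m r fun μ ν =>
    Nat.card {T : SemistandardYoungTableau μ // IsStandardWithDescents B T} • schur ν]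
  refine Finset.sum_congr rfl fun ν _ => ?_
  rw [card_isStandardWithDescents ν.2 hm hB, Finset.sum_smul]

instance : Unique (SemistandardYoungTableau ⊥) where
  uniq T := SemistandardYoungTableau.ext fun i j => by
    rw [T.zeros (YoungDiagram.notMem_bot _), SemistandardYoungTableau.zeros _
      (YoungDiagram.notMem_bot _)]

theorem eq_bot_of_card_eq_zero (h : ν.card = 0) : ν = ⊥ :=
  YoungDiagram.ext (Finset.card_eq_zero.1 h)

theorem schur_bot : schur ⊥ = 1 := by
  classical
  ext δ
  rw [coeff_schur, MvPowerSeries.coeff_one]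
  split_ifs with h
  · rw [Nat.cast_eq_one, Nat.card_eq_one_iff_unique]
    exact ⟨inferInstance, ⟨⟨default, by simp [HasContent, h]⟩⟩⟩
  · rw [Nat.cast_eq_zero, Nat.card_eq_zero]
    refine .inl ⟨fun T => h (Finsupp.ext fun v => ?_)⟩
    rw [← T.2 v]
    simp

theorem descentSeries_zero (B : Set ℕ) : descentSeries B 0 = 1 := by
  have hcard : Nat.card {T : SemistandardYoungTableau ⊥ // IsStandardWithDescents B T} = 1 := by
    rw [Nat.card_eq_one_iff_unique]
    refine ⟨inferInstance, ⟨⟨default, isStandard_of_injOn ?_ ?_,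
      fun a _ ha => absurd ha (Nat.not_lt_zero a)⟩⟩⟩ <;> simp
  rw [descentSeries, Fintype.sum_eq_single (⟨⊥, rfl⟩ : PartitionOf 0)
    fun ν h => absurd (Subtype.ext (eq_bot_of_card_eq_zero ν.2)) h, hcard, one_smul, schur_bot]

end DescentSeries

end Standard

/-! ### Ribbons -/

namespace SkewShape
variable {R : SkewShape} {i j : ℕ}

theorem mem_cells_iff : (i, j) ∈ R.cells ↔ R.inner.rowLen i ≤ j ∧ j < R.outer.rowLen i := by
  rw [cells, Finset.mem_sdiff, YoungDiagram.mem_cells, YoungDiagram.mem_cells,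
    YoungDiagram.mem_iff_lt_rowLen, YoungDiagram.mem_iff_lt_rowLen, not_lt, and_comm]

theorem inner_rowLen_le (R : SkewShape) (i : ℕ) : R.inner.rowLen i ≤ R.outer.rowLen i := by
  refine le_of_forall_lt fun j hj => ?_
  rw [← YoungDiagram.mem_iff_lt_rowLen] at hj ⊢
  exact R.inner_le hj

theorem inner_rowLen_succ_le (R : SkewShape) (i : ℕ) :
    R.inner.rowLen (i + 1) ≤ R.inner.rowLen i :=
  R.inner.rowLen_anti _ _ (Nat.le_succ i)

theorem outer_rowLen_succ_le (R : SkewShape) (i : ℕ) :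
    R.outer.rowLen (i + 1) ≤ R.outer.rowLen i :=
  R.outer.rowLen_anti _ _ (Nat.le_succ i)

theorem outer_rowLen_eq_zero (h : R.length ≤ i) : R.outer.rowLen i = 0 := by
  by_contra hpos
  have hmem : (i, 0) ∈ R.outer := YoungDiagram.mem_iff_lt_rowLen.2 (Nat.pos_of_ne_zero hpos)
  exact (YoungDiagram.mem_iff_lt_colLen.1 hmem).not_ge h

theorem bddAbove_rows (R : SkewShape) : BddAbove R.rows :=
  ⟨R.length, fun i hi => by
    by_contra hlt
    have hne := hi.2
    rw [outer_rowLen_eq_zero (by omega)] at hne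
    exact Nat.not_lt_zero _ hne⟩

theorem mem_innerRows_iff : i ∈ R.innerRows ↔
    (∃ a < i, R.inner.rowLen a < R.outer.rowLen a) ∧
      ∃ b ≥ i, R.inner.rowLen b < R.outer.rowLen b := by
  rw [innerRows, Finset.mem_Ico, firstRow, lastRow]
  constructor
  · rintro ⟨hfirst, hlast⟩
    have hne : R.rows.Nonempty := by
      by_contra hempty
      rw [Set.not_nonempty_iff_eq_empty.1 hempty, csSup_empty] at hlast
      exact Nat.not_lt_zero _ hlast
    have ha := Nat.sInf_mem hne
    have hb := Nat.sSup_mem hne R.bddAbove_rows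
    exact ⟨⟨_, by have := ha.1; omega, ha.2⟩, ⟨_, by omega, hb.2⟩⟩
  · rintro ⟨⟨a, ha, ha'⟩, ⟨b, hb, hb'⟩⟩
    have hfirst : sInf R.rows ≤ a + 1 := Nat.sInf_le ⟨by omega, ha'⟩
    have hlast : b + 1 ≤ sSup R.rows := le_csSup R.bddAbove_rows ⟨by omega, hb'⟩
    omega

theorem pos_of_mem_innerRows (h : i ∈ R.innerRows) : 0 < i := by
  obtain ⟨⟨a, ha, -⟩, -⟩ := mem_innerRows_iff.1 h
  exact Nat.zero_lt_of_lt ha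

theorem lt_length_of_mem_innerRows (h : i ∈ R.innerRows) : i < R.length := by
  obtain ⟨-, b, hb, hlt⟩ := mem_innerRows_iff.1 h
  by_contra hi
  rw [outer_rowLen_eq_zero (by omega)] at hlt
  exact Nat.not_lt_zero _ hlt

theorem outer_rowLen_succ_le_inner (h : i + 1 ∉ R.innerRows) :
    R.outer.rowLen (i + 1) ≤ R.inner.rowLen i := by
  by_contra hlt
  have hinner := R.inner_rowLen_succ_le i
  have houter := R.outer_rowLen_succ_le i
  exact h (mem_innerRows_iff.2 ⟨⟨i, by omega, by omega⟩, ⟨i + 1, le_rfl, by omega⟩⟩)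

theorem row_le_of_walk (h : R.outer.rowLen (i + 1) ≤ R.inner.rowLen i)
    {u v : (R.cells : Set (ℕ × ℕ))}
    (w : ((SimpleGraph.hasse (ℕ × ℕ)).induce (R.cells : Set (ℕ × ℕ))).Walk u v)
    (hu : u.1.1 ≤ i) : v.1.1 ≤ i := by
  induction w with
  | nil => exact hu
  | @cons u v _ hadj _ ih =>
    refine ih ?_
    obtain ⟨⟨p, q⟩, hpq⟩ := u
    obtain ⟨⟨p', q'⟩, hpq'⟩ := v
    rw [Finset.mem_coe, mem_cells_iff] at hpq hpq'
    have hadj : (SimpleGraph.hasse (ℕ × ℕ)).Adj (p, q) (p', q') := hadj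
    rw [SimpleGraph.hasse_adj, Prod.mk_covBy_mk_iff, Prod.mk_covBy_mk_iff] at hadj
    simp only [Order.covBy_iff_add_one_eq] at hadj
    dsimp only at hu ⊢
    by_contra hlt
    obtain ⟨rfl, rfl⟩ : p = i ∧ p' = i + 1 := by omega
    omega

theorem IsRibbon.inner_lt_outer_rowLen_succ (hR : R.IsRibbon) (h : i + 1 ∈ R.innerRows) :
    R.inner.rowLen i < R.outer.rowLen (i + 1) := by
  obtain ⟨⟨a, ha, ha'⟩, ⟨b, hb, hb'⟩⟩ := mem_innerRows_iff.1 h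
  by_contra hle
  obtain ⟨w⟩ := hR.1 ⟨(a, R.inner.rowLen a), mem_cells_iff.2 ⟨le_rfl, ha'⟩⟩
    ⟨(b, R.inner.rowLen b), mem_cells_iff.2 ⟨le_rfl, hb'⟩⟩
  have hb_le : b ≤ i := row_le_of_walk (not_lt.1 hle) w (Nat.le_of_lt_succ ha)
  omega

theorem IsRibbon.outer_rowLen_succ_eq (hR : R.IsRibbon) (h : i + 1 ∈ R.innerRows) :
    R.outer.rowLen (i + 1) = R.inner.rowLen i + 1 := by
  have hlt := hR.inner_lt_outer_rowLen_succ h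
  have hinner := R.inner_rowLen_succ_le i
  have houter := R.outer_rowLen_succ_le i
  by_contra hne
  exact hR.2 ⟨i, R.inner.rowLen i, mem_cells_iff.2 ⟨by omega, by omega⟩,
    mem_cells_iff.2 ⟨by omega, by omega⟩, mem_cells_iff.2 ⟨by omega, by omega⟩,
    mem_cells_iff.2 ⟨by omega, by omega⟩⟩

section PrefixSize

/-- The number of cells in the first `i` rows; `d J R` consists of these numbers for `i ∈ J`. -/
def prefixSize (R : SkewShape) (i : ℕ) : ℕ := ∑ j ∈ Finset.range i, R.rowSize j

theorem prefixSize_succ (R : SkewShape) (i : ℕ) :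
    R.prefixSize (i + 1) = R.prefixSize i + R.rowSize i :=
  Finset.sum_range_succ _ _

theorem prefixSize_mono (R : SkewShape) : Monotone R.prefixSize :=
  monotone_nat_of_le_succ fun i => by rw [prefixSize_succ]; omega

theorem d_eq_image_prefixSize (J : Finset ℕ) : d J R = J.image R.prefixSize := rfl

theorem card_filter_row_lt (R : SkewShape) (i : ℕ) :
    (R.cells.filter fun c => c.1 < i).card = R.prefixSize i := by
  rw [prefixSize, Finset.card_eq_sum_card_fiberwise (f := Prod.fst) (t := Finset.range i)
    fun c hc => by simpa using (Finset.mem_filter.1 hc).2]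
  refine Finset.sum_congr rfl fun k hk => ?_
  have hrow : ((R.cells.filter fun c => c.1 < i).filter fun c => c.1 = k) =
      {k} ×ˢ Finset.Ico (R.inner.rowLen k) (R.outer.rowLen k) := by
    ext ⟨a, b⟩
    simp only [Finset.mem_filter, Finset.mem_product, Finset.mem_singleton, Finset.mem_Ico,
      mem_cells_iff, Finset.mem_range] at hk ⊢
    constructor
    · rintro ⟨⟨hc, -⟩, rfl⟩
      exact ⟨rfl, hc⟩
    · rintro ⟨rfl, hc⟩
      exact ⟨⟨hc, hk⟩, rfl⟩
  rw [hrow, Finset.card_product, Finset.card_singleton, one_mul, Nat.card_Ico, rowSize]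

theorem prefixSize_le_size (R : SkewShape) (i : ℕ) : R.prefixSize i ≤ R.size := by
  rw [← card_filter_row_lt, size]
  exact Finset.card_filter_le _ _

theorem prefixSize_eq_size (h : ∀ b ≥ i, R.outer.rowLen b ≤ R.inner.rowLen b) :
    R.prefixSize i = R.size := by
  rw [← card_filter_row_lt, size, Finset.filter_true_of_mem]
  rintro ⟨a, b⟩ hc
  have hlt := mem_cells_iff.1 hc
  by_contra hi
  exact (hlt.1.trans_lt hlt.2).not_ge (h a (not_lt.1 hi))

theorem prefixSize_of_length_le (h : R.length ≤ i) : R.prefixSize i = R.size :=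
  prefixSize_eq_size fun b hb => by rw [outer_rowLen_eq_zero (h.trans hb)]; exact Nat.zero_le _

theorem prefixSize_eq_zero (h : ∀ a < i, R.outer.rowLen a ≤ R.inner.rowLen a) :
    R.prefixSize i = 0 :=
  Finset.sum_eq_zero fun a ha => Nat.sub_eq_zero_of_le (h a (Finset.mem_range.1 ha))

theorem prefixSize_of_notMem_innerRows (h : i ∉ R.innerRows) :
    R.prefixSize i = 0 ∨ R.prefixSize i = R.size := by
  rw [mem_innerRows_iff, not_and_or] at h
  push Not at h
  exact h.imp prefixSize_eq_zero prefixSize_eq_size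

theorem IsRibbon.prefixSize_lt (hR : R.IsRibbon) (hi : i ∈ R.innerRows) (hij : i < j) :
    R.prefixSize i < R.prefixSize j := by
  refine lt_of_lt_of_le ?_ (R.prefixSize_mono hij)
  obtain ⟨i, rfl⟩ := Nat.exists_eq_add_one_of_ne_zero (pos_of_mem_innerRows hi).ne'
  have houter := hR.outer_rowLen_succ_eq hi
  have hinner := R.inner_rowLen_succ_le i
  rw [Nat.succ_eq_add_one, R.prefixSize_succ (i + 1), rowSize]
  omega

theorem IsRibbon.prefixSize_injOn (hR : R.IsRibbon) :
    Set.InjOn R.prefixSize (R.innerRows : Set ℕ) :=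
  StrictMonoOn.injOn fun _ hi _ _ hij => hR.prefixSize_lt hi hij

theorem IsRibbon.prefixSize_mem_Icc_iff (hR : R.IsRibbon) :
    R.prefixSize i ∈ Finset.Icc 1 (R.size - 1) ↔ i ∈ R.innerRows := by
  rw [Finset.mem_Icc]
  refine ⟨fun h => ?_, fun h => ?_⟩
  · by_contra hi
    rcases prefixSize_of_notMem_innerRows hi with h' | h' <;> omega
  · have hlt := (hR.prefixSize_lt h i.lt_succ_self).trans_le (R.prefixSize_le_size _)
    obtain ⟨⟨a, ha, ha'⟩, -⟩ := mem_innerRows_iff.1 h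
    have hle := R.prefixSize_mono ha
    rw [Nat.succ_eq_add_one, prefixSize_succ, rowSize] at hle
    omega

end PrefixSize

section Descents

theorem label_eq (h : (i, j) ∈ R.cells) :
    R.label (i, j) = R.prefixSize i + (R.outer.rowLen i - j) := by
  have hj := mem_cells_iff.1 h
  have hunion : (R.cells.filter fun c => c.1 < i ∨ (c.1 = i ∧ j ≤ c.2)) =
      (R.cells.filter fun c => c.1 < i) ∪ {i} ×ˢ Finset.Ico j (R.outer.rowLen i) := by
    ext ⟨a, b⟩
    simp only [Finset.mem_filter, Finset.mem_union, Finset.mem_product, Finset.mem_singleton,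
      Finset.mem_Ico, mem_cells_iff]
    constructor
    · rintro ⟨hc, ha | ⟨rfl, hb⟩⟩
      · exact .inl ⟨hc, ha⟩
      · exact .inr ⟨rfl, hb, hc.2⟩
    · rintro (⟨hc, ha⟩ | ⟨rfl, hb, hb'⟩)
      · exact ⟨hc, .inl ha⟩
      · exact ⟨⟨hj.1.trans hb, hb'⟩, .inr ⟨rfl, hb⟩⟩
  have hdisj : Disjoint (R.cells.filter fun c => c.1 < i)
      ({i} ×ˢ Finset.Ico j (R.outer.rowLen i)) := by
    rw [Finset.disjoint_left]
    rintro ⟨a, b⟩ ha hb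
    exact (Finset.mem_filter.1 ha).2.ne (Finset.mem_singleton.1 (Finset.mem_product.1 hb).1)
  rw [label, hunion, Finset.card_union_of_disjoint hdisj, card_filter_row_lt,
    Finset.card_product, Finset.card_singleton, one_mul, Nat.card_Ico]

theorem IsRibbon.des_eq (hR : R.IsRibbon) : R.des = R.innerRows.image R.prefixSize := by
  ext x
  rw [des, Finset.mem_filter, Finset.mem_image]
  constructor
  · rintro ⟨-, ⟨i, j⟩, hc, hc', hlabel, -⟩
    have hj := mem_cells_iff.1 hc
    have hj' : R.inner.rowLen (i + 1) ≤ j ∧ j < R.outer.rowLen (i + 1) := mem_cells_iff.1 hc'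
    have hi : i + 1 ∈ R.innerRows :=
      mem_innerRows_iff.2 ⟨⟨i, by omega, by omega⟩, ⟨i + 1, le_rfl, by omega⟩⟩
    have houter := hR.outer_rowLen_succ_eq hi
    refine ⟨i + 1, hi, ?_⟩
    rw [← hlabel, label_eq hc, prefixSize_succ, rowSize]
    omega
  · rintro ⟨i, hi, rfl⟩
    refine ⟨hR.prefixSize_mem_Icc_iff.2 hi, ?_⟩
    obtain ⟨i, rfl⟩ := Nat.exists_eq_add_one_of_ne_zero (pos_of_mem_innerRows hi).ne'
    have houter := hR.outer_rowLen_succ_eq hi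
    have hinner := R.inner_rowLen_succ_le i
    have houter' := R.outer_rowLen_succ_le i
    have hc : (i, R.inner.rowLen i) ∈ R.cells := mem_cells_iff.2 ⟨le_rfl, by omega⟩
    have hc' : (i + 1, R.inner.rowLen i) ∈ R.cells := mem_cells_iff.2 ⟨hinner, by omega⟩
    refine ⟨_, hc, hc', ?_, ?_⟩
    · rw [label_eq hc, prefixSize_succ, rowSize]
    · rw [label_eq hc', houter, Nat.add_sub_cancel_left]

variable {J J' S : Finset ℕ}

theorem IsRibbon.mem_ndes_union_d_iff (hR : R.IsRibbon) (hJ : J ⊆ R.innerRows) {x : ℕ} :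
    x ∈ R.ndes ∪ d J R ↔
      x ∈ Finset.Icc 1 (R.size - 1) ∧ ∀ i ∈ R.innerRows, R.prefixSize i = x → i ∈ J := by
  rw [Finset.mem_union, ndes, Finset.mem_sdiff, hR.des_eq, d_eq_image_prefixSize,
    Finset.mem_image, Finset.mem_image]
  constructor
  · rintro (⟨hx, hnot⟩ | ⟨i, hi, rfl⟩)
    · exact ⟨hx, fun i hi hix => absurd ⟨i, hi, hix⟩ hnot⟩
    · exact ⟨hR.prefixSize_mem_Icc_iff.2 (hJ hi),
        fun i' hi' h => hR.prefixSize_injOn hi' (hJ hi) h ▸ hi⟩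
  · rintro ⟨hx, hmem⟩
    by_cases hex : ∃ i ∈ R.innerRows, R.prefixSize i = x
    · obtain ⟨i, hi, hix⟩ := hex
      exact .inr ⟨i, hmem i hi hix, hix⟩
    · exact .inl ⟨hx, hex⟩

theorem IsRibbon.prefixSize_mem_ndes_union_d_iff (hR : R.IsRibbon) (hJ : J ⊆ R.innerRows) :
    R.prefixSize i ∈ R.ndes ∪ d J R ↔ i ∈ J := by
  rw [hR.mem_ndes_union_d_iff hJ, hR.prefixSize_mem_Icc_iff]
  exact ⟨fun h => h.2 i h.1 rfl,
    fun hi => ⟨hJ hi, fun i' hi' h => hR.prefixSize_injOn hi' (hJ hi) h ▸ hi⟩⟩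

theorem IsRibbon.ndes_union_d_subset_Icc_iff (hR : R.IsRibbon) :
    R.ndes ∪ d J R ⊆ Finset.Icc 1 (R.size - 1) ↔ J ⊆ R.innerRows := by
  rw [ndes, Finset.union_subset_iff, and_iff_right Finset.sdiff_subset, d_eq_image_prefixSize,
    Finset.image_subset_iff]
  exact forall₂_congr fun i _ => hR.prefixSize_mem_Icc_iff

theorem IsRibbon.ndes_union_d_subset_ndes_union_d_iff (hR : R.IsRibbon) (hS : S ⊆ R.innerRows)
    (hJ : J ⊆ R.innerRows) : R.ndes ∪ d S R ⊆ R.ndes ∪ d J R ↔ S ⊆ J := by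
  refine ⟨fun h i hi => ?_, fun h => Finset.union_subset_union_right (Finset.image_subset_image h)⟩
  rw [← hR.prefixSize_mem_ndes_union_d_iff hJ]
  exact h ((hR.prefixSize_mem_ndes_union_d_iff hS).2 hi)

theorem IsRibbon.ndes_union_d_injOn (hR : R.IsRibbon) :
    Set.InjOn (fun J => R.ndes ∪ d J R) {J | J ⊆ R.innerRows} := fun J hJ J' hJ' h => by
  ext i
  rw [← hR.prefixSize_mem_ndes_union_d_iff hJ, ← hR.prefixSize_mem_ndes_union_d_iff hJ']
  exact Finset.ext_iff.1 h _

theorem IsRibbon.exists_ndes_union_d_eq (hR : R.IsRibbon) {A : Finset ℕ}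
    (hA : A ⊆ Finset.Icc 1 (R.size - 1)) (h : R.ndes ⊆ A) :
    ∃ J ⊆ R.innerRows, R.ndes ∪ d J R = A := by
  refine ⟨R.innerRows.filter fun i => R.prefixSize i ∈ A, Finset.filter_subset _ _, ?_⟩
  ext x
  rw [hR.mem_ndes_union_d_iff (Finset.filter_subset _ _)]
  constructor
  · rintro ⟨hx, hmem⟩
    by_contra hxA
    have hdes : x ∈ R.des := by_contra fun hnot => hxA (h (Finset.mem_sdiff.2 ⟨hx, hnot⟩))
    rw [hR.des_eq, Finset.mem_image] at hdes
    obtain ⟨i, hi, rfl⟩ := hdes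
    exact hxA (Finset.mem_filter.1 (hmem i hi rfl)).2
  · rintro hx
    refine ⟨hA hx, ?_⟩
    rintro i hi rfl
    exact Finset.mem_filter.2 ⟨hi, hx⟩

theorem IsRibbon.sum_ndes_union_d (hR : R.IsRibbon) (hS : S ⊆ R.innerRows) {A : Type*}
    [AddCommMonoid A] (F : Finset ℕ → A) :
    ∑ J ∈ R.innerRows.powerset with S ⊆ J, F (R.ndes ∪ d J R) =
      ∑ B ∈ (Finset.Icc 1 (R.size - 1)).powerset with R.ndes ∪ d S R ⊆ B, F B := by
  refine Finset.sum_bij (fun J _ => R.ndes ∪ d J R) (fun J hJ => ?_) (fun J hJ J' hJ' h => ?_)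
    (fun B hB => ?_) fun _ _ => rfl
  · rw [Finset.mem_filter, Finset.mem_powerset] at hJ ⊢
    exact ⟨hR.ndes_union_d_subset_Icc_iff.2 hJ.1,
      (hR.ndes_union_d_subset_ndes_union_d_iff hS hJ.1).2 hJ.2⟩
  · rw [Finset.mem_filter, Finset.mem_powerset] at hJ hJ'
    exact hR.ndes_union_d_injOn hJ.1 hJ'.1 h
  · rw [Finset.mem_filter, Finset.mem_powerset] at hB
    obtain ⟨J, hJ, rfl⟩ := hR.exists_ndes_union_d_eq hB.1 (Finset.union_subset_left hB.2)
    exact ⟨J, Finset.mem_filter.2 ⟨Finset.mem_powerset.2 hJ,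
      (hR.ndes_union_d_subset_ndes_union_d_iff hS hJ).1 hB.2⟩, rfl⟩

end Descents

end SkewShape

section DescentSets
variable {ν : YoungDiagram}

theorem finite_isStandard (ν : YoungDiagram) (P : SemistandardYoungTableau ν → Prop) :
    Finite {T : SemistandardYoungTableau ν // IsStandard T ∧ P T} := by
  have := finite_tableaux_of_bounded ν (ν.card + 1)
  exact Finite.of_injective
    (Subtype.impEmbedding _ (fun T => ∀ c ∈ ν, T c.1 c.2 < ν.card + 1) fun T hT c hc =>
      Nat.lt_succ_of_le (hT.1.mapsTo hc).2) (Function.Embedding.injective _)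

theorem IsStandard.tableauDes_subset {T : SemistandardYoungTableau ν} (hT : IsStandard T) :
    tableauDes T ⊆ Finset.Icc 1 (ν.card - 1) := by
  rintro a ⟨c, hc, c', hc', rfl, hc'_eq, -⟩
  have hlow : 1 ≤ T c.1 c.2 := (hT.mapsTo hc).1
  have hupp : T c'.1 c'.2 ≤ ν.card := (hT.mapsTo hc').2
  rw [Finset.coe_Icc, Set.mem_Icc]
  omega

theorem card_isStandardWithDescents_eq_sum {B : Finset ℕ} (hB : B ⊆ Finset.Icc 1 (ν.card - 1)) :
    Nat.card {T : SemistandardYoungTableau ν // IsStandardWithDescents (B : Set ℕ) T} =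
      ∑ A ∈ (Finset.Icc 1 (ν.card - 1)).powerset with B ⊆ A, sytCount ν A := by
  set F := (Finset.Icc 1 (ν.card - 1)).powerset.filter fun A => B ⊆ A
  have hB_lt (a : ℕ) (ha : a ∈ B) : a < ν.card := by
    have := Finset.mem_Icc.1 (hB ha)
    omega
  have hfin (A : F) := finite_isStandard ν fun T => tableauDes T = (A.1 : Set ℕ)
  let forget (x : Σ A : F, {T : SemistandardYoungTableau ν //
      IsStandard T ∧ tableauDes T = (A.1 : Set ℕ)}) :
      {T : SemistandardYoungTableau ν // IsStandardWithDescents (B : Set ℕ) T} :=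
    ⟨x.2.1, x.2.2.1, fun a ha _ =>
      x.2.2.2.symm.subset ((Finset.mem_filter.1 x.1.2).2 ha)⟩
  rw [← Finset.sum_coe_sort F]
  simp only [sytCount]
  rw [← Nat.card_sigma]
  refine (Nat.card_congr (Equiv.ofBijective forget ⟨?_, ?_⟩)).symm
  · rintro ⟨⟨A, hA⟩, T, hT⟩ ⟨⟨A', hA'⟩, T', hT'⟩ h
    obtain rfl : T = T' := congrArg Subtype.val h
    obtain rfl : A = A' := Finset.coe_injective (hT.2.symm.trans hT'.2)
    rfl
  · rintro ⟨T, hT, hdes⟩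
    obtain ⟨A, hA⟩ := ((Finset.finite_toSet _).subset hT.tableauDes_subset).exists_finset_coe
    have hA_mem : A ∈ F := by
      rw [Finset.mem_filter, Finset.mem_powerset, ← Finset.coe_subset, ← Finset.coe_subset, hA]
      exact ⟨hT.tableauDes_subset, fun a ha => hdes a ha (hB_lt a ha)⟩
    exact ⟨⟨⟨A, hA_mem⟩, T, hT, hA.symm⟩, rfl⟩

/-- The generating function, in terms of Schur functions, of the standard tableaux of size `m` with
descent set exactly `A`. -/
noncomputable def exactDescentSeries (A : Finset ℕ) (m : ℕ) : MvPowerSeries ℕ ℂ :=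
  ∑ ν : PartitionOf m, sytCount ν.1 A • schur ν.1

theorem descentSeries_eq_sum_exactDescentSeries {B : Finset ℕ} {m : ℕ}
    (hB : B ⊆ Finset.Icc 1 (m - 1)) :
    descentSeries B m =
      ∑ A ∈ (Finset.Icc 1 (m - 1)).powerset with B ⊆ A, exactDescentSeries A m := by
  simp only [descentSeries, exactDescentSeries]
  rw [Finset.sum_comm]
  refine Finset.sum_congr rfl fun ν _ => ?_
  obtain ⟨ν, rfl⟩ := ν
  rw [card_isStandardWithDescents_eq_sum hB, Finset.sum_smul]

theorem SkewShape.IsRibbon.descentSeries_ndes_union_d {R : SkewShape} (hR : R.IsRibbon)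
    {S : Finset ℕ} (hS : S ⊆ R.innerRows) :
    descentSeries (R.ndes ∪ d S R : Finset ℕ) R.size =
      ∑ J ∈ R.innerRows.powerset with S ⊆ J, exactDescentSeries (R.ndes ∪ d J R) R.size := by
  rw [descentSeries_eq_sum_exactDescentSeries (hR.ndes_union_d_subset_Icc_iff.2 hS),
    hR.sum_ndes_union_d hS fun A => exactDescentSeries A R.size]

end DescentSets

/-! ### The Jacobi--Trudi matrix of a ribbon -/

section JacobiTrudi
open SkewShape
variable {R : SkewShape} {n p t : ℕ} {S : Finset (Fin (n - 1))}

theorem elemSymm_of_neg {d : ℤ} (h : d < 0) : elemSymm d = 0 :=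
  funext fun δ => if_neg fun hδ : (δ.degree : ℤ) = d ∧ _ => by omega

theorem jacobiTrudi_apply (p q : Fin n) : jacobiTrudi n R p q =
    elemSymm ((R.outer.rowLen p : ℤ) - R.inner.rowLen q - (p : ℕ) + (q : ℕ)) := rfl

theorem isHessenberg_jacobiTrudi (hR : R.IsRibbon) : IsHessenberg (jacobiTrudi n R) := by
  intro p q hqp
  have hanti := R.outer.rowLen_anti (q + 1) p hqp.le
  have hle : R.outer.rowLen (q + 1) ≤ R.inner.rowLen q + 1 := by
    by_cases hq : (q : ℕ) + 1 ∈ R.innerRows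
    · exact (hR.outer_rowLen_succ_eq hq).le
    · exact (outer_rowLen_succ_le_inner hq).trans (Nat.le_succ _)
  exact elemSymm_of_neg (by omega)

theorem jacobiTrudi_hi_lo_of_mem (hR : R.IsRibbon) {j : Fin (n - 1)}
    (hj : (j : ℕ) + 1 ∈ R.innerRows) : jacobiTrudi n R (hi j) (lo j) = 1 := by
  rw [jacobiTrudi_apply, ← elemSymm_zero, hi, lo, hR.outer_rowLen_succ_eq hj]
  congr 1
  push_cast
  ring

theorem jacobiTrudi_hi_lo_of_notMem {j : Fin (n - 1)} (hj : (j : ℕ) + 1 ∉ R.innerRows) :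
    jacobiTrudi n R (hi j) (lo j) = 0 := by
  have hle := outer_rowLen_succ_le_inner hj
  rw [jacobiTrudi_apply, hi, lo]
  exact elemSymm_of_neg (by push_cast; omega)

theorem SkewShape.IsRibbon.outer_rowLen_sub_inner_rowLen (hR : R.IsRibbon) (p k : ℕ)
    (h : ∀ i, p < i → i ≤ p + k → i ∈ R.innerRows) :
    (R.outer.rowLen p : ℤ) - R.inner.rowLen (p + k) + k =
      R.prefixSize (p + k + 1) - R.prefixSize p := by
  induction k with
  | zero =>
    have hle := R.inner_rowLen_le p
    rw [add_zero, prefixSize_succ, rowSize]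
    push_cast [hle]
    ring
  | succ k ih =>
    have hk := ih fun i hi hi' => h i hi (by omega)
    have houter := hR.outer_rowLen_succ_eq (h (p + k + 1) (by omega) (by omega))
    have hle := R.inner_rowLen_le (p + k + 1)
    rw [← add_assoc, prefixSize_succ _ (p + k + 1), rowSize, houter]
    rw [houter] at hle
    push_cast [hle] at hk ⊢
    linarith

theorem jacobiTrudi_of_run (hR : R.IsRibbon) {p q : Fin n} (hpq : p ≤ q)
    (h : ∀ i : ℕ, p < i → i ≤ q → i ∈ R.innerRows) :
    jacobiTrudi n R p q = elemSymm ((R.prefixSize (q + 1) - R.prefixSize p : ℕ) : ℤ) := by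
  obtain ⟨k, hk⟩ := Nat.exists_eq_add_of_le (Fin.le_def.1 hpq)
  have htelescope := hR.outer_rowLen_sub_inner_rowLen p k fun i hi hi' => h i hi (by omega)
  have hmono : R.prefixSize p ≤ R.prefixSize (q + 1) := R.prefixSize_mono (by omega)
  rw [← hk] at htelescope
  rw [jacobiTrudi_apply]
  congr 1
  push_cast [hmono]
  omega

theorem mem_oneBased {i : ℕ} : i ∈ oneBased S ↔ ∃ j ∈ S, (j : ℕ) + 1 = i := by
  rw [oneBased, Finset.mem_image]

theorem succ_mem_oneBased {j : Fin (n - 1)} : (j : ℕ) + 1 ∈ oneBased S ↔ j ∈ S := by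
  rw [mem_oneBased]
  constructor
  · rintro ⟨j', hj', h⟩
    rwa [← Fin.ext (Nat.succ_injective h)]
  · exact fun hj => ⟨j, hj, rfl⟩

theorem zero_notMem_oneBased : 0 ∉ oneBased S := fun h => by
  obtain ⟨j, -, hj⟩ := mem_oneBased.1 h
  exact Nat.succ_ne_zero _ hj

theorem notMem_oneBased_self : n ∉ oneBased S := fun h => by
  obtain ⟨j, -, hj⟩ := mem_oneBased.1 h
  omega

theorem exists_run_start {A : Finset ℕ} (h0 : 0 ∉ A) (ht : 0 < t) :
    ∃ p < t, p ∉ A ∧ ∀ i, p < i → i < t → i ∈ A := by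
  refine ⟨Nat.findGreatest (· ∉ A) (t - 1), ?_,
    Nat.findGreatest_spec (P := (· ∉ A)) (Nat.zero_le _) h0, fun i hpi hit => ?_⟩
  · have := Nat.findGreatest_le (P := (· ∉ A)) (t - 1)
    omega
  · exact not_not.1 (Nat.findGreatest_is_greatest hpi (by omega))

theorem ascendingPerm_run_start (hpt : p < t) (htn : t ≤ n) (hp : p ∉ oneBased S)
    (ht : t ∉ oneBased S) (hrun : ∀ i, p < i → i < t → i ∈ oneBased S) :
    ascendingPerm S ⟨p, hpt.trans_le htn⟩ = ⟨t - 1, by omega⟩ := by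
  refine ascendingPerm_apply_run (Fin.mk_le_mk.2 (by omega)) (fun j hj h => hp ?_)
    (fun j hj h => ht ?_) fun j hpj hjt => ?_
  · exact mem_oneBased.2 ⟨j, hj, Fin.mk.inj h⟩
  · exact mem_oneBased.2 ⟨j, hj, by have := Fin.mk.inj h; omega⟩
  · have hpj : p ≤ j := hpj
    have hjt : (j : ℕ) + 1 ≤ t - 1 := hjt
    exact succ_mem_oneBased.1 (hrun _ (by omega) (by omega))

theorem prod_filter_lt_eq_mul {A : Type*} [CommMonoid A] {f : Fin n → A} (hpt : p < t)
    (htn : t ≤ n) (hf : ∀ i : Fin n, p < i → (i : ℕ) < t → f i = 1) :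
    ∏ i : Fin n with i.val < t, f i =
      (∏ i : Fin n with i.val < p, f i) * f ⟨p, hpt.trans_le htn⟩ := by
  rw [mul_comm, ← Finset.prod_insert (by simp)]
  refine (Finset.prod_subset (fun i hi => ?_) fun i hi hi' => ?_).symm
  · simp only [Finset.mem_insert, Finset.mem_filter, Finset.mem_univ, true_and, Fin.ext_iff] at hi ⊢
    omega
  · simp only [Finset.mem_insert, Finset.mem_filter, Finset.mem_univ, true_and,
      Fin.ext_iff] at hi hi'
    exact hf i (by omega) hi

theorem jacobiTrudi_ascendingPerm_of_mem (hR : R.IsRibbon) (hS : oneBased S ⊆ R.innerRows)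
    {i : Fin n} (hi : (i : ℕ) ∈ oneBased S) : jacobiTrudi n R i (ascendingPerm S i) = 1 := by
  obtain ⟨j, hj, hji⟩ := mem_oneBased.1 hi
  obtain rfl : RibbonImmanant.hi j = i := Fin.ext hji
  rw [(ascendingPerm_apply_hi S j).2 hj, jacobiTrudi_hi_lo_of_mem hR (hS hi)]

theorem SkewShape.IsRibbon.mem_ndes_union_d_of_run (hR : R.IsRibbon) {J : Finset ℕ}
    (hJ : J ⊆ R.innerRows) (hrun : ∀ i, p < i → i < t → i ∈ J) {x : ℕ}
    (hpx : R.prefixSize p < x) (hxt : x < R.prefixSize t) : x ∈ R.ndes ∪ d J R := by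
  have hsize := R.prefixSize_le_size t
  refine (hR.mem_ndes_union_d_iff hJ).2 ⟨Finset.mem_Icc.2 ⟨by omega, by omega⟩, ?_⟩
  rintro i - rfl
  exact hrun i (R.prefixSize_mono.reflect_lt hpx) (R.prefixSize_mono.reflect_lt hxt)

theorem prod_jacobiTrudi_ascendingPerm_lt (hR : R.IsRibbon) (hS : oneBased S ⊆ R.innerRows)
    (htn : t ≤ n) (ht : t ∉ oneBased S) :
    ∏ i : Fin n with i.val < t, jacobiTrudi n R i (ascendingPerm S i) =
      descentSeries (R.ndes ∪ d (oneBased S) R : Finset ℕ) (R.prefixSize t) := by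
  induction t using Nat.strong_induction_on with
  | _ t ih =>
    rcases Nat.eq_zero_or_pos t with rfl | hpos
    · rw [prefixSize_eq_zero fun a ha => absurd ha (Nat.not_lt_zero a), descentSeries_zero]
      simp
    obtain ⟨p, hpt, hp, hrun⟩ := exists_run_start zero_notMem_oneBased hpos
    have hentry : jacobiTrudi n R ⟨p, hpt.trans_le htn⟩
        (ascendingPerm S ⟨p, hpt.trans_le htn⟩) =
          elemSymm ((R.prefixSize t - R.prefixSize p : ℕ) : ℤ) := by
      rw [ascendingPerm_run_start hpt htn hp ht hrun, jacobiTrudi_of_run hR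
        (Fin.mk_le_mk.2 (by omega)) fun i hpi hit => hS (hrun i hpi (by dsimp only at hit; omega))]
      dsimp only
      rw [Nat.sub_add_cancel hpos]
    have hsize := Nat.add_sub_cancel' (R.prefixSize_mono hpt.le)
    rw [prod_filter_lt_eq_mul hpt htn fun i hpi hit =>
        jacobiTrudi_ascendingPerm_of_mem hR hS (hrun i hpi hit),
      ih p hpt (hpt.le.trans htn) hp, hentry, mul_comm, ← descentSeries_add, hsize]
    · rwa [Finset.mem_coe, hR.prefixSize_mem_ndes_union_d_iff hS]
    · rw [hsize]
      exact fun x hpx hxt => hR.mem_ndes_union_d_of_run hS hrun hpx hxt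

theorem prod_jacobiTrudi_ascendingPerm (hR : R.IsRibbon) (hn : R.length ≤ n)
    (S : Finset (Fin (n - 1))) :
    ∏ i, jacobiTrudi n R i (ascendingPerm S i) = ∑ J ∈ R.innerRows.powerset with oneBased S ⊆ J,
      exactDescentSeries (R.ndes ∪ d J R) R.size := by
  by_cases hS : oneBased S ⊆ R.innerRows
  · rw [← hR.descentSeries_ndes_union_d hS, ← prefixSize_of_length_le hn,
      ← prod_jacobiTrudi_ascendingPerm_lt hR hS le_rfl notMem_oneBased_self,
      Finset.filter_true_of_mem fun i _ => i.2]
  · obtain ⟨_, hx, hnot⟩ := Finset.not_subset.1 hS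
    obtain ⟨j, hj, rfl⟩ := mem_oneBased.1 hx
    rw [Finset.prod_eq_zero (Finset.mem_univ (hi j)), Finset.filter_eq_empty_iff.2,
      Finset.sum_empty]
    · exact fun J hJ h => hnot (Finset.mem_powerset.1 hJ (h hx))
    · rw [(ascendingPerm_apply_hi S j).2 hj, jacobiTrudi_hi_lo_of_notMem hnot]

end JacobiTrudi

/-! ### Immanants of Hadamard products -/

section Hadamard
open SkewShape
variable {k n : ℕ}

/-- The substitution `inVars i` as an algebra homomorphism. -/
noncomputable def inVarsHom (i : Fin k) : MvPowerSeries ℕ ℂ →ₐ[ℂ] MultiSeries k :=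
  MvPowerSeries.rename (Function.Embedding.sectR i ℕ)

theorem inVarsHom_apply (i : Fin k) (f : MvPowerSeries ℕ ℂ) : inVarsHom i f = inVars i f := rfl

theorem hadamardProd_map_inVars_apply (M : Fin k → Matrix (Fin n) (Fin n) (MvPowerSeries ℕ ℂ))
    (p q : Fin n) :
    hadamardProd (fun i => (M i).map (inVars i)) p q = ∏ i, inVarsHom i (M i p q) := rfl

theorem prod_hadamardProd_map_inVars (M : Fin k → Matrix (Fin n) (Fin n) (MvPowerSeries ℕ ℂ))
    (w : Equiv.Perm (Fin n)) :
    ∏ p, hadamardProd (fun i => (M i).map (inVars i)) p (w p) =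
      ∏ i, inVarsHom i (∏ p, M i p (w p)) := by
  simp only [hadamardProd_map_inVars_apply, map_prod]
  exact Finset.prod_comm

theorem isHessenberg_hadamardProd [NeZero k]
    {M : Fin k → Matrix (Fin n) (Fin n) (MvPowerSeries ℕ ℂ)} (hM : ∀ i, IsHessenberg (M i)) :
    IsHessenberg (hadamardProd fun i => (M i).map (inVars i)) := fun p q hqp => by
  rw [hadamardProd_map_inVars_apply]
  exact Finset.prod_eq_zero (Finset.mem_univ 0) (by rw [hM 0 p q hqp, map_zero])

theorem mem_tuplesWithInter {E J : Fin k → Finset ℕ} {T : Finset ℕ} :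
    J ∈ tuplesWithInter E T ↔ (∀ i, J i ⊆ E i) ∧ ∀ x, (∀ i, x ∈ J i) ↔ x ∈ T := by
  rw [tuplesWithInter, Finset.mem_filter, Fintype.mem_piFinset, Set.ext_iff]
  simp only [Finset.mem_powerset, Set.mem_iInter, Finset.mem_coe]

theorem forall_iff_mem_oneBased {P : ℕ → Prop} [DecidablePred P]
    (hP : ∀ x, P x → 0 < x ∧ x < n) {K : Finset (Fin (n - 1))} :
    (∀ x, P x ↔ x ∈ oneBased K) ↔ Finset.univ.filter (fun j : Fin (n - 1) => P (j + 1)) = K := by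
  simp only [Finset.ext_iff, Finset.mem_filter, Finset.mem_univ, true_and]
  refine ⟨fun h j => (h _).trans succ_mem_oneBased, fun h x => ⟨fun hx => ?_, fun hx => ?_⟩⟩
  · obtain ⟨hpos, hlt⟩ := hP x hx
    obtain ⟨j, rfl⟩ : ∃ j : Fin (n - 1), (j : ℕ) + 1 = x :=
      ⟨⟨x - 1, by omega⟩, Nat.sub_add_cancel hpos⟩
    exact succ_mem_oneBased.2 ((h j).1 hx)
  · obtain ⟨j, hj, rfl⟩ := mem_oneBased.1 hx
    exact (h j).2 hj

theorem sum_tuplesWithInter_oneBased [NeZero k] {A : Type*} [AddCommMonoid A]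
    {E : Fin k → Finset ℕ} (hE : ∀ i, ∀ x ∈ E i, 0 < x ∧ x < n) (S : Finset (Fin (n - 1)))
    (F : (Fin k → Finset ℕ) → A) :
    ∑ K with S ⊆ K, ∑ J ∈ tuplesWithInter E (oneBased K), F J =
      ∑ J ∈ Fintype.piFinset fun i => (E i).powerset.filter (oneBased S ⊆ ·), F J := by
  classical
  let inter (J : Fin k → Finset ℕ) : Finset (Fin (n - 1)) := {j | ∀ i, (j : ℕ) + 1 ∈ J i}
  have hmem (J : Fin k → Finset ℕ) (K) :
      J ∈ tuplesWithInter E (oneBased K) ↔ (∀ i, J i ⊆ E i) ∧ inter J = K := by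
    rw [mem_tuplesWithInter]
    exact and_congr_right fun hJ => forall_iff_mem_oneBased fun x hx => hE 0 x (hJ 0 (hx 0))
  have hsub (J : Fin k → Finset ℕ) : (∀ i, oneBased S ⊆ J i) ↔ S ⊆ inter J := by
    simp only [inter, oneBased, Finset.image_subset_iff]
    exact ⟨fun h j hj => Finset.mem_filter.2 ⟨Finset.mem_univ _, fun i => h i j hj⟩,
      fun h i j hj => (Finset.mem_filter.1 (h hj)).2 i⟩
  rw [← Finset.sum_fiberwise_of_maps_to (g := inter) (t := Finset.univ.filter (S ⊆ ·))]
  · refine Finset.sum_congr rfl fun K hK => Finset.sum_congr ?_ fun _ _ => rfl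
    ext J
    simp only [Finset.mem_filter, Fintype.mem_piFinset, Finset.mem_powerset, forall_and, hmem, hsub]
    refine ⟨fun ⟨hJ, h⟩ => ⟨⟨hJ, ?_⟩, h⟩, fun ⟨⟨hJ, _⟩, h⟩ => ⟨hJ, h⟩⟩
    exact h ▸ (Finset.mem_filter.1 hK).2
  · intro J hJ
    simp only [Finset.mem_filter, Fintype.mem_piFinset, forall_and, hsub] at hJ
    exact Finset.mem_filter.2 ⟨Finset.mem_univ _, hJ.2⟩

theorem tlImmanant_hadamardProd_jacobiTrudi [NeZero k] (I : Finset (Fin (n - 1)))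
    {R : Fin k → SkewShape} (hR : ∀ i, (R i).IsRibbon) (hn : ∀ i, (R i).length ≤ n) :
    tlImmanant (tau I) (hadamardProd fun i => (jacobiTrudi n (R i)).map (inVars i)) =
      ∑ J ∈ tuplesWithInter (fun i => (R i).innerRows) (oneBased I),
        ∏ i, inVarsHom i (exactDescentSeries ((R i).ndes ∪ d (J i) (R i)) (R i).size) := by
  refine tlImmanant_hessenberg (isHessenberg_hadamardProd fun i => isHessenberg_jacobiTrudi (hR i))
    (c := fun K => ∑ J ∈ tuplesWithInter (fun i => (R i).innerRows) (oneBased K),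
      ∏ i, inVarsHom i (exactDescentSeries ((R i).ndes ∪ d (J i) (R i)) (R i).size))
    (fun S => ?_) I
  have hbound (i : Fin k) (x : ℕ) (hx : x ∈ (R i).innerRows) : 0 < x ∧ x < n :=
    ⟨pos_of_mem_innerRows hx, (lt_length_of_mem_innerRows hx).trans_le (hn i)⟩
  rw [prod_hadamardProd_map_inVars, sum_tuplesWithInter_oneBased hbound]
  simp only [prod_jacobiTrudi_ascendingPerm (hR _) (hn _), map_sum]
  exact Finset.prod_univ_sum _ _

theorem prod_inVarsHom_exactDescentSeries (m : Fin k → ℕ) (B : Fin k → Finset ℕ) :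
    ∏ i, inVarsHom i (exactDescentSeries (B i) (m i)) =
      ∑ ν : (i : Fin k) → PartitionOf (m i),
        ((∏ i, sytCount (ν i).1 (B i) : ℕ) : MultiSeries k) * ∏ i, inVars i (schur (ν i).1) := by
  simp only [exactDescentSeries, map_sum, nsmul_eq_mul, map_mul, map_natCast]
  rw [Finset.prod_univ_sum, Fintype.piFinset_univ]
  simp only [Finset.prod_mul_distrib, Nat.cast_prod, inVarsHom_apply]

theorem sum_prod_inVarsHom_exactDescentSeries (𝒯 : Finset (Fin k → Finset ℕ))
    (m : Fin k → ℕ) (B : Fin k → Finset ℕ → Finset ℕ) :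
    ∑ J ∈ 𝒯, ∏ i, inVarsHom i (exactDescentSeries (B i (J i)) (m i)) =
      ∑ ν : (i : Fin k) → PartitionOf (m i),
        ((∑ J ∈ 𝒯, ∏ i, sytCount (ν i).1 (B i (J i)) : ℕ) : MultiSeries k) *
          ∏ i, inVars i (schur (ν i).1) := by
  simp only [prod_inVarsHom_exactDescentSeries, Nat.cast_sum, Finset.sum_mul]
  exact Finset.sum_comm

variable {R : SkewShape}

theorem SkewShape.IsRibbon.inter_ndes_union_d_iff [NeZero k] (hR : R.IsRibbon)
    {J : Fin k → Finset ℕ} (hJ : ∀ i, J i ⊆ R.innerRows) {T : Finset ℕ} (hT : T ⊆ R.innerRows) :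
    (∀ x, (∀ i, x ∈ R.ndes ∪ d (J i) R) ↔ x ∈ R.ndes ∪ d T R) ↔
      ∀ x, (∀ i, x ∈ J i) ↔ x ∈ T := by
  constructor
  · intro h x
    by_cases hx : x ∈ R.innerRows
    · simpa only [hR.prefixSize_mem_ndes_union_d_iff (hJ _),
        hR.prefixSize_mem_ndes_union_d_iff hT] using h (R.prefixSize x)
    · exact iff_of_false (fun h' => hx (hJ 0 (h' 0))) fun h' => hx (hT h')
  · intro h x
    simp only [hR.mem_ndes_union_d_iff (hJ _), hR.mem_ndes_union_d_iff hT, ← h]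
    exact ⟨fun hx => ⟨(hx 0).1, fun j hj hjx i => (hx i).2 j hj hjx⟩,
      fun hx i => ⟨hx.1, fun j hj hjx => hx.2 j hj hjx i⟩⟩

theorem SkewShape.IsRibbon.sum_tuplesWithInter_ndes_union_d [NeZero k] {A : Type*}
    [AddCommMonoid A] (hR : R.IsRibbon) (T : Finset ℕ) (F : (Fin k → Finset ℕ) → A) :
    ∑ J ∈ tuplesWithInter (fun _ => R.innerRows) T, F (fun i => R.ndes ∪ d (J i) R) =
      ∑ B ∈ tuplesWithInter (fun _ => Finset.Icc 1 (R.size - 1)) (R.ndes ∪ d T R), F B := by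
  refine Finset.sum_bij (fun J _ i => R.ndes ∪ d (J i) R) (fun J hJ => ?_)
    (fun J hJ J' hJ' h => ?_) (fun B hB => ?_) fun _ _ => rfl
  · obtain ⟨hJ, hinter⟩ := mem_tuplesWithInter.1 hJ
    have hT : T ⊆ R.innerRows := fun x hx => hJ 0 ((hinter x).2 hx 0)
    exact mem_tuplesWithInter.2 ⟨fun i => hR.ndes_union_d_subset_Icc_iff.2 (hJ i),
      (hR.inter_ndes_union_d_iff hJ hT).2 hinter⟩
  · exact funext fun i => hR.ndes_union_d_injOn ((mem_tuplesWithInter.1 hJ).1 i)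
      ((mem_tuplesWithInter.1 hJ').1 i) (congrFun h i)
  · obtain ⟨hB, hinter⟩ := mem_tuplesWithInter.1 hB
    have hT : T ⊆ R.innerRows :=
      hR.ndes_union_d_subset_Icc_iff.1 fun x hx => hB 0 ((hinter x).2 hx 0)
    choose J hJ hJB using fun i => hR.exists_ndes_union_d_eq (hB i) fun x hx =>
      (hinter x).2 (Finset.mem_union_left _ hx) i
    obtain rfl : (fun i => R.ndes ∪ d (J i) R) = B := funext hJB
    exact ⟨J, mem_tuplesWithInter.2 ⟨hJ, (hR.inter_ndes_union_d_iff hJ hT).1 hinter⟩, rfl⟩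

end Hadamard

end RibbonImmanant

theorem mainTheorem4 (k n : ℕ) (hk : 1 ≤ k) (I : Finset (Fin (n - 1))) :
    (∀ R : Fin k → SkewShape, (∀ i, (R i).IsRibbon) → (∀ i, (R i).length ≤ n) →
      tlImmanant (tau I) (hadamardProd fun i => (jacobiTrudi n (R i)).map (inVars i)) =
        ∑ ν : (i : Fin k) → PartitionOf (R i).size,
          ((∑ J ∈ tuplesWithInter (fun i => (R i).innerRows) (oneBased I),
              ∏ i, sytCount (ν i).1 ((R i).ndes ∪ SkewShape.d (J i) (R i)) : ℕ) : MultiSeries k) *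
            ∏ i, inVars i (schur (ν i).1)) ∧
    (∀ R : SkewShape, R.IsRibbon → R.length ≤ n →
      tlImmanant (tau I) (hadamardProd fun i : Fin k => (jacobiTrudi n R).map (inVars i)) =
        ∑ ν : Fin k → PartitionOf R.size,
          ((∑ A ∈ tuplesWithInter (fun _ : Fin k => Finset.Icc 1 (R.size - 1))
                (R.ndes ∪ SkewShape.d (oneBased I) R),
              ∏ i, sytCount (ν i).1 (A i) : ℕ) : MultiSeries k) *
            ∏ i, inVars i (schur (ν i).1)) := by
  have : NeZero k := ⟨Nat.one_le_iff_ne_zero.1 hk⟩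
  refine ⟨fun R hR hn => ?_, fun R hR hn => ?_⟩
  · rw [tlImmanant_hadamardProd_jacobiTrudi I hR hn]
    exact sum_prod_inVarsHom_exactDescentSeries _ (fun i => (R i).size) fun i J =>
      (R i).ndes ∪ SkewShape.d J (R i)
  · rw [tlImmanant_hadamardProd_jacobiTrudi I (fun _ => hR) fun _ => hn,
      hR.sum_tuplesWithInter_ndes_union_d (oneBased I) fun B =>
        ∏ i, inVarsHom i (exactDescentSeries (B i) R.size)]
    exact sum_prod_inVarsHom_exactDescentSeries _ (fun _ => R.size) fun _ A => A
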